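/- Let $K$ be an infinite field and let $A$ be an abelian group, on which all groups below act trivially. Let $St(K)$ be the (stable) Steinberg group of $K$, with generators $x_{ij}(a)$ ($i\neq j$ in $\mathbb{N}=\{0,1,2,\dots\}$, $a\in K$) and relations $x_{ij}(a)x_{ij}(b)=x_{ij}(a+b)$, $[x_{ij}(a),x_{jk}(b)]=x_{ik}(ab)$ for $i\neq k$, and $[x_{ij}(a),x_{kl}(b)]=1$ for $j\neq k$, $i\neq l$. Let $SL(K)=\varinjlim_n SL_n(K)$, and let $K_2(K)$ be the kernel of the homomorphism $St(K)\to SL(K)$, $x_{ij}(a)\mapsto 1+aE_{ij}$. Let $\widetilde{SL_2(K)}=St(K)\times_{SL(K)}SL_2(K)$ be the pullback along the embedding $B\mapsto \mathrm{diag}(B,1,1,\dots)$ of $SL_2(K)$ in $SL(K)$. The group $K^*$ acts on $St(K)$ by $u\cdot x_{ij}(a)=x_{ij}(d_i a d_j^{-1})$, where $d_0=u$ and $d_i=1$ for $i\geq 1$ (this lifts conjugation by $\mathrm{diag}(u,1,1,\dots)$ on $SL(K)$), it acts on $SL_2(K)$ by conjugation by $\mathrm{diag}(u,1)$, and hence it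 acts on $\widetilde{SL_2(K)}$. Put $\widehat{GL_2(K)}=\widetilde{SL_2(K)}\rtimes K^*$, with the projection $\pi:\widehat{GL_2(K)}\to GL_2(K)$, $((s,B),u)\mapsto B\cdot\mathrm{diag}(u,1)$. Then the following hold. 1. The group extension $1\to K_2(K)\to\widehat{GL_2(K)}\xrightarrow{\pi}GL_2(K)\to 1$ is central, and it splits over the subgroup $K^*\subset GL_2(K)$, $u\mapsto\mathrm{diag}(u,1)$. 2. There is an isomorphism of abelian groups $$H^2(K^*,A)\oplus \mathrm{Hom}(K_2(K),A)\;\xrightarrow{\ \sim\ }\;H^2(GL_2(K),A)$$ whose restriction to $H^2(K^*,A)$ is the inflation map $\det^*$ induced by $\det:GL_2(K)\to K^*$, and whose restriction to $\mathrm{Hom}(K_2(K),A)$ sends $\varphi$ to the class of the central extension of $GL_2(K)$ by $A$ obtained by pushing the extension in 1 forward along $\varphi$, that is, to the class of the 2-cocycle $(g,h)\mapsto\varphi\bigl(s(g)s(h)s(gh)^{-1}\bigr)$ for any set-theoretic section $s$ of $\pi$. -/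

import Mathlib

open Matrix CategoryTheory

universe u

namespace Steinberg

open scoped commutatorElement

noncomputable section

/-! ### The second cohomology group with trivial coefficients -/

/-- `H²(G, A)` for a group `G` acting trivially on the abelian group `A` (that is, on the
`ℤ`-module `A`; Mathlib asks for the base ring to live in the universe of `G`). -/
abbrev trivRep (G A : Type u) [Group G] [AddCommGroup A] : Rep (ULift.{u} ℤ) G :=
  Rep.trivial (ULift.{u} ℤ) G A

/-- `H²(G, A)` for the trivial action of `G` on `A`. -/
abbrev H2 (G A : Type u) [Group G] [AddCommGroup A] : Type u :=
  groupCohomology.H2 (trivRep G A)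

/-- The map `f^* : H²(H, A) → H²(G, A)` induced by a group homomorphism `f : G → H`. -/
def H2map {G H : Type u} (A : Type u) [Group G] [Group H] [AddCommGroup A] (f : G →* H) :
    H2 H A →+ H2 G A :=
  (groupCohomology.map (A := trivRep H A) (B := trivRep G A) f (𝟙 (trivRep G A)) 2).hom.toAddMonoidHom

/-- The factor set `(g, h) ↦ s(g) s(h) s(gh)⁻¹` of a set-theoretic section `s` of a group extension
`1 → N → E → G → 1`, as a function with values in `N`. -/
def factorSet {N E G : Type*} [Group N] [Group E] [Group G] {S : GroupExtension N E G}
    (s : S.Section) (p : G × G) : N :=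
  (MonoidHom.ofInjective S.inl_injective).symm
    ⟨s p.1 * s p.2 * (s (p.1 * p.2))⁻¹, by
      rw [S.range_inl_eq_ker_rightHom, MonoidHom.mem_ker]
      simp⟩

/-- `c ∈ H²(G, A)` is the class of the extension of `G` by `A` obtained by pushing
`1 → N → E → G → 1` forward along `φ : N → A`: for every set-theoretic section `s`, the function
`(g, h) ↦ φ (s(g) s(h) s(gh)⁻¹)` is a 2-cocycle and `c` is its class. -/
def IsPushforwardClass {N E G A : Type u} [Group N] [Group E] [Group G] [AddCommGroup A]
    (S : GroupExtension N E G) (φ : Additive N →+ A) (c : H2 G A) : Prop :=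
  ∀ s : S.Section,
    ∃ h : (fun p : G × G => φ (Additive.ofMul (factorSet s p))) ∈
        groupCohomology.cocycles₂ (trivRep G A),
      c = groupCohomology.H2π (trivRep G A) ⟨_, h⟩

/-! ### The Steinberg group -/

/-- Symbols `x_{ij}(a)` with `i ≠ j` natural numbers and `a ∈ K`. -/
structure Gen (K : Type u) where
  i : ℕ
  j : ℕ
  ne : i ≠ j
  a : K

/-- The symbol `x_{ij}(a)` as an element of the free group on all symbols. -/
abbrev x {K : Type u} (i j : ℕ) (h : i ≠ j) (a : K) : FreeGroup (Gen K) :=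
  FreeGroup.of ⟨i, j, h, a⟩

variable (K : Type u) [Field K]

/-- The Steinberg relators: `x_{ij}(a) x_{ij}(b) = x_{ij}(a + b)`,
`[x_{ij}(a), x_{jk}(b)] = x_{ik}(ab)` for `i ≠ k`, and `[x_{ij}(a), x_{kl}(b)] = 1` for `j ≠ k` and
`i ≠ l`. -/
inductive IsRel : FreeGroup (Gen K) → Prop
  | add (i j : ℕ) (h : i ≠ j) (a b : K) :
      IsRel (x i j h a * x i j h b * (x i j h (a + b))⁻¹)
  | comm_mul (i j k : ℕ) (hij : i ≠ j) (hjk : j ≠ k) (hik : i ≠ k) (a b : K) :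
      IsRel (⁅x i j hij a, x j k hjk b⁆ * (x i k hik (a * b))⁻¹)
  | comm_one (i j k l : ℕ) (hij : i ≠ j) (hkl : k ≠ l) (hjk : j ≠ k) (hil : i ≠ l) (a b : K) :
      IsRel ⁅x i j hij a, x k l hkl b⁆

/-- The set of Steinberg relators. -/
def Rels : Set (FreeGroup (Gen K)) := {r | IsRel K r}

/-- The (stable) Steinberg group `St(K)`. -/
abbrev St : Type u := PresentedGroup (Rels K)

/-! ### The group `SL(K) = lim SL_n(K)` -/

/-- `GL(K^(ℕ))`, in which all the groups `SL_n(K)` are realized compatibly. -/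
abbrev GLinf : Type u := LinearMap.GeneralLinearGroup K (ℕ →₀ K)

/-- The inclusion `K^n → K^(ℕ)` onto the first `n` coordinates. -/
def incl (n : ℕ) : (Fin n → K) →ₗ[K] (ℕ →₀ K) :=
  ∑ i : Fin n, (Finsupp.lsingle (i : ℕ)).comp (LinearMap.proj i)

/-- The projection `K^(ℕ) → K^n` to the first `n` coordinates. -/
def proj (n : ℕ) : (ℕ →₀ K) →ₗ[K] (Fin n → K) :=
  LinearMap.pi fun i => Finsupp.lapply (i : ℕ)

variable {K} in
theorem proj_comp_incl (n : ℕ) : (proj K n).comp (incl K n) = LinearMap.id := by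
  apply LinearMap.ext
  intro v
  funext j
  simp only [proj, incl, LinearMap.comp_apply, LinearMap.pi_apply, LinearMap.sum_apply, map_sum,
    Finsupp.lapply_apply, Finsupp.lsingle_apply, LinearMap.proj_apply, LinearMap.id_apply,
    Finsupp.single_apply]
  rw [Finset.sum_eq_single j]
  · simp
  · intro b _ hb
    rw [if_neg]
    exact fun h => hb (Fin.ext h)
  · simp

/-- A matrix `A` of size `n` acting on `K^(ℕ)` as the block matrix `diag(A, 1, 1, …)`: it is `A` on
the first `n` coordinates and the identity on the others. -/
def blockEnd (n : ℕ) : Matrix (Fin n) (Fin n) K →* Module.End K (ℕ →₀ K) where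
  toFun A := LinearMap.id + (incl K n).comp ((Matrix.toLin' A - LinearMap.id).comp (proj K n))
  map_one' := by
    simp only [Matrix.toLin'_one, sub_self, LinearMap.zero_comp, LinearMap.comp_zero, add_zero]
    rfl
  map_mul' A B := by
    apply LinearMap.ext
    intro v
    have h : ∀ w, proj K n (incl K n w) = w := fun w =>
      LinearMap.congr_fun (proj_comp_incl (K := K) n) w
    simp only [Module.End.mul_apply, LinearMap.add_apply, LinearMap.id_apply,
      LinearMap.comp_apply, LinearMap.sub_apply, Matrix.toLin'_mul, map_add, map_sub, h]
    abel

/-- The embedding `GL_n(K) → GL(K^(ℕ))`, `g ↦ diag(g, 1, 1, …)`. -/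
def blockGL (n : ℕ) : GL (Fin n) K →* GLinf K := Units.map (blockEnd K n)

/-- The group `SL(K)`: the union of the groups `SL_n(K)`, each embedded by
`A ↦ diag(A, 1, 1, …)`. -/
def SLinf : Subgroup (GLinf K) :=
  ⨆ n : ℕ, ((blockGL K n).comp (SpecialLinearGroup.toGL (n := Fin n) (R := K))).range

/-- The embedding `SL_n(K) → SL(K)`. -/
def blockSL (n : ℕ) : SpecialLinearGroup (Fin n) K →* SLinf K :=
  ((blockGL K n).comp (SpecialLinearGroup.toGL (n := Fin n) (R := K))).codRestrict (SLinf K)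
    fun A => Subgroup.mem_iSup_of_mem n ⟨A, rfl⟩

/-! ### The homomorphism `St(K) → SL(K)` and `K_2(K)` -/

/-- The matrix unit `E_{ij}` as an endomorphism of `K^(ℕ)`. -/
def E (i j : ℕ) : Module.End K (ℕ →₀ K) := (Finsupp.lsingle i).comp (Finsupp.lapply j)

variable {K}

theorem E_mul_same (i j k : ℕ) : E K i j * E K j k = E K i k := by
  apply LinearMap.ext
  intro v
  simp [E]

theorem E_mul_ne {i j k l : ℕ} (h : j ≠ k) : E K i j * E K k l = 0 := by
  apply LinearMap.ext
  intro v
  simp [E, h.symm]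

/-- The elementary matrix `1 + a E_{ij}`, where `i ≠ j`. -/
def elem (x : Gen K) : GLinf K where
  val := 1 + x.a • E K x.i x.j
  inv := 1 + (-x.a) • E K x.i x.j
  val_inv := by
    simp only [mul_add, add_mul, one_mul, mul_one, smul_mul_smul_comm, E_mul_ne x.ne.symm,
      smul_zero, add_zero]
    rw [add_assoc, ← add_smul, add_neg_cancel, zero_smul, add_zero]
  inv_val := by
    simp only [mul_add, add_mul, one_mul, mul_one, smul_mul_smul_comm, E_mul_ne x.ne.symm,
      smul_zero, add_zero]
    rw [add_assoc, ← add_smul, neg_add_cancel, zero_smul, add_zero]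

theorem elem_val (x : Gen K) : (elem x : Module.End K (ℕ →₀ K)) = 1 + x.a • E K x.i x.j := rfl

theorem blockGL_transvection {n : ℕ} (i j : Fin n) (h : i ≠ j) (a : K) (g : GL (Fin n) K)
    (hg : (g : Matrix (Fin n) (Fin n) K) = Matrix.transvection i j a) :
    blockGL K n g = elem ⟨i, j, fun e => h (Fin.ext e), a⟩ := by
  apply Units.ext
  apply LinearMap.ext
  intro v
  have h1 : ((blockGL K n g : GLinf K) : Module.End K (ℕ →₀ K)) =
    LinearMap.id + (incl K n).comp ((Matrix.toLin' (g : Matrix (Fin n) (Fin n) K)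
      - LinearMap.id).comp (proj K n)) := rfl
  rw [h1, elem_val, hg, Matrix.transvection, map_add, Matrix.toLin'_one, add_sub_cancel_left]
  simp only [LinearMap.add_apply, LinearMap.id_apply, Module.End.one_apply, LinearMap.comp_apply,
    LinearMap.smul_apply, Matrix.toLin'_apply]
  congr 1
  rw [Matrix.single_mulVec]
  simp only [incl, LinearMap.sum_apply, LinearMap.comp_apply, LinearMap.proj_apply, E, proj,
    LinearMap.pi_apply, Finsupp.lapply_apply, Finsupp.lsingle_apply]
  rw [Finset.sum_eq_single i]
  · simp
  · intro b _ hb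
    simp [hb]
  · simp

theorem elem_mem (x : Gen K) : elem x ∈ SLinf K := by
  obtain ⟨i, j, h, a⟩ := x
  let n := max i j + 1
  let i' : Fin n := ⟨i, by omega⟩
  let j' : Fin n := ⟨j, by omega⟩
  have h' : i' ≠ j' := fun e => h (congrArg Fin.val e)
  refine Subgroup.mem_iSup_of_mem n
    ⟨⟨Matrix.transvection i' j' a, Matrix.det_transvection_of_ne i' j' h' a⟩, ?_⟩
  exact blockGL_transvection i' j' h' a _ rfl

theorem elem_rels : ∀ r ∈ Rels K, FreeGroup.lift (elem (K := K)) r = 1 := by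
  rintro _ (⟨i, j, h, a, b⟩ | ⟨i, j, k, hij, hjk, hik, a, b⟩ | ⟨i, j, k, l, hij, hkl, hjk, hil, a, b⟩)
  · simp only [map_mul, map_inv, FreeGroup.lift_apply_of]
    rw [mul_inv_eq_one]
    apply Units.ext
    simp only [Units.val_mul, elem_val]
    have h2 : (a • E K i j) * (b • E K i j) = 0 := by
      rw [smul_mul_smul_comm, E_mul_ne h.symm, smul_zero]
    rw [add_smul, mul_add, add_mul, add_mul, h2]
    noncomm_ring
  · simp only [map_mul, map_inv, FreeGroup.lift_apply_of, map_commutatorElement]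
    rw [mul_inv_eq_one, commutatorElement_def, mul_inv_eq_iff_eq_mul, mul_inv_eq_iff_eq_mul]
    apply Units.ext
    simp only [Units.val_mul, elem_val]
    simp only [mul_add, add_mul, one_mul, mul_one, smul_mul_smul_comm, E_mul_same,
      E_mul_ne hjk.symm, E_mul_ne hik.symm, smul_zero, add_zero]
    abel
  · simp only [FreeGroup.lift_apply_of, map_commutatorElement]
    rw [commutatorElement_eq_one_iff_mul_comm]
    apply Units.ext
    simp only [Units.val_mul, elem_val]
    simp only [mul_add, add_mul, one_mul, mul_one, smul_mul_smul_comm,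
      E_mul_ne hjk, E_mul_ne hil.symm, smul_zero, add_zero]
    abel

variable (K) in
/-- The homomorphism `St(K) → GL(K^(ℕ))`, `x_{ij}(a) ↦ 1 + a E_{ij}`. -/
def toGLinf : St K →* GLinf K := PresentedGroup.toGroup elem_rels

theorem toGLinf_of (x : Gen K) : toGLinf K (PresentedGroup.of x) = elem x :=
  PresentedGroup.toGroup.of _

theorem toGLinf_mem (s : St K) : toGLinf K s ∈ SLinf K := by
  have h : (⊤ : Subgroup (St K)) ≤ (SLinf K).comap (toGLinf K) := by
    rw [← PresentedGroup.closure_range_of (Rels K), Subgroup.closure_le]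
    rintro _ ⟨x, rfl⟩
    change toGLinf K (PresentedGroup.of x) ∈ SLinf K
    rw [toGLinf_of]
    exact elem_mem x
  exact h (Subgroup.mem_top s)

variable (K)

/-- The canonical homomorphism `St(K) → SL(K)`. -/
def toSL : St K →* SLinf K := (toGLinf K).codRestrict (SLinf K) toGLinf_mem

/-- `K_2(K)`, the kernel of `St(K) → SL(K)`. -/
def K2 : Subgroup (St K) := (toSL K).ker

/-- The pullback of `St(K) → SL(K)` along the embedding of `SL_2(K)` into `SL(K)`. -/
def SL2tilde : Subgroup (St K × SpecialLinearGroup (Fin 2) K) :=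
  MonoidHom.eqLocus ((toSL K).comp (MonoidHom.fst _ _)) ((blockSL K 2).comp (MonoidHom.snd _ _))

/-! ### The action of `K^*` -/

variable {K}

/-- An action of a group by endomorphisms is an action by automorphisms. -/
def autOfEnd {G H : Type*} [Group G] [Group H] (f : G →* Monoid.End H) : G →* MulAut H where
  toFun g :=
    { toFun := f g
      invFun := f g⁻¹
      left_inv := fun x => by
        change (f g⁻¹ * f g) x = x
        rw [← map_mul, inv_mul_cancel, map_one]; rfl
      right_inv := fun x => by
        change (f g * f g⁻¹) x = x
        rw [← map_mul, mul_inv_cancel, map_one]; rfl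
      map_mul' := fun x y => map_mul (f g) x y }
  map_one' := by
    ext x
    change f 1 x = x
    rw [map_one]; rfl
  map_mul' g h := by
    ext x
    change f (g * h) x = f g (f h x)
    rw [map_mul]; rfl

/-- The diagonal matrix with diagonal entries `u, 1, 1, …`, entry by entry. -/
def dg (u : Kˣ) (i : ℕ) : Kˣ := if i = 0 then u else 1

theorem dg_mul (u v : Kˣ) (i : ℕ) : dg (u * v) i = dg u i * dg v i := by
  unfold dg; split_ifs <;> simp

theorem dg_one (i : ℕ) : dg (1 : Kˣ) i = 1 := by
  unfold dg; split_ifs <;> simp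

/-- Conjugation by `diag(u, 1, 1, …)` on symbols: `x_{ij}(a) ↦ x_{ij}(d_i a d_j⁻¹)`. -/
def genAct (u : Kˣ) (x : Gen K) : Gen K :=
  ⟨x.i, x.j, x.ne, (dg u x.i : K) * x.a * ((dg u x.j)⁻¹ : Kˣ)⟩

theorem of_rel {r : FreeGroup (Gen K)} (hr : r ∈ Rels K) : (PresentedGroup.mk (Rels K) r) = 1 :=
  (QuotientGroup.eq_one_iff r).2 (Subgroup.subset_normalClosure hr)

theorem act_rels (u : Kˣ) : ∀ r ∈ Rels K,
    FreeGroup.lift (fun x : Gen K => (PresentedGroup.of (genAct u x) : St K)) r = 1 := by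
  rintro _ (⟨i, j, h, a, b⟩ | ⟨i, j, k, hij, hjk, hik, a, b⟩ | ⟨i, j, k, l, hij, hkl, hjk, hil, a, b⟩)
  · have := of_rel (IsRel.add i j h ((dg u i : K) * a * ((dg u j)⁻¹ : Kˣ))
      ((dg u i : K) * b * ((dg u j)⁻¹ : Kˣ)))
    rw [← add_mul, ← mul_add] at this
    simp only [map_mul, map_inv, FreeGroup.lift_apply_of]
    exact this
  · have := of_rel (IsRel.comm_mul i j k hij hjk hik ((dg u i : K) * a * ((dg u j)⁻¹ : Kˣ))
      ((dg u j : K) * b * ((dg u k)⁻¹ : Kˣ)))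
    have e : (dg u i : K) * a * ((dg u j)⁻¹ : Kˣ) * ((dg u j : K) * b * ((dg u k)⁻¹ : Kˣ)) =
        (dg u i : K) * (a * b) * ((dg u k)⁻¹ : Kˣ) := by
      have : (((dg u j)⁻¹ : Kˣ) : K) * (dg u j : K) = 1 := Units.inv_mul _
      linear_combination (dg u i : K) * a * b * ((dg u k)⁻¹ : Kˣ) * this
    rw [e] at this
    simp only [map_mul, map_inv, FreeGroup.lift_apply_of, map_commutatorElement]
    exact this
  · have := of_rel (IsRel.comm_one i j k l hij hkl hjk hil ((dg u i : K) * a * ((dg u j)⁻¹ : Kˣ))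
      ((dg u k : K) * b * ((dg u l)⁻¹ : Kˣ)))
    simp only [FreeGroup.lift_apply_of, map_commutatorElement]
    exact this

/-- The endomorphism `x_{ij}(a) ↦ x_{ij}(d_i a d_j⁻¹)` of `St(K)`, with `d = diag(u, 1, 1, …)`. -/
def stEnd (u : Kˣ) : St K →* St K := PresentedGroup.toGroup (act_rels u)

theorem stEnd_of (u : Kˣ) (x : Gen K) :
    stEnd u (PresentedGroup.of x) = PresentedGroup.of (genAct u x) :=
  PresentedGroup.toGroup.of _

/-- The action of `K^*` on `St(K)` that lifts the conjugation by `diag(u, 1, 1, …)` on `SL(K)`. -/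
def stAct : Kˣ →* Monoid.End (St K) where
  toFun u := stEnd u
  map_one' := by
    apply PresentedGroup.ext
    intro x
    refine (stEnd_of 1 x).trans ?_
    simp only [genAct, dg_one, Units.val_one, inv_one, one_mul, mul_one]
    rfl
  map_mul' u v := by
    apply PresentedGroup.ext
    intro x
    refine (stEnd_of (u * v) x).trans ?_
    change _ = stEnd u (stEnd v (PresentedGroup.of x))
    rw [stEnd_of, stEnd_of]
    congr 1
    simp only [genAct, dg_mul, Gen.mk.injEq, true_and, mul_inv, Units.val_mul]
    ring

variable (K) in
/-- The embedding `K^* → GL_2(K)`, `u ↦ diag(u, 1)`, into the upper-left corner. -/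
def diag2 : Kˣ →* GL (Fin 2) K where
  toFun u := ⟨!![(u : K), 0; 0, 1], !![((u⁻¹ : Kˣ) : K), 0; 0, 1],
    by simp [Matrix.one_fin_two], by simp [Matrix.one_fin_two]⟩
  map_one' := by
    apply Units.ext
    simp [Matrix.one_fin_two]
  map_mul' u v := by
    apply Units.ext
    simp

theorem det_diag2 (u : Kˣ) : GeneralLinearGroup.det (diag2 K u) = u := by
  apply Units.ext
  simp [diag2]

/-- Conjugation by `g ∈ GL_2(K)` on `SL_2(K)`. -/
def conjSL (g : GL (Fin 2) K) (B : SpecialLinearGroup (Fin 2) K) : SpecialLinearGroup (Fin 2) K :=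
  ⟨(g * SpecialLinearGroup.toGL B * g⁻¹ : GL (Fin 2) K), by
    change ((GeneralLinearGroup.det (g * SpecialLinearGroup.toGL B * g⁻¹) : Kˣ) : K) = 1
    rw [map_mul, map_mul, map_inv, mul_comm, inv_mul_cancel_left]
    exact B.2⟩

theorem toGL_conjSL (g : GL (Fin 2) K) (B : SpecialLinearGroup (Fin 2) K) :
    SpecialLinearGroup.toGL (conjSL g B) = g * SpecialLinearGroup.toGL B * g⁻¹ :=
  Units.ext rfl

/-- The action of `K^*` on `SL_2(K)` by conjugation by `diag(u, 1)`. -/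
def slAct : Kˣ →* Monoid.End (SpecialLinearGroup (Fin 2) K) where
  toFun u := MonoidHom.mk' (conjSL (diag2 K u)) fun A B => by
    apply SpecialLinearGroup.toGL_injective
    simp only [toGL_conjSL, map_mul]
    group
  map_one' := by
    ext1 B
    apply SpecialLinearGroup.toGL_injective
    refine (toGL_conjSL _ _).trans ?_
    simp
  map_mul' u v := by
    ext1 B
    apply SpecialLinearGroup.toGL_injective
    refine (toGL_conjSL _ _).trans ?_
    change _ = SpecialLinearGroup.toGL (conjSL (diag2 K u) (conjSL (diag2 K v) B))
    simp only [toGL_conjSL, map_mul]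
    group

theorem blockGL_diag2_single (u : Kˣ) (j : ℕ) (a : K) :
    (blockGL K 2 (diag2 K u) : Module.End K (ℕ →₀ K)) (Finsupp.single j a) =
      Finsupp.single j ((dg u j : K) * a) := by
  change (LinearMap.id + (incl K 2).comp ((Matrix.toLin' !![(u : K), 0; 0, 1]
      - LinearMap.id).comp (proj K 2)) : Module.End K (ℕ →₀ K)) (Finsupp.single j a) = _
  simp only [LinearMap.add_apply, LinearMap.id_apply, LinearMap.comp_apply, LinearMap.sub_apply,
    incl, Fin.sum_univ_two, Finsupp.lsingle_apply, LinearMap.proj_apply,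
    Pi.sub_apply, Matrix.toLin'_apply, proj, Matrix.mulVec, dotProduct, LinearMap.pi_apply,
    Finsupp.lapply_apply]
  by_cases hj : j = 0
  · subst hj
    simp [dg]
  · simp [dg, Finsupp.single_apply, hj]

theorem toGLinf_stEnd (u : Kˣ) (s : St K) :
    toGLinf K (stEnd u s) =
      blockGL K 2 (diag2 K u) * toGLinf K s * (blockGL K 2 (diag2 K u))⁻¹ := by
  have h : (toGLinf K).comp (stEnd u) =
      ((MulAut.conj (blockGL K 2 (diag2 K u))).toMonoidHom).comp (toGLinf K) := by
    apply PresentedGroup.ext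
    intro x
    change toGLinf K (stEnd u (PresentedGroup.of x)) =
      blockGL K 2 (diag2 K u) * toGLinf K (PresentedGroup.of x) * (blockGL K 2 (diag2 K u))⁻¹
    rw [stEnd_of, toGLinf_of, toGLinf_of, eq_mul_inv_iff_mul_eq]
    apply Units.ext
    apply Finsupp.lhom_ext
    intro j a
    simp only [Units.val_mul, Module.End.mul_apply, elem_val, LinearMap.add_apply,
      Module.End.one_apply, LinearMap.smul_apply, blockGL_diag2_single, E, LinearMap.comp_apply,
      Finsupp.lapply_apply, Finsupp.lsingle_apply, map_add, map_smul, genAct]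
    congr 1
    by_cases hj : j = x.j
    · subst hj
      simp only [Finsupp.single_eq_same, Finsupp.smul_single, smul_eq_mul]
      congr 1
      have : (((dg u x.j)⁻¹ : Kˣ) : K) * (dg u x.j : K) = 1 := Units.inv_mul _
      linear_combination (dg u x.i : K) * x.a * a * this
    · simp [hj]
  exact DFunLike.congr_fun h s

theorem mem_SL2tilde {x : St K × SpecialLinearGroup (Fin 2) K} :
    x ∈ SL2tilde K ↔ toGLinf K x.1 = blockGL K 2 (SpecialLinearGroup.toGL x.2) :=
  Subtype.ext_iff

theorem act_mem (u : Kˣ) (x : SL2tilde K) :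
    MonoidHom.prodMap (stAct u) (slAct u) x.1 ∈ SL2tilde K := by
  have h := mem_SL2tilde.1 x.2
  refine mem_SL2tilde.2 ?_
  change toGLinf K (stEnd u x.1.1) =
    blockGL K 2 (SpecialLinearGroup.toGL (conjSL (diag2 K u) x.1.2))
  rw [toGLinf_stEnd, toGL_conjSL, h, map_mul, map_mul, map_inv]

/-- The action of `K^*` on the pullback, by the two actions on `St(K)` and `SL_2(K)`. -/
def tildeAct : Kˣ →* Monoid.End (SL2tilde K) where
  toFun u := ((MonoidHom.prodMap (stAct u) (slAct u)).comp (SL2tilde K).subtype).codRestrict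
    (SL2tilde K) (act_mem u)
  map_one' := by
    ext1 x
    apply Subtype.ext
    change (stAct 1 x.1.1, slAct 1 x.1.2) = x.1
    rw [map_one, map_one]
    rfl
  map_mul' u v := by
    ext1 x
    apply Subtype.ext
    change (stAct (u * v) x.1.1, slAct (u * v) x.1.2) =
      (stAct u (stAct v x.1.1), slAct u (slAct v x.1.2))
    rw [map_mul, map_mul]
    rfl

/-! ### The extension of `GL_2(K)` by `K_2(K)` -/

variable (K)

/-- The semidirect product of the pullback of `St(K)` to `SL_2(K)` with `K^*`. -/
abbrev GL2hat : Type u := SL2tilde K ⋊[autOfEnd (tildeAct (K := K))] Kˣ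

/-- The projection to `GL_2(K)`: `((s, B), u) ↦ B · diag(u, 1)`. -/
def toGL2 : GL2hat K →* GL (Fin 2) K :=
  SemidirectProduct.lift
    ((SpecialLinearGroup.toGL (n := Fin 2) (R := K)).comp
      ((MonoidHom.snd _ _).comp (SL2tilde K).subtype))
    (diag2 K)
    (fun u => by
      ext1 x
      exact toGL_conjSL (diag2 K u) x.1.2)

/-- The inclusion `K_2(K) → SL_2~(K)`, `c ↦ (c, 1)`. -/
def K2toTilde : K2 K →* SL2tilde K :=
  ((MonoidHom.inl (St K) (SpecialLinearGroup (Fin 2) K)).comp (K2 K).subtype).codRestrict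
    (SL2tilde K) fun c => by
      change toSL K c.1 = blockSL K 2 1
      rw [map_one]
      exact c.2

variable {K}

theorem toGL2_apply (x : GL2hat K) :
    toGL2 K x = SpecialLinearGroup.toGL x.left.1.2 * diag2 K x.right := rfl

theorem exists_lift (B : SpecialLinearGroup (Fin 2) K) :
    ∃ s : St K, (s, B) ∈ SL2tilde K := by
  suffices h : B ∈ ((SL2tilde K).map (MonoidHom.snd (St K) (SpecialLinearGroup (Fin 2) K))) by
    obtain ⟨x, hx, rfl⟩ := h
    exact ⟨x.1, hx⟩
  set H := (SL2tilde K).map (MonoidHom.snd (St K) (SpecialLinearGroup (Fin 2) K))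
  have key : ∀ (i j : Fin 2) (h : i ≠ j) (a : K),
      (⟨Matrix.transvection i j a, Matrix.det_transvection_of_ne i j h a⟩ :
        SpecialLinearGroup (Fin 2) K) ∈ H := by
    intro i j h a
    refine ⟨(PresentedGroup.of ⟨i, j, fun e => h (Fin.ext e), a⟩, _), ?_, rfl⟩
    refine mem_SL2tilde.2 ?_
    rw [toGLinf_of]
    exact (blockGL_transvection i j h a _ rfl).symm
  have h01 : ∀ C : SpecialLinearGroup (Fin 2) K, C.1 1 0 ≠ 0 → C ∈ H := by
    intro C hC
    have hd : C.1 0 0 * C.1 1 1 - C.1 0 1 * C.1 1 0 = 1 := by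
      rw [← Matrix.det_fin_two]; exact C.2
    have e : C = ⟨_, Matrix.det_transvection_of_ne 0 1 (by decide) ((C.1 0 0 - 1) / C.1 1 0)⟩ *
        ⟨_, Matrix.det_transvection_of_ne 1 0 (by decide) (C.1 1 0)⟩ *
        ⟨_, Matrix.det_transvection_of_ne 0 1 (by decide) ((C.1 1 1 - 1) / C.1 1 0)⟩ := by
      apply Subtype.ext
      change C.1 = Matrix.transvection 0 1 ((C.1 0 0 - 1) / C.1 1 0) *
        Matrix.transvection 1 0 (C.1 1 0) * Matrix.transvection 0 1 ((C.1 1 1 - 1) / C.1 1 0)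
      ext i j
      fin_cases i <;> fin_cases j <;>
        simp [Matrix.transvection, Matrix.mul_apply, Matrix.one_apply, Matrix.single_apply] <;>
        field_simp
      · ring
      · linear_combination (-1 : K) * hd
      · ring
    rw [e]
    exact H.mul_mem (H.mul_mem (key _ _ (by decide) _) (key _ _ (by decide) _))
      (key _ _ (by decide) _)
  by_cases hB : B.1 1 0 = 0
  · have hd : B.1 0 0 * B.1 1 1 - B.1 0 1 * B.1 1 0 = 1 := by
      rw [← Matrix.det_fin_two]; exact B.2
    have ha : B.1 0 0 ≠ 0 := by
      intro h0
      rw [h0, hB] at hd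
      simp at hd
    have ht := key 1 0 (by decide) 1
    refine (H.mul_mem_cancel_left ht).1 (h01 _ ?_)
    change (Matrix.transvection (1 : Fin 2) 0 (1 : K) * B.1 : Matrix (Fin 2) (Fin 2) K) 1 0 ≠ 0
    simpa [Matrix.transvection, Matrix.mul_apply, Matrix.one_apply, Matrix.single_apply, hB]
      using ha
  · exact h01 B hB

variable (K) in
/-- The extension `1 → K_2(K) → GL_2^(K) → GL_2(K) → 1`. -/
def steinbergExt : GroupExtension (K2 K) (GL2hat K) (GL (Fin 2) K) where
  inl := SemidirectProduct.inl.comp (K2toTilde K)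
  rightHom := toGL2 K
  inl_injective := by
    refine SemidirectProduct.inl_injective.comp fun c d h => ?_
    exact Subtype.ext (congrArg (fun x : SL2tilde K => x.1.1) h)
  range_inl_eq_ker_rightHom := by
    ext x
    rw [MonoidHom.mem_ker, toGL2_apply]
    constructor
    · rintro ⟨c, rfl⟩
      change SpecialLinearGroup.toGL 1 * diag2 K 1 = 1
      simp
    · intro h
      have hu : x.right = 1 := by
        have := congrArg GeneralLinearGroup.det h
        rw [map_mul, det_diag2, map_one] at this
        have h2 : GeneralLinearGroup.det (SpecialLinearGroup.toGL x.left.1.2) = 1 :=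
          Units.ext x.left.1.2.2
        rwa [h2, one_mul] at this
      rw [hu, map_one, mul_one] at h
      have hB : x.left.1.2 = 1 :=
        SpecialLinearGroup.toGL_injective (h.trans (map_one _).symm)
      have hs : x.left.1.1 ∈ K2 K := by
        have := x.left.2
        change toSL K x.left.1.1 = blockSL K 2 x.left.1.2 at this
        rw [hB, map_one] at this
        exact this
      refine ⟨⟨x.left.1.1, hs⟩, ?_⟩
      refine SemidirectProduct.ext ?_ hu.symm
      exact Subtype.ext (Prod.ext rfl hB.symm)
  rightHom_surjective := by
    intro g
    have hdet : GeneralLinearGroup.det (g * (diag2 K (GeneralLinearGroup.det g))⁻¹) = 1 := by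
      rw [map_mul, map_inv, det_diag2, mul_inv_cancel]
    let B : SpecialLinearGroup (Fin 2) K :=
      ⟨(g * (diag2 K (GeneralLinearGroup.det g))⁻¹ : GL (Fin 2) K), congrArg Units.val hdet⟩
    obtain ⟨s, hs⟩ := exists_lift B
    refine ⟨⟨⟨(s, B), hs⟩, GeneralLinearGroup.det g⟩, ?_⟩
    rw [toGL2_apply]
    have hB : SpecialLinearGroup.toGL B = g * (diag2 K (GeneralLinearGroup.det g))⁻¹ :=
      Units.ext rfl
    change SpecialLinearGroup.toGL B * diag2 K (GeneralLinearGroup.det g) = g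
    rw [hB, inv_mul_cancel_right]

end

end Steinberg

namespace Steinberg

open scoped commutatorElement

noncomputable section

section

/-! ### Groups of rank one -/

/-! The composite of `diag2` with `det` is the identity of `Kˣ`, so inflation along `det` is split
by restriction to the torus `diag(u, 1)`. The torus lifts to the extension, so push-forwards
restrict to zero on it. It remains to see that push-forward identifies `Hom(K_2(K), A)` with the
classes that vanish on the torus.

Centrality. `K_2(K)` is central in `St(K)` (`K2_le_center`), and `Kˣ` fixes it pointwise, because on
an element involving finitely many indices it acts like an inner automorphism (`stEnd_of_mem_K2`).

Injectivity. If the push-forward along `φ` splits, `φ` extends to a homomorphism from the whole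
extension to `A`. Such a homomorphism kills the root elements, since the torus rescales them. Hence
it kills the Steinberg symbols, which generate `K_2(K)` by the Bruhat decomposition of `St(K)`
(`K2_eq_symGroupS`).

Surjectivity. A class that vanishes on the torus is a central extension of `GL_2(K)` with a lifted
torus. Commutators with torus elements give canonical lifts of elementary matrices (`rootLift`), and
these form a rank one pair. Its symbols `h(u) h(v) h(uv)⁻¹` are commutators of elements of two
lifted tori, hence bimultiplicative, and they satisfy the Steinberg relation by a computation with
Weyl elements. By Matsumoto's theorem (`exists_hom_of_symbol`) they come from some `φ : K_2(K) → A`.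
In the product of the two extensions, the subgroup generated by the paired root elements and torus
meets the kernel in the graph of `φ`, again by Bruhat decomposition. So the given extension is the
push-forward along `φ` (`exists_pushHom_eq`).

Matsumoto's theorem. From a symbol one builds central extensions of all `GL_n(K)`, `n ≥ 2`. A triple
of sequences of vectors in general position gets a value in `A`, a sum over the lattice points of a
triangle of an expression in the symbols of minors. It is a cocycle because the Plücker relation
turns the Steinberg relation into a vanishing sum over an octahedron (`flagCocycle_eq`). The
extension consists of pairs `(g, F)`, where `F` is a function on generic sequences whose differences
record how the cocycle changes when `g` moves the base point. For diagonal matrices `F` is explicit,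
and commutators return the original symbol. Canonical lifts satisfy the Steinberg relations, so
every word representing an element of `K_2(K)` takes a well-defined constant value in the extensions
for large `n`. -/

/-- A pair of opposite root subgroups, parametrized by a field `K`, whose Weyl elements exchange the
two subgroups as in `SL_2(K)`. -/
structure RankOne (K E : Type*) [Field K] [Group E] where
  x : K → E
  y : K → E
  x_add : ∀ a b, x (a + b) = x a * x b
  y_add : ∀ a b, y (a + b) = y a * y b
  weyl : ∀ u : K, u ≠ 0 → ∀ a, x u * y (-u⁻¹) * x u * x a = y (-(a / u ^ 2)) * (x u * y (-u⁻¹) * x u)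

namespace RankOne

variable {K E : Type*} [Field K] [Group E] (R : RankOne K E)

theorem x_zero : R.x 0 = 1 := by
  have := R.x_add 0 0
  rwa [add_zero, left_eq_mul] at this

theorem y_zero : R.y 0 = 1 := by
  have := R.y_add 0 0
  rwa [add_zero, left_eq_mul] at this

theorem x_neg (a : K) : R.x (-a) = (R.x a)⁻¹ := by
  rw [eq_inv_iff_mul_eq_one, ← R.x_add, neg_add_cancel, R.x_zero]

theorem y_neg (a : K) : R.y (-a) = (R.y a)⁻¹ := by
  rw [eq_inv_iff_mul_eq_one, ← R.y_add, neg_add_cancel, R.y_zero]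

/-- The Weyl element `w(u) = x(u) y(-u⁻¹) x(u)`. -/
def w (u : K) : E := R.x u * R.y (-u⁻¹) * R.x u

theorem w_neg (u : K) : R.w (-u) = (R.w u)⁻¹ := by
  simp only [w, inv_neg, neg_neg, R.x_neg, R.y_neg]
  group

theorem w_mul_x {u : K} (hu : u ≠ 0) (a : K) : R.w u * R.x a = R.y (-(a / u ^ 2)) * R.w u :=
  R.weyl u hu a

theorem w_mul_y {u : K} (hu : u ≠ 0) (a : K) : R.w u * R.y a = R.x (-(u ^ 2 * a)) * R.w u := by
  have h := R.w_mul_x (neg_ne_zero.2 hu) (-(u ^ 2 * a))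
  have e : -(-(u ^ 2 * a) / (-u) ^ 2) = a := by
    field_simp
  rw [e, R.w_neg, inv_mul_eq_iff_eq_mul, ← mul_assoc, eq_mul_inv_iff_mul_eq] at h
  exact h.symm

theorem x_mul_w {u : K} (hu : u ≠ 0) (a : K) : R.x a * R.w u = R.w u * R.y (-(a / u ^ 2)) := by
  rw [R.w_mul_y hu]
  congr 2
  field_simp

theorem y_mul_w {u : K} (hu : u ≠ 0) (a : K) : R.y a * R.w u = R.w u * R.x (-(u ^ 2 * a)) := by
  rw [R.w_mul_x hu]
  congr 2
  field_simp

/-- Conjugation by `w(u)` exchanges `x(u)` and `y(-u⁻¹)`. Pushing one factor of `w(u) w(u)` through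
the word of the other swaps the roles of `x` and `y`, and one factor cancels. -/
theorem w_eq {u : K} (hu : u ≠ 0) : R.w u = R.y (-u⁻¹) * R.x u * R.y (-u⁻¹) := by
  have h1 : R.w u * R.y (-u⁻¹) = R.x u * R.w u := by
    rw [R.w_mul_y hu]
    congr 2
    field_simp
  have h2 : R.w u * R.x u = R.y (-u⁻¹) * R.w u := by
    rw [R.w_mul_x hu]
    congr 2
    field_simp
  have h : R.w u * R.w u = R.y (-u⁻¹) * R.x u * R.y (-u⁻¹) * R.w u := by
    calc R.w u * R.w u = R.w u * (R.x u * R.y (-u⁻¹) * R.x u) := rfl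
      _ = (R.w u * R.x u) * R.y (-u⁻¹) * R.x u := by group
      _ = R.y (-u⁻¹) * (R.w u * R.y (-u⁻¹)) * R.x u := by rw [h2]; group
      _ = R.y (-u⁻¹) * R.x u * (R.w u * R.x u) := by rw [h1]; group
      _ = _ := by rw [h2]; group
  exact mul_right_cancel h

/-- The torus element `h(u) = w(u) w(-1)`. -/
def h (u : K) : E := R.w u * R.w (-1)

/-- The symbol `h(u) h(v) h(uv)⁻¹`. -/
def sym (u v : K) : E := R.h u * R.h v * (R.h (u * v))⁻¹

theorem w_eq_h_mul (u : K) : R.w u = R.h u * R.w 1 := by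
  rw [h, R.w_neg, inv_mul_cancel_right]

theorem h_mul_h (u v : K) : R.h u * R.h v = R.sym u v * R.h (u * v) := by
  rw [sym, inv_mul_cancel_right]

/-- With `v = 1 - u` one has `uv = u - u² = v - v²` and `(uv)⁻¹ = u⁻¹ + v⁻¹`. Splitting the three
factors of `w(uv)` accordingly, and moving `x(-u²)` and `x(-v²)` through `w(u)` and `w(v)`, leaves
`y(1) x(-1) y(1) = w(-1)` in the middle. So `w(uv) = w(u) w(-1) w(v)`, which says `h(uv) = h(u)
h(v)`. -/
theorem sym_one_sub {u : K} (hu : u ≠ 0) (hu' : 1 - u ≠ 0) : R.sym u (1 - u) = 1 := by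
  set v := 1 - u with hv
  have hw : R.w (u * v) = R.w u * R.w (-1) * R.w v := by
    have e1 : u * v = -u ^ 2 + u := by rw [hv]; ring
    have e2 : u * v = v + -v ^ 2 := by rw [hv]; ring
    have e3 : -(u * v)⁻¹ = -u⁻¹ + -v⁻¹ := by
      field_simp
      rw [hv]; ring
    have e4 : R.x (-u ^ 2) * R.w u = R.w u * R.y 1 := by
      rw [R.x_mul_w hu]
      congr 2
      field_simp
    have e5 : R.w v * R.x (-v ^ 2) = R.y 1 * R.w v := by
      rw [R.w_mul_x hu']
      congr 2
      field_simp
    have e6 : R.w (-1) = R.y 1 * R.x (-1) * R.y 1 := by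
      rw [R.w_eq (neg_ne_zero.2 one_ne_zero), inv_neg, neg_neg, inv_one]
    have e7 : R.x (-1) = (R.x v)⁻¹ * (R.x u)⁻¹ := by
      rw [← R.x_neg, ← R.x_neg, ← R.x_add]
      congr 1
      rw [hv]; ring
    calc R.w (u * v) = R.x (u * v) * R.y (-(u * v)⁻¹) * R.x (u * v) := rfl
      _ = R.x (-u ^ 2 + u) * R.y (-u⁻¹ + -v⁻¹) * R.x (v + -v ^ 2) := by rw [e3, ← e1, ← e2]
      _ = (R.x (-u ^ 2) * R.w u) * ((R.x u)⁻¹ * (R.x v)⁻¹) * (R.w v * R.x (-v ^ 2)) := by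
        rw [R.x_add, R.y_add, R.x_add]
        simp only [w]
        group
      _ = R.w u * (R.y 1 * ((R.x u)⁻¹ * (R.x v)⁻¹) * R.y 1) * R.w v := by
        rw [e4, e5]; group
      _ = _ := by
        have : (R.x u)⁻¹ * (R.x v)⁻¹ = R.x (-1) := by
          rw [e7, ← R.x_neg, ← R.x_neg, ← R.x_add, ← R.x_add, add_comm]
        rw [this, e6]
  rw [sym, h, h, h, hw]
  group

theorem torus_conj_w {τ : E} {t : K} (hx : ∀ a, τ * R.x a * τ⁻¹ = R.x (t * a))
    (hy : ∀ a, τ * R.y a * τ⁻¹ = R.y (a / t)) (u : K) : τ * R.w u * τ⁻¹ = R.w (t * u) := by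
  have e : R.w (t * u) = R.x (t * u) * R.y (-u⁻¹ / t) * R.x (t * u) := by
    rw [w, neg_div, mul_inv, mul_comm t⁻¹, div_eq_mul_inv]
  rw [e, ← hx, ← hy, w]
  group

theorem torus_conj_h {τ : E} {t : K} (hx : ∀ a, τ * R.x a * τ⁻¹ = R.x (t * a))
    (hy : ∀ a, τ * R.y a * τ⁻¹ = R.y (a / t)) (u : K) :
    τ * R.h u * τ⁻¹ = R.h (t * u) * (R.h t)⁻¹ := by
  have e : τ * R.h u * τ⁻¹ = (τ * R.w u * τ⁻¹) * (τ * R.w (-1) * τ⁻¹) := by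
    simp only [h]; group
  rw [e, R.torus_conj_w hx hy, R.torus_conj_w hx hy, h, h, mul_neg, mul_one, R.w_neg, R.w_neg]
  group

/-- Only the scaling action of `τ` on the root subgroups enters. The symbol can therefore be read
off from the commutator of any lift of a torus element with `h(u)`. -/
theorem torus_commutator_h {τ : E} {t : K} (hx : ∀ a, τ * R.x a * τ⁻¹ = R.x (t * a))
    (hy : ∀ a, τ * R.y a * τ⁻¹ = R.y (a / t)) (u : K) : ⁅τ, R.h u⁆ = (R.sym u t)⁻¹ := by
  rw [commutatorElement_def, R.torus_conj_h hx hy, sym, mul_comm t u]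
  group

/-- Transport of a rank one pair along a homomorphism. -/
def map {E' : Type*} [Group E'] (f : E →* E') : RankOne K E' where
  x a := f (R.x a)
  y a := f (R.y a)
  x_add a b := by rw [R.x_add, map_mul]
  y_add a b := by rw [R.y_add, map_mul]
  weyl u hu a := by simp only [← map_mul, R.weyl u hu a]

theorem map_sym {E' : Type*} [Group E'] (f : E →* E') (u v : K) :
    (R.map f).sym u v = f (R.sym u v) := by
  simp only [sym, h, w, map, map_mul, map_inv]

end RankOne

/-- A rank one pair normalized by a torus `t`, whose symbols are central. -/
structure SplitRankOne (K E : Type*) [Field K] [Group E] extends RankOne K E where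
  t : Kˣ →* E
  t_x : ∀ (u : Kˣ) a, t u * x a * (t u)⁻¹ = x (u * a)
  t_y : ∀ (u : Kˣ) a, t u * y a * (t u)⁻¹ = y (a / u)
  sym_central : ∀ u v : Kˣ, toRankOne.sym u v ∈ Subgroup.center E

/-! ### Bimultiplicativity of symbols and Bruhat cells in rank one. -/

namespace SplitRankOne

variable {K E : Type*} [Field K] [Group E] (R : SplitRankOne K E)

/-- The opposite torus `w(1) t(u) w(1)⁻¹`. -/
def optorus : Kˣ →* E := (MulAut.conj (R.w 1)).toMonoidHom.comp R.t

theorem optorus_apply (u : Kˣ) : R.optorus u = R.w 1 * R.t u * (R.w 1)⁻¹ := rfl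

/-- The subgroup generated by the symbols. -/
def symGroup : Subgroup E := Subgroup.closure {g | ∃ u v : Kˣ, g = R.sym u v}

theorem sym_mem_symGroup (u v : Kˣ) : R.sym u v ∈ R.symGroup :=
  Subgroup.subset_closure ⟨u, v, rfl⟩

theorem symGroup_le_center : R.symGroup ≤ Subgroup.center E := by
  rw [symGroup, Subgroup.closure_le]
  rintro _ ⟨u, v, rfl⟩
  exact R.sym_central u v

theorem mul_comm_sym (u v : Kˣ) (g : E) : g * R.sym u v = R.sym u v * g :=
  Subgroup.mem_center_iff.1 (R.sym_central u v) g

theorem h_eq_torus (u : Kˣ) : R.h u = R.t u * (R.optorus u)⁻¹ := by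
  have := R.torus_conj_w (R.t_x u) (R.t_y u) 1
  rw [mul_one] at this
  rw [RankOne.h, ← this, R.w_neg, optorus_apply]
  group

/-- Since `h(u) = t(u) t'(u)⁻¹` for the two tori `t`, `t'`, the symbol measures the failure of these
tori to commute. As `t` and `t'` are homomorphisms and symbols are central, bimultiplicativity
follows. -/
theorem sym_eq_commutator (u v : Kˣ) : R.sym u v = ⁅(R.optorus u)⁻¹, R.t v⁆ := by
  have h1 : R.sym u v = R.t u * ⁅(R.optorus u)⁻¹, R.t v⁆ * (R.t u)⁻¹ := by
    have hc : R.t v * (R.t u)⁻¹ * (R.t v)⁻¹ = (R.t u)⁻¹ := by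
      rw [← map_inv, ← map_inv, ← map_mul, ← map_mul]
      congr 1
      rw [mul_comm, inv_mul_cancel_left]
    rw [RankOne.sym, ← Units.val_mul, R.h_eq_torus, R.h_eq_torus, R.h_eq_torus, mul_comm u v,
      map_mul, map_mul, _root_.mul_inv_rev, commutatorElement_def]
    calc _ = R.t u * (R.optorus u)⁻¹ * R.t v * R.optorus u * ((R.t u)⁻¹ * (R.t v)⁻¹) := by group
      _ = R.t u * (R.optorus u)⁻¹ * R.t v * R.optorus u *
          ((R.t v)⁻¹ * (R.t v * (R.t u)⁻¹ * (R.t v)⁻¹)) := by group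
      _ = _ := by rw [hc]; group
  have h3 : ⁅(R.optorus u)⁻¹, R.t v⁆ = (R.t u)⁻¹ * R.sym u v * R.t u := by
    rw [h1]; group
  rw [h3, R.mul_comm_sym, inv_mul_cancel_right]

theorem t_mul_optorus (u v : Kˣ) :
    R.optorus u * R.t v = R.sym (u⁻¹ : Kˣ) v * (R.t v * R.optorus u) := by
  rw [R.sym_eq_commutator, map_inv, inv_inv, commutatorElement_def]
  group

theorem sym_mul_left (u u' v : Kˣ) : R.sym (u * u' : Kˣ) v = R.sym u v * R.sym u' v := by
  have key : ∀ a b c : E, ⁅b * a, c⁆ = b * ⁅a, c⁆ * b⁻¹ * ⁅b, c⁆ := by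
    intro a b c
    simp only [commutatorElement_def]; group
  rw [R.sym_eq_commutator (u * u') v, mul_comm u u', map_mul, _root_.mul_inv_rev, key,
    ← R.sym_eq_commutator, ← R.sym_eq_commutator, R.mul_comm_sym u' v, mul_inv_cancel_right,
    R.mul_comm_sym u v]

theorem sym_mul_right (u v v' : Kˣ) : R.sym u (v * v' : Kˣ) = R.sym u v * R.sym u v' := by
  have key : ∀ a b c : E, ⁅a, b * c⁆ = ⁅a, b⁆ * (b * ⁅a, c⁆ * b⁻¹) := by
    intro a b c
    simp only [commutatorElement_def]; group
  rw [R.sym_eq_commutator u (v * v'), map_mul, key, ← R.sym_eq_commutator,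
    ← R.sym_eq_commutator, R.mul_comm_sym u v', mul_inv_cancel_right]

/-- The group of products `t(u) t'(v) c` of elements of the two tori and of the symbol group. -/
def bigTorus : Subgroup E where
  carrier := {g | ∃ u v : Kˣ, ∃ c ∈ R.symGroup, g = R.t u * R.optorus v * c}
  one_mem' := ⟨1, 1, 1, one_mem _, by simp⟩
  mul_mem' := by
    rintro _ _ ⟨u, v, c, hc, rfl⟩ ⟨u', v', c', hc', rfl⟩
    refine ⟨u * u', v * v', R.sym (v⁻¹ : Kˣ) u' * c * c',
      mul_mem (mul_mem (R.sym_mem_symGroup _ _) hc) hc', ?_⟩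
    have h3 := Subgroup.mem_center_iff.1 (R.symGroup_le_center hc)
    calc _ = R.t u * R.optorus v * (c * (R.t u' * R.optorus v')) * c' := by group
      _ = R.t u * (R.optorus v * R.t u') * R.optorus v' * c * c' := by rw [← h3]; group
      _ = (R.t u * R.sym (v⁻¹ : Kˣ) u') * R.t u' * R.optorus v * R.optorus v' * c * c' := by
        rw [R.t_mul_optorus]; group
      _ = R.sym (v⁻¹ : Kˣ) u' * (R.t u * R.t u' * R.optorus v * R.optorus v') * c * c' := by
        rw [R.mul_comm_sym]; group
      _ = _ := by rw [← R.mul_comm_sym, map_mul, map_mul]; group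
  inv_mem' := by
    rintro _ ⟨u, v, c, hc, rfl⟩
    refine ⟨u⁻¹, v⁻¹, R.sym v (u⁻¹ : Kˣ) * c⁻¹, mul_mem (R.sym_mem_symGroup _ _) (inv_mem hc), ?_⟩
    have h3 := Subgroup.mem_center_iff.1 (R.symGroup_le_center (inv_mem hc))
    have h1 := R.t_mul_optorus v⁻¹ u⁻¹
    rw [inv_inv] at h1
    rw [_root_.mul_inv_rev, ← h3, _root_.mul_inv_rev, ← map_inv, ← map_inv, h1, ← R.mul_comm_sym,
      mul_assoc]

theorem t_mem (u : Kˣ) : R.t u ∈ R.bigTorus := ⟨u, 1, 1, one_mem _, by simp⟩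

theorem optorus_mem (u : Kˣ) : R.optorus u ∈ R.bigTorus := ⟨1, u, 1, one_mem _, by simp⟩

theorem h_mem (u : Kˣ) : R.h u ∈ R.bigTorus := by
  rw [R.h_eq_torus]
  exact mul_mem (R.t_mem u) (inv_mem (R.optorus_mem u))

theorem w_one_mul_self_mem : R.w 1 * R.w 1 ∈ R.bigTorus := by
  have h := R.h_mem (-1)
  rw [Units.val_neg, Units.val_one, RankOne.h, R.w_neg] at h
  simpa using inv_mem h

theorem w_one_conj_mem {τ : E} (hτ : τ ∈ R.bigTorus) : R.w 1 * τ * (R.w 1)⁻¹ ∈ R.bigTorus := by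
  obtain ⟨u, v, c, hc, rfl⟩ := hτ
  have h3 := Subgroup.mem_center_iff.1 (R.symGroup_le_center hc)
  have e : R.w 1 * (R.t u * R.optorus v * c) * (R.w 1)⁻¹ =
      R.optorus u * ((R.w 1 * R.w 1) * R.t v * (R.w 1 * R.w 1)⁻¹) * c := by
    rw [← mul_assoc, mul_assoc _ c, ← h3, optorus_apply, optorus_apply]
    group
  rw [e]
  exact mul_mem (mul_mem (R.optorus_mem _) (mul_mem (mul_mem R.w_one_mul_self_mem (R.t_mem _))
    (inv_mem R.w_one_mul_self_mem))) ⟨1, 1, c, hc, by simp⟩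

theorem x_mul_bigTorus {τ : E} (hτ : τ ∈ R.bigTorus) (a : K) : ∃ b, R.x a * τ = τ * R.x b := by
  obtain ⟨u, v, c, hc, rfl⟩ := hτ
  have h3 := Subgroup.mem_center_iff.1 (R.symGroup_le_center hc)
  have h1 : R.x a * R.t u = R.t u * R.x (a / u) := by
    have := R.t_x u (a / u)
    rw [mul_div_cancel₀ _ u.ne_zero] at this
    rw [← this, inv_mul_cancel_right]
  have h2 : R.x (a / u) * R.optorus v = R.optorus v * R.x (v * (a / u)) := by
    have e1 := R.w_mul_y one_ne_zero (-(a / u))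
    have e2 := R.x_mul_w one_ne_zero (v * (a / u))
    have e3 := R.t_y v (-(v * (a / u)))
    rw [one_pow, one_mul, neg_neg] at e1
    rw [one_pow, div_one] at e2
    rw [neg_div, mul_div_cancel_left₀ _ v.ne_zero] at e3
    rw [optorus_apply]
    calc _ = R.x (a / u) * R.w 1 * R.t v * (R.w 1)⁻¹ := by group
      _ = R.w 1 * (R.t v * R.y (-(v * (a / u)))) * (R.w 1)⁻¹ := by rw [← e1, ← e3]; group
      _ = R.w 1 * R.t v * ((R.w 1)⁻¹ * (R.w 1 * R.y (-(v * (a / u))))) * (R.w 1)⁻¹ := by group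
      _ = _ := by rw [← e2]; group
  refine ⟨v * (a / u), ?_⟩
  rw [mul_assoc (R.t u * _), ← h3, ← mul_assoc, ← mul_assoc, h1, mul_assoc (R.t u), h2]
  group

theorem bigTorus_mul_x {τ : E} (hτ : τ ∈ R.bigTorus) (a : K) : ∃ b, τ * R.x a = R.x b * τ := by
  obtain ⟨b, hb⟩ := R.x_mul_bigTorus (inv_mem hτ) a
  refine ⟨b, ?_⟩
  rw [eq_inv_mul_iff_mul_eq, ← mul_assoc, mul_inv_eq_iff_eq_mul] at hb
  exact hb

/-- The union of the two Bruhat cells. -/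
def cells : Set E := {g | (∃ a, ∃ τ ∈ R.bigTorus, g = R.x a * τ) ∨
  ∃ a b, ∃ τ ∈ R.bigTorus, g = R.x a * τ * R.w 1 * R.x b}

theorem x_mul_mem_cells (a : K) {g : E} (hg : g ∈ R.cells) : R.x a * g ∈ R.cells := by
  obtain ⟨b, τ, hτ, rfl⟩ | ⟨b, c, τ, hτ, rfl⟩ := hg
  · exact Or.inl ⟨a + b, τ, hτ, by rw [R.x_add, mul_assoc]⟩
  · exact Or.inr ⟨a + b, c, τ, hτ, by simp only [R.x_add, mul_assoc]⟩

theorem bigTorus_mul_mem_cells {τ : E} (hτ : τ ∈ R.bigTorus) {g : E} (hg : g ∈ R.cells) :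
    τ * g ∈ R.cells := by
  obtain ⟨a, σ, hσ, rfl⟩ | ⟨a, c, σ, hσ, rfl⟩ := hg <;> obtain ⟨b, hb⟩ := R.bigTorus_mul_x hτ a
  · exact Or.inl ⟨b, τ * σ, mul_mem hτ hσ, by rw [← mul_assoc, hb, mul_assoc]⟩
  · exact Or.inr ⟨b, c, τ * σ, mul_mem hτ hσ, by simp only [← mul_assoc, hb]⟩

/-- The product `w(1) x(a)` equals `y(-a) w(1)`, and for `a ≠ 0` the definition of `w(a⁻¹)` gives
`y(-a) = x(-a⁻¹) w(a⁻¹) x(-a⁻¹)`, which lies in the big cell. -/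
theorem w_one_mul_x {a : K} (ha : a ≠ 0) :
    ∃ b, ∃ τ ∈ R.bigTorus, R.w 1 * R.x a * R.w 1 = R.x b * τ * R.w 1 * R.x b := by
  have hu : a⁻¹ ≠ 0 := inv_ne_zero ha
  have hτ := R.h_mem (Units.mk0 _ hu)
  rw [Units.val_mk0] at hτ
  have e : R.y (-a) = R.x (-a⁻¹) * R.w a⁻¹ * R.x (-a⁻¹) := by
    rw [RankOne.w, inv_inv, R.x_neg]; group
  have h1 : R.w 1 * R.x a * R.w 1 = R.x (-a⁻¹) * R.h a⁻¹ * R.w 1 * (R.x (-a⁻¹) * (R.w 1 * R.w 1)) := by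
    rw [R.w_mul_x one_ne_zero, one_pow, div_one, e, R.w_eq_h_mul]
    group
  obtain ⟨b, hb⟩ := R.x_mul_bigTorus R.w_one_mul_self_mem (-a⁻¹)
  have h2 : R.w 1 * R.x a * R.w 1 = R.x (-a⁻¹) * (R.h a⁻¹ * (R.w 1 * R.w 1)) * R.w 1 * R.x b := by
    rw [h1, hb]; group
  have e1 := R.w_one_mul_self_mem
  have hb' : R.x b = R.x (-a⁻¹) := by
    have e2 : R.x (-a⁻¹) * (R.w 1 * R.w 1) = R.w 1 * R.w 1 * R.x (-a⁻¹) := by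
      rw [← mul_assoc, R.x_mul_w one_ne_zero, mul_assoc, R.y_mul_w one_ne_zero, ← mul_assoc]
      simp
    exact mul_left_cancel (hb.symm.trans e2)
  exact ⟨-a⁻¹, _, mul_mem hτ e1, by rw [h2, hb']⟩

theorem w_one_mul_mem_cells {g : E} (hg : g ∈ R.cells) : R.w 1 * g ∈ R.cells := by
  obtain ⟨a, σ, hσ, rfl⟩ | ⟨a, c, σ, hσ, rfl⟩ := hg <;>
    obtain ⟨b, hb⟩ := R.x_mul_bigTorus hσ a
  · refine Or.inr ⟨0, b, _, R.w_one_conj_mem hσ, ?_⟩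
    rw [hb, R.x_zero]
    group
  · have e : R.w 1 * (R.x a * σ * R.w 1 * R.x c) =
        (R.w 1 * σ * (R.w 1)⁻¹) * (R.w 1 * R.x b * R.w 1 * R.x c) := by
      rw [hb]; group
    rw [e]
    refine R.bigTorus_mul_mem_cells (R.w_one_conj_mem hσ) ?_
    by_cases hb0 : b = 0
    · obtain ⟨d, hd⟩ := R.bigTorus_mul_x R.w_one_mul_self_mem c
      exact Or.inl ⟨d, _, R.w_one_mul_self_mem, by rw [hb0, R.x_zero, mul_one, hd]⟩
    · obtain ⟨d, τ, hτ, hd⟩ := R.w_one_mul_x hb0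
      exact Or.inr ⟨d, d + c, τ, hτ, by rw [hd, R.x_add]; group⟩

theorem w_one_inv_mul_mem_cells {g : E} (hg : g ∈ R.cells) : (R.w 1)⁻¹ * g ∈ R.cells := by
  have := R.bigTorus_mul_mem_cells (inv_mem R.w_one_mul_self_mem) (R.w_one_mul_mem_cells hg)
  convert this using 1
  group

/-- The subgroup generated by the two root subgroups and the torus. -/
def generated : Subgroup E :=
  Subgroup.closure ((Set.range R.x ∪ Set.range R.y) ∪ Set.range R.t)

theorem x_mem_generated (a : K) : R.x a ∈ R.generated :=
  Subgroup.subset_closure (Or.inl (Or.inl ⟨a, rfl⟩))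

theorem y_mem_generated (a : K) : R.y a ∈ R.generated :=
  Subgroup.subset_closure (Or.inl (Or.inr ⟨a, rfl⟩))

theorem t_mem_generated (u : Kˣ) : R.t u ∈ R.generated :=
  Subgroup.subset_closure (Or.inr ⟨u, rfl⟩)

theorem w_mem_generated (u : K) : R.w u ∈ R.generated :=
  mul_mem (mul_mem (R.x_mem_generated _) (R.y_mem_generated _)) (R.x_mem_generated _)

/-- The two cells contain `1` and are stable under left multiplication by the generators; `y(a)` is
covered because it is the conjugate of `x(-a)` by `w(1)`. -/
theorem generated_subset_cells {g : E} (hg : g ∈ R.generated) : g ∈ R.cells := by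
  have hy : ∀ a, ∀ z ∈ R.cells, R.y a * z ∈ R.cells := by
    intro a z hz
    have e : R.y a = R.w 1 * R.x (-a) * (R.w 1)⁻¹ := by
      rw [R.w_mul_x one_ne_zero, one_pow, div_one, neg_neg, mul_inv_cancel_right]
    rw [e, mul_assoc, mul_assoc]
    exact R.w_one_mul_mem_cells (R.x_mul_mem_cells _ (R.w_one_inv_mul_mem_cells hz))
  induction hg using Subgroup.closure_induction_left with
  | one => exact Or.inl ⟨0, 1, one_mem _, by rw [R.x_zero, mul_one]⟩
  | mul_left a ha z _ hz =>
    obtain (⟨b, rfl⟩ | ⟨b, rfl⟩) | ⟨b, rfl⟩ := ha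
    · exact R.x_mul_mem_cells _ hz
    · exact hy _ _ hz
    · exact R.bigTorus_mul_mem_cells (R.t_mem _) hz
  | inv_mul_cancel a ha z _ hz =>
    obtain (⟨b, rfl⟩ | ⟨b, rfl⟩) | ⟨b, rfl⟩ := ha
    · rw [← R.x_neg]
      exact R.x_mul_mem_cells _ hz
    · rw [← R.y_neg]
      exact hy _ _ hz
    · exact R.bigTorus_mul_mem_cells (inv_mem (R.t_mem _)) hz

end SplitRankOne

/-- The elementary matrix `1 + a E_{ij}` in `GL_n(K)`. -/
def elemGL {n : ℕ} {K : Type*} [Field K] (i j : Fin n) (h : i ≠ j) (a : K) : GL (Fin n) K :=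
  SpecialLinearGroup.toGL ⟨Matrix.transvection i j a, Matrix.det_transvection_of_ne i j h a⟩

theorem elemGL_val {n : ℕ} {K : Type*} [Field K] (i j : Fin n) (h : i ≠ j) (a : K) :
    (elemGL i j h a : Matrix (Fin n) (Fin n) K) = Matrix.transvection i j a := rfl

theorem elemGL_zero_one_val {K : Type*} [Field K] (a : K) :
    (elemGL (0 : Fin 2) 1 zero_ne_one a : Matrix (Fin 2) (Fin 2) K) = !![1, a; 0, 1] := by
  rw [elemGL_val]
  ext i j
  fin_cases i <;> fin_cases j <;> simp [Matrix.transvection]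

theorem elemGL_one_zero_val {K : Type*} [Field K] (a : K) :
    (elemGL (1 : Fin 2) 0 one_ne_zero a : Matrix (Fin 2) (Fin 2) K) = !![1, 0; a, 1] := by
  rw [elemGL_val]
  ext i j
  fin_cases i <;> fin_cases j <;> simp [Matrix.transvection]

theorem diag2_val {K : Type*} [Field K] (u : Kˣ) :
    (diag2 K u : Matrix (Fin 2) (Fin 2) K) = !![(u : K), 0; 0, 1] := rfl

/-! ### Split rank one pairs over `GL_2(K)`. -/

namespace SplitRankOne

variable {K E : Type*} [Field K] [Group E] (R : SplitRankOne K E) (p : E →* GL (Fin 2) K)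

theorem map_w (hx : ∀ a, p (R.x a) = elemGL 0 1 zero_ne_one a)
    (hy : ∀ a, p (R.y a) = elemGL 1 0 one_ne_zero a) {u : K} (hu : u ≠ 0) :
    (p (R.w u) : Matrix (Fin 2) (Fin 2) K) = !![0, u; -u⁻¹, 0] := by
  rw [RankOne.w, map_mul, map_mul, hx, hy, Units.val_mul, Units.val_mul, elemGL_zero_one_val,
    elemGL_one_zero_val]
  simp [hu]

theorem map_optorus (hx : ∀ a, p (R.x a) = elemGL 0 1 zero_ne_one a)
    (hy : ∀ a, p (R.y a) = elemGL 1 0 one_ne_zero a) (ht : ∀ u, p (R.t u) = diag2 K u) (u : Kˣ) :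
    (p (R.optorus u) : Matrix (Fin 2) (Fin 2) K) = !![1, 0; 0, (u : K)] := by
  rw [optorus_apply, ← R.w_neg, map_mul, map_mul, ht, Units.val_mul, Units.val_mul,
    R.map_w p hx hy one_ne_zero, R.map_w p hx hy (neg_ne_zero.2 one_ne_zero), diag2_val]
  simp

theorem map_symGroup (hx : ∀ a, p (R.x a) = elemGL 0 1 zero_ne_one a)
    (hy : ∀ a, p (R.y a) = elemGL 1 0 one_ne_zero a) {c : E} (hc : c ∈ R.symGroup) : p c = 1 := by
  have : R.symGroup ≤ p.ker := by
    rw [symGroup, Subgroup.closure_le]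
    rintro _ ⟨u, v, rfl⟩
    rw [SetLike.mem_coe, MonoidHom.mem_ker, RankOne.sym, map_mul, map_inv, mul_inv_eq_one]
    apply Units.ext
    simp only [RankOne.h, map_mul, Units.val_mul, R.map_w p hx hy u.ne_zero,
      R.map_w p hx hy v.ne_zero, R.map_w p hx hy (neg_ne_zero.2 (one_ne_zero (α := K))),
      R.map_w p hx hy (mul_ne_zero u.ne_zero v.ne_zero)]
    simp [mul_comm]
  exact this hc

/-- The subgroup generated by the root subgroups and the torus meets the kernel of the projection to
`GL_2(K)` in the group of symbols only. -/
theorem mem_symGroup (hx : ∀ a, p (R.x a) = elemGL 0 1 zero_ne_one a)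
    (hy : ∀ a, p (R.y a) = elemGL 1 0 one_ne_zero a) (ht : ∀ u, p (R.t u) = diag2 K u) {g : E}
    (hg : g ∈ R.generated) (h1 : p g = 1) : g ∈ R.symGroup := by
  have h1' : (p g : Matrix (Fin 2) (Fin 2) K) = 1 := by rw [h1, Units.val_one]
  obtain ⟨a, τ, ⟨u, v, c, hc, rfl⟩, rfl⟩ | ⟨a, b, τ, ⟨u, v, c, hc, rfl⟩, rfl⟩ :=
    R.generated_subset_cells hg
  · simp only [map_mul, Units.val_mul, hx, ht, R.map_optorus p hx hy ht, R.map_symGroup p hx hy hc,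
      elemGL_zero_one_val, diag2_val, mul_one] at h1'
    have h00 := congrFun (congrFun h1' 0) 0
    have h01 := congrFun (congrFun h1' 0) 1
    have h11 := congrFun (congrFun h1' 1) 1
    simp at h00 h01 h11
    subst h00 h11 h01
    simpa [R.x_zero] using hc
  -- The big cell does not meet the kernel: the lower left entry of the image is `-v` with `v` a
  -- unit.
  · simp only [map_mul, Units.val_mul, hx, ht, R.map_optorus p hx hy ht, R.map_symGroup p hx hy hc,
      elemGL_zero_one_val, diag2_val, R.map_w p hx hy one_ne_zero, mul_one] at h1'
    have h10 := congrFun (congrFun h1' 1) 0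
    simp at h10

theorem exists_generated (hx : ∀ a, p (R.x a) = elemGL 0 1 zero_ne_one a)
    (hy : ∀ a, p (R.y a) = elemGL 1 0 one_ne_zero a) (ht : ∀ u, p (R.t u) = diag2 K u)
    (g : GL (Fin 2) K) : ∃ e ∈ R.generated, p e = g := by
  have hw := R.w_mem_generated 1
  have hop : ∀ u, R.optorus u ∈ R.generated := fun u =>
    mul_mem (mul_mem hw (R.t_mem_generated u)) (inv_mem hw)
  obtain ⟨A, hA⟩ : ∃ A : Matrix (Fin 2) (Fin 2) K, (g : Matrix (Fin 2) (Fin 2) K) = A := ⟨_, rfl⟩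
  have hdet : A 0 0 * A 1 1 - A 0 1 * A 1 0 ≠ 0 := by
    rw [← Matrix.det_fin_two, ← hA]
    exact ((Matrix.isUnit_iff_isUnit_det _).1 g.isUnit).ne_zero
  by_cases h0 : A 1 0 = 0
  · rw [h0, mul_zero, sub_zero] at hdet
    have ha := left_ne_zero_of_mul hdet
    have hd := right_ne_zero_of_mul hdet
    refine ⟨R.x (A 0 1 / A 1 1) * (R.t (Units.mk0 _ ha) * R.optorus (Units.mk0 _ hd)),
      mul_mem (R.x_mem_generated _) (mul_mem (R.t_mem_generated _) (hop _)), Units.ext ?_⟩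
    simp only [map_mul, Units.val_mul, hx, ht, R.map_optorus p hx hy ht, elemGL_zero_one_val,
      diag2_val, Units.val_mk0, hA]
    ext i j
    fin_cases i <;> fin_cases j <;> simp [h0, hd]
  · have hb : (A 0 1 * A 1 0 - A 0 0 * A 1 1) / A 1 0 ≠ 0 :=
      div_ne_zero (fun e => hdet (by linear_combination -e)) h0
    -- The matrix with rows `(a, b)`, `(c, d)` and `c ≠ 0` is `x(a/c) · diag((bc - ad)/c, -c) · w(1)
    -- · x(d/c)`.
    refine ⟨R.x (A 0 0 / A 1 0) * (R.t (Units.mk0 _ hb) * R.optorus (Units.mk0 _ (neg_ne_zero.2 h0)) *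
      R.w 1) * R.x (A 1 1 / A 1 0), mul_mem (mul_mem (R.x_mem_generated _) (mul_mem (mul_mem
      (R.t_mem_generated _) (hop _)) hw)) (R.x_mem_generated _), Units.ext ?_⟩
    simp only [map_mul, Units.val_mul, hx, ht, R.map_optorus p hx hy ht, elemGL_zero_one_val,
      diag2_val, Units.val_mk0, hA, R.map_w p hx hy one_ne_zero]
    ext i j
    fin_cases i <;> fin_cases j <;> simp <;> field_simp
    ring

end SplitRankOne

end

section

/-! ### The Steinberg group -/

variable {K : Type u} [Field K]

/-- The generator `x_{ij}(a)` of the Steinberg group. -/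
def xS (i j : ℕ) (h : i ≠ j) (a : K) : St K := PresentedGroup.of ⟨i, j, h, a⟩

theorem xS_add (i j : ℕ) (h : i ≠ j) (a b : K) : xS i j h (a + b) = xS i j h a * xS i j h b := by
  have := of_rel (IsRel.add i j h a b)
  rw [map_mul, map_mul, map_inv, mul_inv_eq_one] at this
  exact this.symm

theorem xS_commutator (i j k : ℕ) (hij : i ≠ j) (hjk : j ≠ k) (hik : i ≠ k) (a b : K) :
    ⁅xS i j hij a, xS j k hjk b⁆ = xS i k hik (a * b) := by
  have := of_rel (IsRel.comm_mul i j k hij hjk hik a b)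
  rw [map_mul, map_inv, mul_inv_eq_one, map_commutatorElement] at this
  exact this

theorem xS_commute (i j k l : ℕ) (hij : i ≠ j) (hkl : k ≠ l) (hjk : j ≠ k) (hil : i ≠ l) (a b : K) :
    xS i j hij a * xS k l hkl b = xS k l hkl b * xS i j hij a := by
  have := of_rel (IsRel.comm_one i j k l hij hkl hjk hil a b)
  rw [map_commutatorElement, commutatorElement_eq_one_iff_mul_comm] at this
  exact this

theorem xS_zero (i j : ℕ) (h : i ≠ j) : xS i j h (0 : K) = 1 := by
  have := xS_add i j h (0 : K) 0
  rwa [add_zero, left_eq_mul] at this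

theorem xS_neg (i j : ℕ) (h : i ≠ j) (a : K) : xS i j h (-a) = (xS i j h a)⁻¹ := by
  rw [eq_inv_iff_mul_eq_one, ← xS_add, neg_add_cancel, xS_zero]

theorem toGLinf_xS (i j : ℕ) (h : i ≠ j) (a : K) : toGLinf K (xS i j h a) = elem ⟨i, j, h, a⟩ :=
  toGLinf_of _

theorem elem_single (g : Gen K) (k : ℕ) (b : K) :
    (elem g : Module.End K (ℕ →₀ K)) (Finsupp.single k b) =
      Finsupp.single k b + if k = g.j then Finsupp.single g.i (g.a * b) else 0 := by
  rw [elem_val]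
  simp only [LinearMap.add_apply, Module.End.one_apply, LinearMap.smul_apply, E,
    LinearMap.comp_apply, Finsupp.lapply_apply, Finsupp.lsingle_apply, Finsupp.single_apply]
  split_ifs <;> simp

theorem mem_K2 {z : St K} : z ∈ K2 K ↔ toGLinf K z = 1 := by
  rw [K2, MonoidHom.mem_ker]
  exact Subtype.ext_iff

/-- The image of the basis vector `e_k` under an element of the Steinberg group. -/
def act (s : St K) (k : ℕ) : ℕ →₀ K := (toGLinf K s : Module.End K (ℕ →₀ K)) (Finsupp.single k 1)

theorem toGLinf_ext {s t : St K} (h : ∀ k, act s k = act t k) : toGLinf K s = toGLinf K t := by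
  apply Units.ext
  apply Finsupp.lhom_ext'
  intro k
  apply LinearMap.ext_ring
  exact h k

theorem act_one (k : ℕ) : act (1 : St K) k = Finsupp.single k 1 := by
  simp [act]

theorem act_mul (s t : St K) (k : ℕ) :
    act (s * t) k = (toGLinf K s : Module.End K (ℕ →₀ K)) (act t k) := by
  simp [act]

theorem act_xS (i j : ℕ) (h : i ≠ j) (a : K) (k : ℕ) :
    act (xS i j h a) k = Finsupp.single k 1 + if k = j then Finsupp.single i a else 0 := by
  rw [act, toGLinf_xS, elem_single, mul_one]

theorem mem_K2_of_act {z : St K} (h : ∀ k, act z k = Finsupp.single k 1) : z ∈ K2 K := by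
  rw [mem_K2, ← map_one (toGLinf K)]
  exact toGLinf_ext fun k => by rw [h, act_one]

theorem act_of_mem_K2 {z : St K} (h : z ∈ K2 K) (k : ℕ) : act z k = Finsupp.single k 1 := by
  rw [act, mem_K2.1 h]
  rfl

/-- The subgroup of the Steinberg group generated by a set of generators closed under scaling. -/
def gensGroup (P : ℕ → ℕ → Prop) : Subgroup (St K) :=
  Subgroup.closure {s | ∃ i j h a, P i j ∧ s = xS i j h a}

theorem xS_mem_gensGroup {P : ℕ → ℕ → Prop} {i j : ℕ} (hP : P i j) (h : i ≠ j) (a : K) :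
    xS i j h a ∈ gensGroup P :=
  Subgroup.subset_closure ⟨i, j, h, a, hP, rfl⟩

theorem gensGroup_induction {P : ℕ → ℕ → Prop} {Q : St K → Prop} (h1 : Q 1)
    (hmul : ∀ i j (h : i ≠ j) a s, P i j → Q s → Q (xS i j h a * s)) {s : St K}
    (hs : s ∈ gensGroup P) : Q s := by
  induction hs using Subgroup.closure_induction_left with
  | one => exact h1
  | mul_left g hg z _ hz =>
    obtain ⟨i, j, h, a, hP, rfl⟩ := hg
    exact hmul i j h a z hP hz
  | inv_mul_cancel g hg z _ hz =>
    obtain ⟨i, j, h, a, hP, rfl⟩ := hg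
    rw [← xS_neg]
    exact hmul i j h _ z hP hz

theorem gensGroup_mono {P Q : ℕ → ℕ → Prop} (h : ∀ i j, P i j → Q i j) :
    gensGroup (K := K) P ≤ gensGroup Q := by
  apply Subgroup.closure_mono
  rintro _ ⟨i, j, hij, a, hP, rfl⟩
  exact ⟨i, j, hij, a, h i j hP, rfl⟩

theorem gensGroup_true : gensGroup (K := K) (fun _ _ => True) = ⊤ := by
  rw [← PresentedGroup.closure_range_of (Rels K), gensGroup]
  congr 1
  ext s
  constructor
  · rintro ⟨i, j, h, a, -, rfl⟩
    exact ⟨_, rfl⟩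
  · rintro ⟨⟨i, j, h, a⟩, rfl⟩
    exact ⟨i, j, h, a, trivial, rfl⟩

theorem exists_bound (s : St K) : ∃ n, s ∈ gensGroup (K := K) (fun i j => i < n ∧ j < n) := by
  have hs : s ∈ gensGroup (K := K) (fun _ _ => True) := by rw [gensGroup_true]; trivial
  refine gensGroup_induction (Q := fun s => ∃ n, s ∈ gensGroup (K := K) (fun i j => i < n ∧ j < n))
    ⟨0, one_mem _⟩ ?_ hs
  rintro i j h a s - ⟨n, hn⟩
  refine ⟨n + i + j + 1, mul_mem (xS_mem_gensGroup ⟨by omega, by omega⟩ h a)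
    (gensGroup_mono (fun i j hij => ⟨by omega, by omega⟩) hn)⟩

/-! ### Centrality of `K_2` -/

theorem act_col {N m : ℕ} {p : St K} (hp : p ∈ gensGroup (K := K) (fun i j => i < m ∧ j = N)) :
    (∀ k, k ≠ N → act p k = Finsupp.single k 1) ∧
      ∀ i, m ≤ i → i ≠ N → act p N i = 0 := by
  refine gensGroup_induction (Q := fun p => (∀ k, k ≠ N → act p k = Finsupp.single k 1) ∧
      ∀ i, m ≤ i → i ≠ N → act p N i = 0) ?_ ?_ hp
  · simp only [act_one, implies_true, true_and]
    intro i _ hi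
    rw [Finsupp.single_apply, if_neg hi.symm]
  · rintro i j h a s ⟨hi, rfl⟩ ⟨h1, h2⟩
    have key : ∀ v : ℕ →₀ K, (toGLinf K (xS i j h a) : Module.End K (ℕ →₀ K)) v =
        v + Finsupp.single i (a * v j) := by
      intro v
      rw [toGLinf_xS, elem_val]
      simp [E]
    refine ⟨fun k hk => ?_, fun k hk hk' => ?_⟩
    · rw [act_mul, h1 k hk, key]
      simp [hk]
    · rw [act_mul, key, Finsupp.add_apply, h2 k hk hk', Finsupp.single_apply, if_neg, add_zero]
      omega

/-- The generators `x_{iN}(a)` for fixed `N` commute, so `p` is a product of one factor for each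
`i`, and the parameters of the factors are the entries of column `N`. The induction splits off the
factor with the largest `i`. -/
theorem col_eq_one {N m : ℕ} {p : St K} (hp : p ∈ gensGroup (K := K) (fun i j => i < m ∧ j = N))
    (h : act p N = Finsupp.single N 1) : p = 1 := by
  induction m generalizing p with
  | zero =>
    refine gensGroup_induction (Q := fun p => p = 1) rfl ?_ hp
    rintro i j _ a s ⟨hi, -⟩
    omega
  | succ m ih =>
    by_cases hmN : m = N
    · refine ih (gensGroup_induction (Q := fun p => p ∈ gensGroup (K := K)
        (fun i j => i < m ∧ j = N)) (one_mem _) ?_ hp) h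
      rintro i j hij a s ⟨hi, hj⟩ hs
      exact mul_mem (xS_mem_gensGroup ⟨by omega, hj⟩ hij a) hs
    · obtain ⟨a, q, hq, rfl⟩ : ∃ a, ∃ q ∈ gensGroup (K := K) (fun i j => i < m ∧ j = N),
          p = q * xS m N hmN a := by
        refine gensGroup_induction (Q := fun p => ∃ a, ∃ q ∈ gensGroup (K := K)
          (fun i j => i < m ∧ j = N), p = q * xS m N hmN a)
          ⟨0, 1, one_mem _, by rw [xS_zero, mul_one]⟩ ?_ hp
        rintro i j hij b s ⟨hi, rfl⟩ ⟨a, q, hq, rfl⟩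
        by_cases him : i = m
        · subst him
          refine ⟨b + a, q, hq, ?_⟩
          rw [xS_add, ← mul_assoc, ← mul_assoc]
          congr 1
          refine gensGroup_induction (Q := fun q => xS i j hij b * q = q * xS i j hij b)
            (by simp) ?_ hq
          rintro k l hkl c s ⟨hk, rfl⟩ hs
          rw [← mul_assoc, xS_commute i l k l hij hkl hkl.symm hij, mul_assoc, hs, mul_assoc]
        · exact ⟨a, _, mul_mem (xS_mem_gensGroup ⟨by omega, rfl⟩ hij b) hq, by rw [mul_assoc]⟩
      have h1 := act_col hq
      have ha : a = 0 := by
        have h2 := congrArg (fun v => v m) h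
        beta_reduce at h2
        rw [act_mul, act_xS, if_pos rfl, map_add] at h2
        have h3 : (toGLinf K q : Module.End K (ℕ →₀ K)) (Finsupp.single m a) = Finsupp.single m a := by
          have h4 := h1.1 m hmN
          rw [act] at h4
          rw [← mul_one a, ← smul_eq_mul, ← Finsupp.smul_single, map_smul, h4]
        have h5 := h1.2 m le_rfl hmN
        rw [act] at h5
        rw [h3, Finsupp.add_apply, h5, zero_add, Finsupp.single_eq_same, Finsupp.single_apply,
          if_neg (Ne.symm hmN)] at h2
        exact h2
      subst ha
      rw [xS_zero, mul_one] at h ⊢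
      exact ih hq h

theorem act_row {N m : ℕ} {p : St K} (hp : p ∈ gensGroup (K := K) (fun i j => j < m ∧ i = N)) :
    ∀ k, m ≤ k ∨ k = N → act p k = Finsupp.single k 1 := by
  refine gensGroup_induction (Q := fun p => ∀ k, m ≤ k ∨ k = N → act p k = Finsupp.single k 1)
    (fun k _ => act_one k) ?_ hp
  rintro i j h a s ⟨hj, rfl⟩ h1 k hk
  rw [act_mul, h1 k hk]
  exact (act_xS i j h a k).trans (by rw [if_neg (by omega), add_zero])

/-- The analogue of `col_eq_one` for rows; here the parameter of `x_{Nm}` is the entry `(N, m)`,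
read off from the image of `e_m`. -/
theorem row_eq_one {N m : ℕ} {p : St K} (hp : p ∈ gensGroup (K := K) (fun i j => j < m ∧ i = N))
    (h : ∀ k, act p k = Finsupp.single k 1) : p = 1 := by
  induction m generalizing p with
  | zero =>
    refine gensGroup_induction (Q := fun p => p = 1) rfl ?_ hp
    rintro i j _ a s ⟨hi, -⟩
    omega
  | succ m ih =>
    by_cases hmN : N = m
    · refine ih (gensGroup_induction (Q := fun p => p ∈ gensGroup (K := K)
        (fun i j => j < m ∧ i = N)) (one_mem _) ?_ hp) h
      rintro i j hij a s ⟨hi, hj⟩ hs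
      exact mul_mem (xS_mem_gensGroup ⟨by omega, hj⟩ hij a) hs
    · obtain ⟨a, q, hq, rfl⟩ : ∃ a, ∃ q ∈ gensGroup (K := K) (fun i j => j < m ∧ i = N),
          p = q * xS N m hmN a := by
        refine gensGroup_induction (Q := fun p => ∃ a, ∃ q ∈ gensGroup (K := K)
          (fun i j => j < m ∧ i = N), p = q * xS N m hmN a)
          ⟨0, 1, one_mem _, by rw [xS_zero, mul_one]⟩ ?_ hp
        rintro i j hij b s ⟨hi, rfl⟩ ⟨a, q, hq, rfl⟩
        by_cases him : j = m
        · subst him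
          refine ⟨b + a, q, hq, ?_⟩
          rw [xS_add, ← mul_assoc, ← mul_assoc]
          congr 1
          refine gensGroup_induction (Q := fun q => xS i j hij b * q = q * xS i j hij b)
            (by simp) ?_ hq
          rintro k l hkl c s ⟨hk, rfl⟩ hs
          rw [← mul_assoc, xS_commute k j k l hij hkl hij.symm hkl, mul_assoc, hs, mul_assoc]
        · exact ⟨a, _, mul_mem (xS_mem_gensGroup ⟨by omega, rfl⟩ hij b) hq, by rw [mul_assoc]⟩
      have h1 := act_row hq
      have ha : a = 0 := by
        have h2 := congrArg (fun v => v N) (h m)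
        beta_reduce at h2
        rw [act_mul, act_xS, if_pos rfl, map_add] at h2
        have h3 : (toGLinf K q : Module.End K (ℕ →₀ K)) (Finsupp.single N a) = Finsupp.single N a := by
          have h4 := h1 N (Or.inr rfl)
          rw [act] at h4
          rw [← mul_one a, ← smul_eq_mul, ← Finsupp.smul_single, map_smul, h4]
        have h5 := h1 m (Or.inl le_rfl)
        rw [act] at h5
        rw [h3, Finsupp.add_apply, h5, Finsupp.single_eq_same, Finsupp.single_apply,
          if_neg (Ne.symm hmN), zero_add] at h2
        exact h2
      subst ha
      rw [xS_zero, mul_one] at h ⊢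
      exact ih hq h

/-- The block of size `m` normalizes column `N`: conjugating `x_{kN}(b)` by `x_{ij}(a)` either fixes
it or, for `j = k`, multiplies it by `x_{iN}(ab)`. -/
theorem conj_col {N m : ℕ} (hm : m ≤ N) {s p : St K}
    (hs : s ∈ gensGroup (K := K) (fun i j => i < m ∧ j < m))
    (hp : p ∈ gensGroup (K := K) (fun i j => i < m ∧ j = N)) :
    s * p * s⁻¹ ∈ gensGroup (K := K) (fun i j => i < m ∧ j = N) := by
  refine gensGroup_induction (Q := fun s => s * p * s⁻¹ ∈ gensGroup (K := K)
    (fun i j => i < m ∧ j = N)) (by simpa) ?_ hs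
  rintro i j h a s ⟨hi, hj⟩ hq
  rw [_root_.mul_inv_rev, ← mul_assoc, mul_assoc (xS i j h a), mul_assoc (xS i j h a)]
  refine gensGroup_induction (Q := fun q => xS i j h a * q * (xS i j h a)⁻¹ ∈ gensGroup (K := K)
    (fun i j => i < m ∧ j = N)) (by simp) ?_ hq
  rintro k l hkl b q ⟨hk, rfl⟩ hq'
  have e : xS i j h a * (xS k l hkl b * q) * (xS i j h a)⁻¹ =
      (xS i j h a * xS k l hkl b * (xS i j h a)⁻¹) * (xS i j h a * q * (xS i j h a)⁻¹) := by group
  rw [e]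
  refine mul_mem ?_ hq'
  by_cases hjk : j = k
  · subst hjk
    have := xS_commutator i j l h hkl (by omega) a b
    rw [commutatorElement_def, mul_inv_eq_iff_eq_mul] at this
    rw [this]
    exact mul_mem (xS_mem_gensGroup ⟨hi, rfl⟩ _ _) (xS_mem_gensGroup ⟨hk, rfl⟩ _ _)
  · rw [xS_commute i j k l h hkl hjk (by omega), mul_inv_cancel_right]
    exact xS_mem_gensGroup ⟨hk, rfl⟩ _ _

theorem conj_row {N m : ℕ} (hm : m ≤ N) {s p : St K}
    (hs : s ∈ gensGroup (K := K) (fun i j => i < m ∧ j < m))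
    (hp : p ∈ gensGroup (K := K) (fun i j => j < m ∧ i = N)) :
    s * p * s⁻¹ ∈ gensGroup (K := K) (fun i j => j < m ∧ i = N) := by
  refine gensGroup_induction (Q := fun s => s * p * s⁻¹ ∈ gensGroup (K := K)
    (fun i j => j < m ∧ i = N)) (by simpa) ?_ hs
  rintro i j h a s ⟨hi, hj⟩ hq
  rw [_root_.mul_inv_rev, ← mul_assoc, mul_assoc (xS i j h a), mul_assoc (xS i j h a)]
  refine gensGroup_induction (Q := fun q => xS i j h a * q * (xS i j h a)⁻¹ ∈ gensGroup (K := K)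
    (fun i j => j < m ∧ i = N)) (by simp) ?_ hq
  rintro k l hkl b q ⟨hk, rfl⟩ hq'
  have e : xS i j h a * (xS k l hkl b * q) * (xS i j h a)⁻¹ =
      (xS i j h a * xS k l hkl b * (xS i j h a)⁻¹) * (xS i j h a * q * (xS i j h a)⁻¹) := by group
  rw [e]
  refine mul_mem ?_ hq'
  by_cases hil : i = l
  · subst hil
    -- The parameter `-b` puts the commutator into the form `x_{ki}(b)⁻¹ x_{ij}(a) x_{ki}(b)
    -- x_{ij}(a)⁻¹` needed here.
    have := xS_commutator k i j hkl h (by omega) (-b) a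
    rw [commutatorElement_def, xS_neg, inv_inv] at this
    have e : xS i j h a * xS k i hkl b * (xS i j h a)⁻¹ = xS k i hkl b *
        ((xS k i hkl b)⁻¹ * xS i j h a * xS k i hkl b * (xS i j h a)⁻¹) := by group
    rw [e, this]
    exact mul_mem (xS_mem_gensGroup ⟨hk, rfl⟩ _ _) (xS_mem_gensGroup ⟨hj, rfl⟩ _ _)
  · rw [xS_commute i j k l h hkl (by omega) hil, mul_inv_cancel_right]
    exact xS_mem_gensGroup ⟨hk, rfl⟩ _ _

/-- Let `z ∈ K_2(K)` involve only indices below `n`, and let `N ≥ n`. The commutator of `z` with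
`x_{iN}(a)`, for `i < N`, lies in the group of column `N`, which embeds into matrices. It has
trivial image, so it is trivial. The same holds for rows, and every `x_{ij}(a)` is a commutator
`[x_{iN}(a), x_{Nj}(1)]` with `N` large. -/
theorem K2_le_center : K2 K ≤ Subgroup.center (St K) := by
  intro z hz
  obtain ⟨n, hn⟩ := exists_bound z
  have hz' : ∀ s : St K, toGLinf K (z * s * z⁻¹ * s⁻¹) = 1 := by
    intro s
    rw [map_mul, map_mul, map_mul, mem_K2.1 hz, one_mul, map_inv, mem_K2.1 hz, inv_one, mul_one,
      map_inv, mul_inv_cancel]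
  have hz'' : ∀ (s : St K) k, act (z * s * z⁻¹ * s⁻¹) k = Finsupp.single k 1 := fun s =>
    act_of_mem_K2 (mem_K2.2 (hz' s))
  have hcol : ∀ N, n ≤ N → ∀ i (h : i ≠ N) (a : K), i < N → z * xS i N h a = xS i N h a * z := by
    intro N hN i h a hi
    have hx : xS i N h a ∈ gensGroup (K := K) (fun i j => i < N ∧ j = N) :=
      xS_mem_gensGroup ⟨hi, rfl⟩ h a
    have hzN : z ∈ gensGroup (K := K) (fun i j => i < N ∧ j < N) :=
      gensGroup_mono (fun i j hij => ⟨by omega, by omega⟩) hn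
    rw [← mul_inv_eq_iff_eq_mul, ← mul_inv_eq_one]
    exact col_eq_one (mul_mem (conj_col le_rfl hzN hx) (inv_mem hx)) (hz'' _ _)
  have hrow : ∀ N, n ≤ N → ∀ i (h : N ≠ i) (a : K), i < N → z * xS N i h a = xS N i h a * z := by
    intro N hN i h a hi
    have hx : xS N i h a ∈ gensGroup (K := K) (fun i j => j < N ∧ i = N) :=
      xS_mem_gensGroup ⟨hi, rfl⟩ h a
    have hzN : z ∈ gensGroup (K := K) (fun i j => i < N ∧ j < N) :=
      gensGroup_mono (fun i j hij => ⟨by omega, by omega⟩) hn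
    rw [← mul_inv_eq_iff_eq_mul, ← mul_inv_eq_one]
    exact row_eq_one (mul_mem (conj_row le_rfl hzN hx) (inv_mem hx)) (hz'' _)
  have hall : ∀ i j (h : i ≠ j) (a : K), Commute z (xS i j h a) := by
    intro i j h a
    set N := n + i + j + 1 with hN
    have h1 : Commute z (xS i N (by omega) a) := hcol N (by omega) i (by omega) a (by omega)
    have h2 : Commute z (xS N j (by omega) (1 : K)) := hrow N (by omega) j (by omega) 1 (by omega)
    have h3 := xS_commutator i N j (by omega) (by omega) h a 1
    rw [mul_one] at h3
    rw [← h3, commutatorElement_def]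
    exact ((h1.mul_right h2).mul_right h1.inv_right).mul_right h2.inv_right
  rw [Subgroup.mem_center_iff]
  intro g
  have hg : g ∈ gensGroup (K := K) (fun _ _ => True) := by rw [gensGroup_true]; trivial
  refine gensGroup_induction (Q := fun g => g * z = z * g) (by simp) ?_ hg
  rintro i j h a s - hs
  rw [mul_assoc, hs, ← mul_assoc, ← (hall i j h a).eq, mul_assoc]

/-! ### Monomial elements -/

/-- `s` acts on `K^(ℕ)` by the monomial matrix `e_k ↦ d_k e_{σ k}`. -/
def IsMono (s : St K) (σ : Equiv.Perm ℕ) (d : ℕ → Kˣ) : Prop :=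
  ∀ k, act s k = Finsupp.single (σ k) (d k : K)

theorem IsMono.apply_single {s : St K} {σ : Equiv.Perm ℕ} {d : ℕ → Kˣ} (h : IsMono s σ d)
    (k : ℕ) (b : K) : (toGLinf K s : Module.End K (ℕ →₀ K)) (Finsupp.single k b) =
      Finsupp.single (σ k) (b * d k) := by
  have := h k
  rw [act] at this
  rw [← mul_one b, ← smul_eq_mul, ← Finsupp.smul_single, map_smul, this, Finsupp.smul_single,
    smul_eq_mul, smul_eq_mul, mul_one]

theorem isMono_one : IsMono (1 : St K) 1 1 := fun k => by
  rw [act_one]; rfl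

theorem IsMono.mul {s t : St K} {σ τ : Equiv.Perm ℕ} {d e : ℕ → Kˣ} (hs : IsMono s σ d)
    (ht : IsMono t τ e) : IsMono (s * t) (σ * τ) (fun k => d (τ k) * e k) := fun k => by
  rw [act_mul, ht k, hs.apply_single, mul_comm, Units.val_mul]
  rfl

theorem commutator_mul_center {G : Type*} [Group G] (x y : G) {z z' : G}
    (hz : z ∈ Subgroup.center G) (hz' : z' ∈ Subgroup.center G) : ⁅x * z, y * z'⁆ = ⁅x, y⁆ := by
  have c1 := Subgroup.mem_center_iff.1 hz
  have c2 := Subgroup.mem_center_iff.1 hz'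
  simp only [commutatorElement_def, _root_.mul_inv_rev]
  calc _ = x * (z * (y * z' * z⁻¹)) * x⁻¹ * z'⁻¹ * y⁻¹ := by group
    _ = x * (y * z') * x⁻¹ * z'⁻¹ * y⁻¹ := by rw [← c1, inv_mul_cancel_right]
    _ = x * y * (z' * x⁻¹) * z'⁻¹ * y⁻¹ := by group
    _ = x * y * (x⁻¹ * z') * z'⁻¹ * y⁻¹ := by rw [c2 x⁻¹]
    _ = _ := by group

theorem IsMono.inv {s : St K} {σ : Equiv.Perm ℕ} {d : ℕ → Kˣ} (hs : IsMono s σ d) :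
    IsMono s⁻¹ σ.symm (fun k => (d (σ.symm k))⁻¹) := fun k => by
  have h := hs.apply_single (σ.symm k) ((d (σ.symm k))⁻¹ : Kˣ)
  rw [Units.inv_mul, Equiv.apply_symm_apply] at h
  rw [act, ← h, ← Module.End.mul_apply, ← Units.val_mul, ← map_mul, inv_mul_cancel, map_one]
  rfl

theorem IsMono.toGLinf_conj {s : St K} {σ : Equiv.Perm ℕ} {d : ℕ → Kˣ} (hs : IsMono s σ d)
    (i j : ℕ) (h : i ≠ j) (a : K) :
    toGLinf K (s * xS i j h a * s⁻¹) =
      toGLinf K (xS (σ i) (σ j) (σ.injective.ne h) (d i * a * ((d j)⁻¹ : Kˣ))) := by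
  have h1 : toGLinf K (s * xS i j h a) =
      toGLinf K (xS (σ i) (σ j) (σ.injective.ne h) (d i * a * ((d j)⁻¹ : Kˣ)) * s) := by
    apply toGLinf_ext
    intro k
    rw [act_mul, act_mul, act_xS, hs k, map_add, hs.apply_single, one_mul, toGLinf_xS, elem_single]
    congr 1
    simp only [EmbeddingLike.apply_eq_iff_eq]
    split_ifs with hk
    · subst hk
      rw [hs.apply_single, mul_assoc, Units.inv_mul, mul_one, mul_comm]
    · rw [map_zero]
  rw [map_mul, h1, map_mul, map_inv, mul_inv_cancel_right]

/-- A lift of a monomial matrix permutes the generators of the Steinberg group. -/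
theorem IsMono.conj {s : St K} {σ : Equiv.Perm ℕ} {d : ℕ → Kˣ} (hs : IsMono s σ d)
    (i j : ℕ) (h : i ≠ j) (a : K) :
    s * xS i j h a * s⁻¹ = xS (σ i) (σ j) (σ.injective.ne h) (d i * a * ((d j)⁻¹ : Kˣ)) := by
  have key : ∀ i j (h : i ≠ j) (a : K), ∃ z ∈ Subgroup.center (St K), s * xS i j h a * s⁻¹ =
      xS (σ i) (σ j) (σ.injective.ne h) (d i * a * ((d j)⁻¹ : Kˣ)) * z := by
    intro i j h a
    refine ⟨(xS (σ i) (σ j) (σ.injective.ne h) (d i * a * ((d j)⁻¹ : Kˣ)))⁻¹ *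
      (s * xS i j h a * s⁻¹), K2_le_center (mem_K2.2 ?_), by group⟩
    rw [map_mul, hs.toGLinf_conj, map_inv, inv_mul_cancel]
  -- Writing `x_{ij}(a) = [x_{ik}(a), x_{kj}(1)]` with a third index removes the ambiguity: the
  -- central defects of the two conjugated factors do not affect their commutator.
  set k := i + j + 1 with hk
  obtain ⟨z, hz, h1⟩ := key i k (by omega) a
  obtain ⟨z', hz', h2⟩ := key k j (by omega) 1
  have h3 := xS_commutator i k j (by omega) (by omega) h a 1
  rw [mul_one] at h3
  have h4 : s * ⁅xS i k (by omega) a, xS k j (by omega) (1 : K)⁆ * s⁻¹ =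
      ⁅s * xS i k (by omega) a * s⁻¹, s * xS k j (by omega) (1 : K) * s⁻¹⁆ := by
    simp only [commutatorElement_def]; group
  rw [← h3, h4, h1, h2, commutator_mul_center _ _ hz hz', xS_commutator _ _ _ _ _ (σ.injective.ne h)]
  congr 1
  have : (((d k)⁻¹ : Kˣ) : K) * d k = 1 := Units.inv_mul _
  linear_combination (d i * a * ((d j)⁻¹ : Kˣ)) * this

theorem IsMono.inv_conj {s : St K} {σ : Equiv.Perm ℕ} {d : ℕ → Kˣ} (hs : IsMono s σ d)
    (i j : ℕ) (h : i ≠ j) (a : K) :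
    ∃ b, xS i j h a * s = s * xS (σ.symm i) (σ.symm j) (σ.symm.injective.ne h) b := by
  have := hs.inv.conj i j h a
  rw [inv_inv] at this
  refine ⟨(d (σ.symm i))⁻¹ * a * d (σ.symm j), ?_⟩
  rw [Units.val_inv_eq_inv_val, inv_inv] at this
  rw [Units.val_inv_eq_inv_val, ← this]
  group

/-! ### Weyl elements -/

/-- The Weyl element `w_{ij}(u)` of the Steinberg group. -/
def weylS (i j : ℕ) (h : i ≠ j) (u : Kˣ) : St K :=
  xS i j h (u : K) * xS j i h.symm (-(u : K)⁻¹) * xS i j h (u : K)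

theorem isMono_weylS (i j : ℕ) (h : i ≠ j) (u : Kˣ) :
    IsMono (weylS i j h u) (Equiv.swap i j)
      (fun k => if k = i then -u⁻¹ else if k = j then u else 1) := by
  intro k
  rw [weylS, mul_assoc, act_mul, act_mul, act_xS, toGLinf_xS, toGLinf_xS]
  by_cases hi : k = i
  · subst hi
    simp only [h, if_false, add_zero, elem_single, if_true, map_add, Equiv.swap_apply_left]
    simp
  · by_cases hj : k = j
    · subst hj
      simp only [h, if_false, elem_single, if_true, map_add, Equiv.swap_apply_right, h.symm]
      simp [add_assoc, add_comm]
    · simp [hi, hj, elem_single, Equiv.swap_apply_of_ne_of_ne]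

/-- The rank one pair `x_{ij}, x_{ji}` in the Steinberg group. -/
def rankOneS (i j : ℕ) (h : i ≠ j) : RankOne K (St K) where
  x := xS i j h
  y := xS j i h.symm
  x_add := xS_add i j h
  y_add := xS_add j i h.symm
  weyl u hu a := by
    have := (isMono_weylS i j h (Units.mk0 u hu)).conj i j h a
    rw [mul_inv_eq_iff_eq_mul] at this
    simp only [weylS, Units.val_mk0, Equiv.swap_apply_left, Equiv.swap_apply_right] at this
    rw [this]
    congr 1
    simp [h.symm]
    field_simp

end

/-! ### Relations between Weyl elements; independence of the symbols from their indices. -/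

section

variable {K : Type u} [Field K]

theorem rankOneS_w (i j : ℕ) (h : i ≠ j) (u : Kˣ) : (rankOneS i j h).w (u : K) = weylS i j h u := rfl

theorem weylS_symm (i j : ℕ) (h : i ≠ j) (u : Kˣ) : weylS j i h.symm u = weylS i j h (-u⁻¹) := by
  have := (rankOneS (K := K) i j h).w_eq (-u⁻¹ : Kˣ).ne_zero
  rw [← rankOneS_w i j, this]
  simp [rankOneS, weylS, inv_neg]

theorem weylS_inv (i j : ℕ) (h : i ≠ j) (u : Kˣ) : (weylS i j h u)⁻¹ = weylS i j h (-u) := by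
  rw [← rankOneS_w, ← rankOneS_w, ← RankOne.w_neg, Units.val_neg]

theorem IsMono.conj_weylS {s : St K} {σ : Equiv.Perm ℕ} {d : ℕ → Kˣ} (hs : IsMono s σ d)
    (i j : ℕ) (h : i ≠ j) (u : Kˣ) : s * weylS i j h u =
      weylS (σ i) (σ j) (σ.injective.ne h) (d i * u * (d j)⁻¹) * s := by
  rw [← mul_inv_eq_iff_eq_mul]
  have e : s * weylS i j h u * s⁻¹ = (s * xS i j h (u : K) * s⁻¹) *
    (s * xS j i h.symm (-(u : K)⁻¹) * s⁻¹) * (s * xS i j h (u : K) * s⁻¹) := by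
    simp only [weylS]; group
  have e2 : -(((d i * u * (d j)⁻¹ : Kˣ) : K))⁻¹ = d j * -(u : K)⁻¹ * ((d i)⁻¹ : Kˣ) := by
    simp only [Units.val_mul, Units.val_inv_eq_inv_val]
    field_simp
  rw [e, hs.conj, hs.conj, weylS, e2]
  simp only [Units.val_mul]

theorem IsMono.weylS_mul {s : St K} {σ : Equiv.Perm ℕ} {d : ℕ → Kˣ} (hs : IsMono s σ d)
    (i j : ℕ) (h : i ≠ j) (u : Kˣ) : ∃ v, weylS i j h u * s =
      s * weylS (σ.symm i) (σ.symm j) (σ.symm.injective.ne h) v := by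
  have h2 := hs.inv.conj_weylS i j h u
  refine ⟨(d (σ.symm i))⁻¹ * u * (d (σ.symm j))⁻¹⁻¹, ?_⟩
  rw [← mul_inv_cancel_left s (weylS i j h u), h2]
  group

theorem isMono_h (i j : ℕ) (h : i ≠ j) (u : Kˣ) : IsMono ((rankOneS i j h).h (u : K)) 1
    (fun k => if k = i then u else if k = j then u⁻¹ else 1) := by
  have h1 := (isMono_weylS i j h u).mul (isMono_weylS i j h (-1))
  rw [Equiv.swap_mul_self] at h1
  have e : weylS i j h u * weylS i j h (-1) = (rankOneS i j h).h (u : K) := by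
    rw [← rankOneS_w, ← rankOneS_w, Units.val_neg, Units.val_one]; rfl
  rw [e] at h1
  convert h1 using 2 with k
  by_cases hi : k = i
  · subst hi
    simp [h.symm]
  · by_cases hj : k = j
    · subst hj
      simp [h.symm]
    · simp [hi, hj, Equiv.swap_apply_of_ne_of_ne]

/-- The Steinberg symbol `{u, v}` formed with the indices `i, j`. -/
def symS (i j : ℕ) (h : i ≠ j) (u v : Kˣ) : St K := (rankOneS i j h).sym (u : K) v

theorem symS_mem_K2 (i j : ℕ) (h : i ≠ j) (u v : Kˣ) : symS i j h u v ∈ K2 K := by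
  have h1 := ((isMono_h i j h u).mul (isMono_h i j h v)).mul (isMono_h i j h (u * v)).inv
  refine mem_K2_of_act fun k => ?_
  have h2 := h1 k
  rw [Units.val_mul] at h2
  rw [symS, RankOne.sym, h2]
  change Finsupp.single k _ = _
  congr 1
  change (((if k = i then u else if k = j then u⁻¹ else 1) *
    (if k = i then v else if k = j then v⁻¹ else 1) *
    (if k = i then u * v else if k = j then (u * v)⁻¹ else 1)⁻¹ : Kˣ) : K) = 1
  rw [Units.val_eq_one]
  split_ifs
  · rw [mul_inv_cancel]
  · rw [inv_inv, ← mul_inv, inv_mul_cancel]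
  · simp

/-- The symbol is central, so conjugation by `s` fixes it; but conjugation also moves the indices by
`σ`, and it keeps the parameters because the coefficients at `i` and `j` are `1`. -/
theorem IsMono.symS_eq {s : St K} {σ : Equiv.Perm ℕ} {d : ℕ → Kˣ} (hs : IsMono s σ d)
    (i j : ℕ) (h : i ≠ j) (hi : d i = 1) (hj : d j = 1) (u v : Kˣ) :
    symS i j h u v = symS (σ i) (σ j) (σ.injective.ne h) u v := by
  have hw : ∀ u : Kˣ, s * (rankOneS i j h).w (u : K) * s⁻¹ =
      (rankOneS (σ i) (σ j) (σ.injective.ne h)).w (u : K) := by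
    intro u
    rw [rankOneS_w, rankOneS_w, hs.conj_weylS, mul_inv_cancel_right]
    simp [hi, hj]
  have hh : ∀ u : Kˣ, s * (rankOneS i j h).h (u : K) * s⁻¹ =
      (rankOneS (σ i) (σ j) (σ.injective.ne h)).h (u : K) := by
    intro u
    have h1 := hw (-1)
    rw [Units.val_neg, Units.val_one] at h1
    rw [RankOne.h, RankOne.h, ← hw, ← h1]
    group
  have hc := Subgroup.mem_center_iff.1 (K2_le_center (symS_mem_K2 i j h u v)) s
  rw [← mul_inv_eq_iff_eq_mul] at hc
  rw [← hc, symS, symS, RankOne.sym, RankOne.sym, ← Units.val_mul, ← hh, ← hh, ← hh]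
  group

theorem symS_eq_left (i j k : ℕ) (h : i ≠ j) (h' : k ≠ j) (u v : Kˣ) :
    symS i j h u v = symS k j h' u v := by
  by_cases hik : i = k
  · subst hik; rfl
  -- The parameter `-1` makes the coefficient at `i` equal to `-(-1)⁻¹ = 1`.
  · have := (isMono_weylS (K := K) i k hik (-1)).symS_eq i j h (by simp) (by simp [h.symm, h'.symm]) u v
    rw [this]
    congr 1
    · simp
    · rw [Equiv.swap_apply_of_ne_of_ne h.symm h'.symm]

theorem symS_eq_right (i j k : ℕ) (h : i ≠ j) (h' : i ≠ k) (u v : Kˣ) :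
    symS i j h u v = symS i k h' u v := by
  by_cases hjk : j = k
  · subst hjk; rfl
  · have := (isMono_weylS (K := K) j k hjk (-1)).symS_eq i j h (by simp [h, h']) (by simp) u v
    rw [this]
    congr 1
    · rw [Equiv.swap_apply_of_ne_of_ne h h']
    · simp

theorem symS_eq (i j : ℕ) (h : i ≠ j) (u v : Kˣ) : symS i j h u v = symS 0 1 zero_ne_one u v := by
  -- Passing through two fresh indices keeps the two indices distinct at every exchange.
  rw [symS_eq_left i j (i + j + 2) h (by omega), symS_eq_right _ _ (i + j + 3) _ (by omega),
    symS_eq_left _ _ 0 _ (by omega), symS_eq_right _ _ 1 _ zero_ne_one]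

/-- The subgroup of `St(K)` generated by the Steinberg symbols. -/
def symGroupS (K : Type u) [Field K] : Subgroup (St K) :=
  Subgroup.closure {s | ∃ u v : Kˣ, s = symS 0 1 zero_ne_one u v}

theorem symS_mem (i j : ℕ) (h : i ≠ j) (u v : Kˣ) : symS i j h u v ∈ symGroupS K := by
  rw [symS_eq]
  exact Subgroup.subset_closure ⟨u, v, rfl⟩

theorem symGroupS_le_K2 : symGroupS K ≤ K2 K := by
  rw [symGroupS, Subgroup.closure_le]
  rintro _ ⟨u, v, rfl⟩
  exact symS_mem_K2 _ _ _ _ _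

theorem symGroupS_comm {c : St K} (hc : c ∈ symGroupS K) (g : St K) : g * c = c * g :=
  Subgroup.mem_center_iff.1 (K2_le_center (symGroupS_le_K2 hc)) g

/-! ### Monomial elements of `K_2` -/

/-- The subgroup generated by the Weyl elements with indices below `n`. -/
def weylGroup (K : Type u) [Field K] (n : ℕ) : Subgroup (St K) :=
  Subgroup.closure {s | ∃ i j h u, i < n ∧ j < n ∧ s = weylS i j h u}

theorem weylS_mem {n i j : ℕ} (hi : i < n) (hj : j < n) (h : i ≠ j) (u : Kˣ) :
    weylS i j h u ∈ weylGroup K n :=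
  Subgroup.subset_closure ⟨i, j, h, u, hi, hj, rfl⟩

theorem weylGroup_mono {m n : ℕ} (h : m ≤ n) : weylGroup K m ≤ weylGroup K n := by
  apply Subgroup.closure_mono
  rintro _ ⟨i, j, hij, u, hi, hj, rfl⟩
  exact ⟨i, j, hij, u, by omega, by omega, rfl⟩

theorem weylGroup_induction {n : ℕ} {Q : St K → Prop} (h1 : Q 1)
    (hmul : ∀ i j (h : i ≠ j) u s, i < n → j < n → Q s → Q (s * weylS i j h u)) {s : St K}
    (hs : s ∈ weylGroup K n) : Q s := by
  induction hs using Subgroup.closure_induction_right with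
  | one => exact h1
  | mul_right z _ g hg hz =>
    obtain ⟨i, j, h, u, hi, hj, rfl⟩ := hg
    exact hmul i j h u z hi hj hz
  | mul_inv_cancel z _ g hg hz =>
    obtain ⟨i, j, h, u, hi, hj, rfl⟩ := hg
    rw [weylS_inv]
    exact hmul i j h _ z hi hj hz

theorem exists_isMono {n : ℕ} {s : St K} (hs : s ∈ weylGroup K n) :
    ∃ σ d, IsMono s σ d ∧ ∀ k, n ≤ k → σ k = k ∧ d k = 1 := by
  refine weylGroup_induction (Q := fun s => ∃ σ d, IsMono s σ d ∧ ∀ k, n ≤ k → σ k = k ∧ d k = 1)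
    ⟨1, 1, isMono_one, fun _ _ => ⟨rfl, rfl⟩⟩ ?_ hs
  rintro i j h u s hi hj ⟨σ, d, hσ, hk⟩
  refine ⟨_, _, hσ.mul (isMono_weylS i j h u), fun k hnk => ?_⟩
  have e : Equiv.swap i j k = k := Equiv.swap_apply_of_ne_of_ne (by omega) (by omega)
  rw [Equiv.Perm.mul_apply, e, (hk k hnk).2, if_neg (by omega), if_neg (by omega)]
  exact ⟨(hk k hnk).1, one_mul _⟩

/-- Since `w(v) = w(1)⁻¹ h(-v)⁻¹` and `w(u) = h(u) w(1)`, the product is `h(u) h(-v)⁻¹ h(t) w(1)`,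
and `h` is multiplicative up to symbols. -/
theorem weylS_mul_mul (i j : ℕ) (h : i ≠ j) (u v t : Kˣ) : ∃ c ∈ symGroupS K,
    weylS i j h u * weylS i j h v * weylS i j h t = c * weylS i j h (-u * v⁻¹ * t) := by
  set R := rankOneS (K := K) i j h with hR
  have h1 : weylS i j h v = (R.w 1)⁻¹ * (R.h (-v : Kˣ))⁻¹ := by
    rw [← _root_.mul_inv_rev, ← R.w_eq_h_mul, hR, rankOneS_w, weylS_inv, neg_neg]
  have h2 : R.h u = (R.sym (u * (-v)⁻¹ : Kˣ) (-v : Kˣ))⁻¹ *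
      (R.h (u * (-v)⁻¹ : Kˣ) * R.h (-v : Kˣ)) := by
    rw [R.h_mul_h, inv_mul_cancel_left, ← Units.val_mul, inv_mul_cancel_right]
  have h3 := R.h_mul_h (u * (-v)⁻¹ : Kˣ) t
  rw [← Units.val_mul] at h3
  refine ⟨(symS i j h (u * (-v)⁻¹) (-v))⁻¹ * symS i j h (u * (-v)⁻¹) t,
    mul_mem (inv_mem (symS_mem _ _ _ _ _)) (symS_mem _ _ _ _ _), ?_⟩
  have e : -u * v⁻¹ * t = u * (-v)⁻¹ * t := by
    rw [inv_neg]; simp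
  rw [h1, e, ← rankOneS_w, ← rankOneS_w, ← rankOneS_w, ← hR, R.w_eq_h_mul, R.w_eq_h_mul t,
    R.w_eq_h_mul (u * (-v)⁻¹ * t : Kˣ), h2]
  change _ = (R.sym _ _)⁻¹ * R.sym _ _ * _
  rw [mul_assoc (_)⁻¹ (R.sym _ _), ← mul_assoc (R.sym _ _) (R.h _), ← h3]
  group

/-- A normal form modulo symbols, with `q` in the smaller Weyl group on the left and at most two
Weyl elements involving `n` on the right. Right multiplication by a generator preserves it.
Generators with indices below `n` move to the left. For `i ≠ k`, `w_{in}(u) w_{kn}(v) = w_{ki}(t)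
w_{in}(u)`, and the first factor joins `q`. Three factors with the same `i` collapse by
`weylS_mul_mul`. -/
theorem weylGroup_succ {n : ℕ} {s : St K} (hs : s ∈ weylGroup K (n + 1)) :
    ∃ q ∈ weylGroup K n, ∃ c ∈ symGroupS K, s = c * q ∨
      (∃ i h u, i < n ∧ s = c * q * weylS i n h u) ∨
      ∃ i h u v, i < n ∧ s = c * q * (weylS i n h u * weylS i n h v) := by
  have hgen : ∀ i j (h : i ≠ j) (u : Kˣ), i < n + 1 → j < n + 1 →
      (i < n ∧ j < n) ∨ ∃ k h' v, k < n ∧ weylS i j h u = weylS k n h' v := by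
    intro i j h u hi hj
    by_cases hin : i = n
    · subst hin
      refine Or.inr ⟨j, h.symm, -u⁻¹, by omega, ?_⟩
      rw [weylS_symm j i h.symm]
    · by_cases hjn : j = n
      · subst hjn
        exact Or.inr ⟨i, h, u, by omega, rfl⟩
      · exact Or.inl ⟨by omega, by omega⟩
  have hmove : ∀ i k (hi : i ≠ n) (hk : k ≠ n) (u v : Kˣ), i ≠ k → ∃ h t,
      weylS i n hi u * weylS k n hk v = weylS k i h t * weylS i n hi u := by
    intro i k hi hk u v hik
    rw [(isMono_weylS i n hi u).conj_weylS k n hk v]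
    have e1 : Equiv.swap i n k = k := Equiv.swap_apply_of_ne_of_ne (Ne.symm hik) hk
    have e2 : Equiv.swap i n n = i := Equiv.swap_apply_right _ _
    simp only [e1, e2]
    exact ⟨Ne.symm hik, _, rfl⟩
  refine weylGroup_induction (Q := fun s => ∃ q ∈ weylGroup K n, ∃ c ∈ symGroupS K, s = c * q ∨
      (∃ i h u, i < n ∧ s = c * q * weylS i n h u) ∨
      ∃ i h u v, i < n ∧ s = c * q * (weylS i n h u * weylS i n h v))
    ⟨1, one_mem _, 1, one_mem _, Or.inl (mul_one 1).symm⟩ ?_ hs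
  rintro j k hjk t _ hj hk ⟨q, hq, c, hc, hs⟩
  obtain ⟨hj, hk⟩ | ⟨k, hk', t, hk, e⟩ := hgen j k hjk t hj hk
  · refine ⟨q * weylS j k hjk t, mul_mem hq (weylS_mem hj hk _ _), c, hc, ?_⟩
    have e2 : Equiv.swap j k n = n := Equiv.swap_apply_of_ne_of_ne (by omega) (by omega)
    have e3 : ∀ i, i < n → Equiv.swap j k i < n := by
      intro i hi
      rw [Equiv.swap_apply_def]; split_ifs <;> omega
    have hpast : ∀ i (hi : i ≠ n) (u : Kˣ), i < n → ∃ h' t', weylS i n hi u * weylS j k hjk t =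
        weylS j k hjk t * weylS (Equiv.swap j k i) n h' t' := by
      intro i hi u hin
      obtain ⟨t', ht'⟩ := (isMono_weylS j k hjk t).weylS_mul i n hi u
      rw [Equiv.symm_swap] at ht'
      simp only [e2] at ht'
      exact ⟨by have := e3 i hin; omega, t', ht'⟩
    obtain rfl | ⟨i, h, u, hi, rfl⟩ | ⟨i, h, u, v, hi, rfl⟩ := hs
    · left
      rw [mul_assoc]
    · right; left
      obtain ⟨h', t', e⟩ := hpast i h u hi
      exact ⟨_, h', t', e3 i hi, by rw [mul_assoc, e]; group⟩
    · right; right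
      obtain ⟨h', t', ht'⟩ := hpast i h v hi
      obtain ⟨_, t'', ht''⟩ := hpast i h u hi
      refine ⟨_, h', t'', t', e3 i hi, ?_⟩
      rw [mul_assoc, mul_assoc _ _ (weylS j k hjk t), ht', ← mul_assoc _ (weylS j k hjk t), ht'']
      group
  · rw [e]
    obtain rfl | ⟨i, h, u, hi, rfl⟩ | ⟨i, h, u, v, hi, rfl⟩ := hs
    · exact ⟨q, hq, c, hc, Or.inr (Or.inl ⟨k, hk', t, hk, rfl⟩)⟩
    · by_cases hik : i = k
      · subst hik
        exact ⟨q, hq, c, hc, Or.inr (Or.inr ⟨i, hk', u, t, hk, mul_assoc _ _ _⟩)⟩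
      · obtain ⟨h', t', e'⟩ := hmove i k h hk' u t hik
        refine ⟨q * weylS k i h' t', mul_mem hq (weylS_mem hk hi _ _), c, hc,
          Or.inr (Or.inl ⟨i, h, u, hi, ?_⟩)⟩
        rw [mul_assoc, e']
        group
    · by_cases hik : i = k
      · subst hik
        obtain ⟨c', hc', e'⟩ := weylS_mul_mul i n h u v t
        refine ⟨q, hq, c * c', mul_mem hc hc', Or.inr (Or.inl ⟨i, h, -u * v⁻¹ * t, hi, ?_⟩)⟩
        rw [mul_assoc, e', ← mul_assoc, mul_assoc c q, symGroupS_comm hc', ← mul_assoc]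
      · obtain ⟨h', t', e'⟩ := hmove i k h hk' v t hik
        obtain ⟨t'', ht''⟩ := (isMono_weylS k i h' t').weylS_mul i n h u
        have e1 : Equiv.swap k i i = k := Equiv.swap_apply_right _ _
        have e2 : Equiv.swap k i n = n := Equiv.swap_apply_of_ne_of_ne hk'.symm h.symm
        rw [Equiv.symm_swap] at ht''
        simp only [e1, e2] at ht''
        obtain ⟨h3, t3, e3⟩ := hmove k i hk' h t'' v (Ne.symm hik)
        refine ⟨q * weylS k i h' t' * weylS i k h3 t3,
          mul_mem (mul_mem hq (weylS_mem hk hi _ _)) (weylS_mem hi hk _ _), c, hc,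
          Or.inr (Or.inl ⟨k, hk', t'', hk, ?_⟩)⟩
        rw [mul_assoc, mul_assoc _ _ (weylS k n hk' t), e', ← mul_assoc _ (weylS k i h' t'), ht'',
          mul_assoc _ _ (weylS i n h v), e3]
        group

/-- Induction on `n` through the normal form. An element ending in a single `w_{in}(u)` moves the
line of `e_n`, so it is not in `K_2(K)`. One ending in `w_{in}(u) w_{in}(v)` fixes `e_n` only if `v
= -u`, and then the two factors cancel. -/
theorem weylGroup_inf_K2 {n : ℕ} {s : St K} (hs : s ∈ weylGroup K n) (h1 : s ∈ K2 K) :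
    s ∈ symGroupS K := by
  induction n generalizing s with
  | zero =>
    refine weylGroup_induction (Q := fun s => s ∈ symGroupS K) (one_mem _) ?_ hs
    intro i j h u s hi
    omega
  | succ n ih =>
    obtain ⟨q, hq, c, hc, rfl | ⟨i, h, u, hi, rfl⟩ | ⟨i, h, u, v, hi, rfl⟩⟩ := weylGroup_succ hs
    · exact mul_mem hc (ih hq ((Subgroup.mul_mem_cancel_left _ (symGroupS_le_K2 hc)).1 h1))
    · exfalso
      obtain ⟨σ, d, hσ, hk⟩ := exists_isMono hq
      rw [mul_assoc, Subgroup.mul_mem_cancel_left _ (symGroupS_le_K2 hc)] at h1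
      have h2 := (hσ.mul (isMono_weylS i n h u)) n
      rw [act_of_mem_K2 h1, Equiv.Perm.mul_apply, Equiv.swap_apply_right,
        Finsupp.single_eq_single_iff] at h2
      obtain ⟨h3, -⟩ | ⟨h3, -⟩ := h2
      · have := σ.injective (h3.symm.trans (hk n le_rfl).1.symm)
        omega
      · exact one_ne_zero h3
    · obtain ⟨σ, d, hσ, hk⟩ := exists_isMono hq
      rw [mul_assoc, Subgroup.mul_mem_cancel_left _ (symGroupS_le_K2 hc)] at h1
      have h2 := (hσ.mul ((isMono_weylS i n h u).mul (isMono_weylS i n h v))) n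
      rw [act_of_mem_K2 h1, Equiv.Perm.mul_apply, Equiv.Perm.mul_apply, Equiv.swap_apply_right,
        Equiv.swap_apply_left, (hk n le_rfl).1] at h2
      have h3 := Finsupp.single_injective _ h2
      beta_reduce at h3
      rw [Equiv.swap_mul_self, Equiv.Perm.one_apply, (hk n le_rfl).2, Equiv.swap_apply_right] at h3
      simp only [if_true, h.symm, if_false, one_mul] at h3
      have h4 : v = -u := by
        rw [← Units.val_one, Units.val_inj] at h3
        have := congrArg (fun x => -u * x) h3
        simpa using this.symm
      rw [h4, ← weylS_inv, mul_inv_cancel, mul_one] at h1 ⊢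
      exact mul_mem hc (ih hq h1)

end

section

variable {K : Type u} [Field K]

/-! ### The Bruhat decomposition of the Steinberg group -/

theorem act_upper {s : St K} (hs : s ∈ gensGroup (K := K) (fun i j => i < j)) (k : ℕ) :
    act s k k = 1 ∧ ∀ i, k < i → act s k i = 0 := by
  refine gensGroup_induction (Q := fun s => ∀ k, act s k k = 1 ∧ ∀ i, k < i → act s k i = 0)
    ?_ ?_ hs k
  · intro k
    rw [act_one]
    exact ⟨Finsupp.single_eq_same, fun i hi => by rw [Finsupp.single_apply, if_neg (by omega)]⟩
  · intro i j h a s hij ih k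
    have key : ∀ v : ℕ →₀ K, (toGLinf K (xS i j h a) : Module.End K (ℕ →₀ K)) v =
        v + Finsupp.single i (a * v j) := by
      intro v
      rw [toGLinf_xS, elem_val]
      simp [E]
    have h1 := (ih k).1
    have h2 := (ih k).2
    rw [act_mul, key]
    constructor
    · rw [Finsupp.add_apply, h1, Finsupp.single_apply]
      split_ifs with hik
      · rw [h2 j (by omega), mul_zero, add_zero]
      · rw [add_zero]
    · intro l hl
      rw [Finsupp.add_apply, h2 l hl, Finsupp.single_apply, zero_add]
      split_ifs with hil
      · rw [h2 j (by omega), mul_zero]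
      · rfl

/-- The upper unitriangular part of `St(K)` embeds into matrices: an element of size `n + 1` is a
product of its last column, controlled by `col_eq_one`, and an element of size `n`. -/
theorem upper_eq_one {s : St K} (hs : s ∈ gensGroup (K := K) (fun i j => i < j))
    (h1 : s ∈ K2 K) : s = 1 := by
  suffices h : ∀ n, ∀ s ∈ gensGroup (K := K) (fun i j => i < j ∧ j < n), s ∈ K2 K → s = 1 by
    have : ∃ n, s ∈ gensGroup (K := K) (fun i j => i < j ∧ j < n) := by
      refine gensGroup_induction (Q := fun s => ∃ n, s ∈ gensGroup (K := K)
        (fun i j => i < j ∧ j < n)) ⟨0, one_mem _⟩ ?_ hs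
      rintro i j h a s hij ⟨n, hn⟩
      exact ⟨n + j + 1, mul_mem (xS_mem_gensGroup ⟨hij, by omega⟩ h a)
        (gensGroup_mono (fun i j hij => ⟨hij.1, by omega⟩) hn)⟩
    obtain ⟨n, hn⟩ := this
    exact h n s hn h1
  intro n
  induction n with
  | zero =>
    intro s hs _
    refine gensGroup_induction (Q := fun s => s = 1) rfl ?_ hs
    rintro i j _ a s ⟨_, hi⟩
    omega
  | succ n ih =>
    intro s hs h1
    obtain ⟨p, hp, t, ht, rfl⟩ : ∃ p ∈ gensGroup (K := K) (fun i j => i < n ∧ j = n),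
        ∃ t ∈ gensGroup (K := K) (fun i j => i < j ∧ j < n), s = p * t := by
      refine gensGroup_induction (Q := fun s => ∃ p ∈ gensGroup (K := K) (fun i j => i < n ∧ j = n),
        ∃ t ∈ gensGroup (K := K) (fun i j => i < j ∧ j < n), s = p * t)
        ⟨1, one_mem _, 1, one_mem _, (mul_one 1).symm⟩ ?_ hs
      rintro i j h a _ ⟨hij, hj⟩ ⟨p, hp, t, ht, rfl⟩
      by_cases hjn : j = n
      · exact ⟨_, mul_mem (xS_mem_gensGroup ⟨by omega, hjn⟩ h a) hp, t, ht, by rw [mul_assoc]⟩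
      · refine ⟨_, conj_col le_rfl (xS_mem_gensGroup ⟨by omega, by omega⟩ h a) hp, _,
          mul_mem (xS_mem_gensGroup ⟨hij, by omega⟩ h a) ht, ?_⟩
        group
    have ht' : act t n = Finsupp.single n 1 := by
      refine gensGroup_induction (Q := fun t => act t n = Finsupp.single n 1) (act_one n) ?_ ht
      rintro i j h a t ⟨_, hj⟩ ih
      rw [act_mul, ih]
      exact (act_xS i j h a n).trans (by rw [if_neg (by omega), add_zero])
    have h2 := act_of_mem_K2 h1 n
    rw [act_mul, ht'] at h2
    have h3 := col_eq_one hp h2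
    subst h3
    rw [one_mul] at h1 ⊢
    exact ih t ht h1

/-- Upper unitriangular elements with vanishing entry at `(i, i + 1)`. -/
def upperAvoid (i : ℕ) (k l : ℕ) : Prop := k < l ∧ ¬(k = i ∧ l = i + 1)

theorem conj_upperAvoid (i : ℕ) (b : K) {s : St K} (hs : s ∈ gensGroup (K := K) (upperAvoid i)) :
    xS i (i + 1) (by omega) b * s * (xS i (i + 1) (by omega) b)⁻¹ ∈
      gensGroup (K := K) (upperAvoid i) := by
  set x := xS i (i + 1) (by omega) b with hx
  refine gensGroup_induction (Q := fun s => x * s * x⁻¹ ∈ gensGroup (K := K) (upperAvoid i))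
    (by simp) ?_ hs
  rintro k l h a s ⟨hkl, hne⟩ hs
  have e : x * (xS k l h a * s) * x⁻¹ = (x * xS k l h a * x⁻¹) * (x * s * x⁻¹) := by group
  rw [e]
  refine mul_mem ?_ hs
  by_cases hk : k = i + 1
  · subst hk
    have := xS_commutator i (i + 1) l (by omega) h (by omega) b a
    rw [commutatorElement_def, mul_inv_eq_iff_eq_mul, ← hx] at this
    rw [this]
    exact mul_mem (xS_mem_gensGroup ⟨by omega, by omega⟩ _ _)
      (xS_mem_gensGroup ⟨by omega, by omega⟩ _ _)
  · by_cases hl : l = i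
    · subst hl
      have := xS_commutator k l (l + 1) h (by omega) (by omega) (-a) b
      rw [commutatorElement_def, xS_neg, inv_inv, ← hx] at this
      have e : x * xS k l h a * x⁻¹ = xS k l h a * ((xS k l h a)⁻¹ * x * xS k l h a * x⁻¹) := by
        group
      rw [e, this]
      exact mul_mem (xS_mem_gensGroup ⟨by omega, by omega⟩ _ _)
        (xS_mem_gensGroup ⟨by omega, by omega⟩ _ _)
    · rw [hx, xS_commute i (i + 1) k l (by omega) h (Ne.symm hk) (Ne.symm hl), mul_inv_cancel_right]
      exact xS_mem_gensGroup ⟨hkl, hne⟩ _ _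

theorem upper_decomp (i : ℕ) {s : St K} (hs : s ∈ gensGroup (K := K) (fun i j => i < j)) :
    ∃ t ∈ gensGroup (K := K) (upperAvoid i), ∃ a, s = t * xS i (i + 1) (by omega) a := by
  refine gensGroup_induction (Q := fun s => ∃ t ∈ gensGroup (K := K) (upperAvoid i), ∃ a,
    s = t * xS i (i + 1) (by omega) a) ⟨1, one_mem _, 0, by rw [xS_zero, mul_one]⟩ ?_ hs
  rintro k l h b _ hkl ⟨t, ht, a, rfl⟩
  by_cases hk : k = i ∧ l = i + 1
  · obtain ⟨rfl, rfl⟩ := hk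
    refine ⟨_, conj_upperAvoid k b ht, b + a, ?_⟩
    rw [xS_add]
    group
  · exact ⟨_, mul_mem (xS_mem_gensGroup ⟨hkl, hk⟩ h b) ht, a, by rw [mul_assoc]⟩

/-- The transposition of `i` and `i + 1` preserves the order of every pair `k < l` other than `(i, i
+ 1)`. -/
theorem weylS_conj_upperAvoid (i : ℕ) (u : Kˣ) {s : St K}
    (hs : s ∈ gensGroup (K := K) (upperAvoid i)) :
    weylS i (i + 1) (by omega) u * s * (weylS i (i + 1) (by omega) u)⁻¹ ∈
      gensGroup (K := K) (fun i j => i < j) := by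
  have hm := isMono_weylS (K := K) i (i + 1) (by omega) u
  set w := weylS i (i + 1) (by omega) u with hw
  refine gensGroup_induction (Q := fun s => w * s * w⁻¹ ∈ gensGroup (K := K) (fun i j => i < j))
    (by simp) ?_ hs
  rintro k l h a s ⟨hkl, hne⟩ hs
  have e : w * (xS k l h a * s) * w⁻¹ = (w * xS k l h a * w⁻¹) * (w * s * w⁻¹) := by group
  rw [e, hm.conj]
  refine mul_mem (xS_mem_gensGroup ?_ _ _) hs
  rw [Equiv.swap_apply_def, Equiv.swap_apply_def]
  split_ifs <;> omega

/-- The subgroup generated by all Weyl elements. -/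
def weylGroupTop (K : Type u) [Field K] : Subgroup (St K) :=
  Subgroup.closure {s | ∃ i j h u, s = weylS i j h u}

theorem weylS_mem_top (i j : ℕ) (h : i ≠ j) (u : Kˣ) : weylS i j h u ∈ weylGroupTop K :=
  Subgroup.subset_closure ⟨i, j, h, u, rfl⟩

theorem exists_mem_weylGroup {s : St K} (hs : s ∈ weylGroupTop K) : ∃ n, s ∈ weylGroup K n := by
  induction hs using Subgroup.closure_induction with
  | mem s hs =>
    obtain ⟨i, j, h, u, rfl⟩ := hs
    exact ⟨i + j + 1, weylS_mem (by omega) (by omega) h u⟩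
  | one => exact ⟨0, one_mem _⟩
  | mul s t _ _ hs ht =>
    obtain ⟨m, hm⟩ := hs
    obtain ⟨n, hn⟩ := ht
    exact ⟨m + n, mul_mem (weylGroup_mono (by omega) hm) (weylGroup_mono (by omega) hn)⟩
  | inv s _ hs =>
    obtain ⟨m, hm⟩ := hs
    exact ⟨m, inv_mem hm⟩

/-- The union of the Bruhat cells. -/
def bruhatCells (K : Type u) [Field K] : Set (St K) :=
  {s | ∃ a ∈ gensGroup (K := K) (fun i j => i < j), ∃ w ∈ weylGroupTop K,
    ∃ b ∈ gensGroup (K := K) (fun i j => i < j), s = a * w * b}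

theorem upper_mul_bruhat {a s : St K} (ha : a ∈ gensGroup (K := K) (fun i j => i < j))
    (hs : s ∈ bruhatCells K) : a * s ∈ bruhatCells K := by
  obtain ⟨b, hb, w, hw, c, hc, rfl⟩ := hs
  exact ⟨_, mul_mem ha hb, w, hw, c, hc, by simp only [mul_assoc]⟩

theorem bruhat_mul_upper {a s : St K} (ha : a ∈ gensGroup (K := K) (fun i j => i < j))
    (hs : s ∈ bruhatCells K) : s * a ∈ bruhatCells K := by
  obtain ⟨b, hb, w, hw, c, hc, rfl⟩ := hs
  exact ⟨b, hb, w, hw, _, mul_mem hc ha, by simp only [mul_assoc]⟩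

/-- The rank one step of the Bruhat decomposition. The upper factor is split as `t · x_{i,i+1}(a)`
with `t` avoiding the simple root `(i, i + 1)`; then `t` stays upper triangular after crossing the
simple Weyl element, and only `x_{i,i+1}(a)` has to be treated. -/
theorem weylS_mul_bruhat (i : ℕ) (u : Kˣ) {s : St K} (hs : s ∈ bruhatCells K) :
    weylS i (i + 1) (by omega) u * s ∈ bruhatCells K := by
  obtain ⟨b, hb, w, hw, c, hc, rfl⟩ := hs
  rw [← mul_assoc]
  refine bruhat_mul_upper hc ?_
  obtain ⟨t, ht, a, rfl⟩ := upper_decomp i hb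
  have e : weylS i (i + 1) (by omega) u * (t * xS i (i + 1) (by omega) a * w) =
      (weylS i (i + 1) (by omega) u * t * (weylS i (i + 1) (by omega) u)⁻¹) *
        (weylS i (i + 1) (by omega) u * (xS i (i + 1) (by omega) a * w)) := by group
  rw [e]
  refine upper_mul_bruhat (weylS_conj_upperAvoid i u ht) ?_
  obtain ⟨n, hn⟩ := exists_mem_weylGroup hw
  obtain ⟨σ, d, hσ, -⟩ := exists_isMono hn
  have hmem := weylS_mem_top i (i + 1) (by omega) u
  -- If `σ⁻¹` preserves the order of `i` and `i + 1`, then `x_{i,i+1}(a)` can be moved to the right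
  -- of `w` and remains upper triangular.
  by_cases hlt : σ.symm i < σ.symm (i + 1)
  · obtain ⟨b', hb'⟩ := hσ.inv_conj i (i + 1) (by omega) a
    rw [hb']
    exact ⟨1, one_mem _, _, mul_mem hmem hw, _,
      xS_mem_gensGroup hlt (σ.symm.injective.ne (by omega)) b', by rw [one_mul, mul_assoc]⟩
  · by_cases ha : a = 0
    · subst ha
      rw [xS_zero, one_mul]
      exact ⟨1, one_mem _, _, mul_mem hmem hw, 1, one_mem _, by group⟩
    · have hlt' : σ.symm (i + 1) < σ.symm i := by
        have : σ.symm i ≠ σ.symm (i + 1) := σ.symm.injective.ne (by omega)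
        omega
      obtain ⟨b', hb'⟩ := hσ.inv_conj (i + 1) i (by omega) a⁻¹
      have hm := (isMono_weylS (K := K) i (i + 1) (by omega) u).mul
        (isMono_weylS (K := K) i (i + 1) (by omega) (Units.mk0 a ha))
      rw [Equiv.swap_mul_self] at hm
      have hx := hm.conj i (i + 1) (by omega) (-a)
      rw [mul_inv_eq_iff_eq_mul] at hx
      -- In the opposite case it is the lower factor `x_{i+1,i}(a⁻¹)` that becomes upper triangular
      -- on the right of `w`. The product of the two Weyl elements with indices `i`, `i + 1` is
      -- diagonal, so `x_{i,i+1}(-a)` can be moved to its left.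
      have e2 : xS i (i + 1) (by omega) a = weylS i (i + 1) (by omega) (Units.mk0 a ha) *
          xS i (i + 1) (by omega) (-a) * xS (i + 1) i (by omega) a⁻¹ := by
        rw [weylS, Units.val_mk0, xS_neg, xS_neg]
        group
      rw [e2, mul_assoc _ _ w, hb', ← mul_assoc, ← mul_assoc,
        ← mul_assoc (weylS i (i + 1) (by omega) u), hx]
      refine bruhat_mul_upper (xS_mem_gensGroup hlt' _ b') ?_
      rw [mul_assoc]
      exact upper_mul_bruhat (xS_mem_gensGroup (Nat.lt_succ_self i) _ _)
        ⟨1, one_mem _, _, mul_mem (mul_mem hmem (weylS_mem_top _ _ _ _)) hw, 1, one_mem _,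
          by rw [one_mul, mul_one]⟩

/-- The union of cells is stable under left multiplication by all generators. Upper ones are clear,
`x_{j+1,j}` is conjugate by a simple Weyl element to an upper one, and the other lower ones are
iterated commutators of these, by induction on `i - j`. -/
theorem bruhatCells_eq (s : St K) : s ∈ bruhatCells K := by
  have hP : ∀ i j (h : i ≠ j) (a : K), ∀ s ∈ bruhatCells K, xS i j h a * s ∈ bruhatCells K := by
    have hlow : ∀ m i j (h : i ≠ j) (a : K), i = j + m + 1 → ∀ s ∈ bruhatCells K,
        xS i j h a * s ∈ bruhatCells K := by
      intro m
      induction m with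
      | zero =>
        rintro _ j h a rfl s hs
        have e : xS (j + 1) j h a = weylS j (j + 1) h.symm 1 * xS j (j + 1) h.symm (-a) *
            weylS j (j + 1) h.symm (-1) := by
          have := (isMono_weylS (K := K) j (j + 1) h.symm 1).conj j (j + 1) h.symm (-a)
          rw [weylS_inv] at this
          rw [this]
          simp
        change xS (j + 1) j h a * s ∈ _
        rw [e, mul_assoc, mul_assoc]
        exact weylS_mul_bruhat j 1 (upper_mul_bruhat (xS_mem_gensGroup (by omega) _ _)
          (weylS_mul_bruhat j _ hs))
      | succ m ih =>
        rintro _ j h a rfl s hs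
        have e := xS_commutator (j + (m + 1) + 1) (j + 1) j (by omega) (by omega) h a 1
        rw [mul_one] at e
        rw [← e, commutatorElement_def, ← xS_neg, ← xS_neg]
        simp only [mul_assoc]
        have h0 := fun (a : K) => ih (j + (m + 1) + 1) (j + 1) (by omega) a (by omega)
        have h1 : ∀ (a : K), ∀ s ∈ bruhatCells K, xS (j + 1) j (by omega) a * s ∈ bruhatCells K := by
          intro a s hs
          have e : xS (j + 1) j (by omega) a = weylS j (j + 1) (by omega) 1 *
              xS j (j + 1) (by omega) (-a) * weylS j (j + 1) (by omega) (-1) := by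
            have := (isMono_weylS (K := K) j (j + 1) (by omega) 1).conj j (j + 1) (by omega) (-a)
            rw [weylS_inv] at this
            rw [this]
            simp
          rw [e, mul_assoc, mul_assoc]
          exact weylS_mul_bruhat j 1 (upper_mul_bruhat (xS_mem_gensGroup (by omega) _ _)
            (weylS_mul_bruhat j _ hs))
        exact h0 _ _ (h1 _ _ (h0 _ _ (h1 _ _ hs)))
    intro i j h a s hs
    by_cases hij : i < j
    · exact upper_mul_bruhat (xS_mem_gensGroup hij h a) hs
    · exact hlow (i - j - 1) i j h a (by omega) s hs
  have hs : s ∈ gensGroup (K := K) (fun _ _ => True) := by rw [gensGroup_true]; trivial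
  exact gensGroup_induction (Q := fun s => s ∈ bruhatCells K)
    ⟨1, one_mem _, 1, one_mem _, 1, one_mem _, by group⟩ (fun i j h a s _ hs => hP i j h a s hs) hs

/-- `K_2` of a field is generated by the Steinberg symbols `{u, v}`. -/
theorem K2_eq_symGroupS : K2 K = symGroupS K := by
  refine le_antisymm (fun z hz => ?_) symGroupS_le_K2
  obtain ⟨a, ha, w, hw, b, hb, rfl⟩ := bruhatCells_eq z
  have hc := Subgroup.mem_center_iff.1 (K2_le_center hz) b
  -- Conjugating the central element by `b` collects the two unipotent factors on the left.
  have e : a * w * b = b * a * w := by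
    rw [← mul_inv_eq_iff_eq_mul] at hc
    rw [← hc]
    group
  rw [e] at hz ⊢
  obtain ⟨n, hn⟩ := exists_mem_weylGroup hw
  obtain ⟨σ, d, hσ, -⟩ := exists_isMono hn
  have hba := mul_mem hb ha
  have hw' : toGLinf K w = toGLinf K (b * a)⁻¹ := by
    rw [map_inv]
    refine eq_inv_of_mul_eq_one_right ?_
    rw [← map_mul]
    exact mem_K2.1 hz
  -- The image of `w` is monomial and at the same time the inverse of a unitriangular matrix: its
  -- diagonal entries are `1`, which leaves only the identity.
  have hwK : w ∈ K2 K := by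
    refine mem_K2_of_act fun k => ?_
    have h1 := act_upper (inv_mem hba) k
    have h2 : act w k = act (b * a)⁻¹ k := by rw [act, act, hw']
    rw [← h2, hσ k] at h1
    have h3 := h1.1
    rw [Finsupp.single_apply] at h3
    split_ifs at h3 with hk
    · rw [hσ k, hk, h3]
    · exact absurd h3 zero_ne_one
  have hbaK : b * a ∈ K2 K := (Subgroup.mul_mem_cancel_right _ hwK).1 hz
  rw [upper_eq_one hba hbaK, one_mul]
  exact weylGroup_inf_K2 hn hwK

/-! ### The action of `K^*` on `K_2` -/

theorem stEnd_xS (u : Kˣ) (i j : ℕ) (h : i ≠ j) (a : K) :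
    stEnd u (xS i j h a) = xS i j h ((dg u i : K) * a * ((dg u j)⁻¹ : Kˣ)) := stEnd_of u _

/-- If `z` involves only indices below `n`, choose `N > n`. On `z` the action of `u` agrees with
conjugation by `h_{0N}(u)`, whose extra entry `u⁻¹` in place `N` is not seen, and `z` is central. -/
theorem stEnd_of_mem_K2 (u : Kˣ) {z : St K} (hz : z ∈ K2 K) : stEnd u z = z := by
  obtain ⟨n, hn⟩ := exists_bound z
  set N := n + 1 with hN
  have hm := isMono_h (K := K) 0 N (by omega) u
  have key : stEnd u z = (rankOneS 0 N (by omega)).h (u : K) * z * ((rankOneS 0 N (by omega)).h (u : K))⁻¹ := by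
    refine gensGroup_induction (Q := fun z => stEnd u z = (rankOneS 0 N (by omega)).h (u : K) * z *
      ((rankOneS 0 N (by omega)).h (u : K))⁻¹) (by simp) ?_ hn
    rintro i j h a s ⟨hi, hj⟩ hs
    have e := hm.conj i j h a
    rw [map_mul, hs, stEnd_xS]
    have e1 : ∀ i, i < n → (if i = 0 then u else if i = N then u⁻¹ else 1) = dg u i := by
      intro i hi
      rw [dg, if_neg (show i ≠ N by omega)]
    simp only [e1 i hi, e1 j hj, Equiv.Perm.coe_one, id_eq] at e
    rw [← e]
    group
  rw [key, Subgroup.mem_center_iff.1 (K2_le_center hz), mul_inv_cancel_right]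

end

section

/-! ### Second cohomology classes and cocycles -/

section Cohomology

variable {G H A : Type u} [Group G] [Group H] [AddCommGroup A]

theorem mem_cocycles_iff (f : G × G → A) :
    f ∈ groupCohomology.cocycles₂ (trivRep G A) ↔
      ∀ g h j : G, f (g * h, j) + f (g, h) = f (h, j) + f (g, h * j) :=
  groupCohomology.mem_cocycles₂_iff (A := trivRep G A) f

/-- The cohomology class of a 2-cocycle. -/
def classOf (f : G × G → A)
    (hf : ∀ g h j : G, f (g * h, j) + f (g, h) = f (h, j) + f (g, h * j)) : H2 G A :=
  groupCohomology.H2π (trivRep G A) ⟨f, (mem_cocycles_iff f).2 hf⟩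

theorem exists_classOf (c : H2 G A) : ∃ f hf, c = classOf (G := G) (A := A) f hf := by
  refine groupCohomology.H2_induction_on c fun x => ?_
  exact ⟨x.1, (mem_cocycles_iff x.1).1 x.2, rfl⟩

theorem classOf_eq_zero_iff (f : G × G → A) (hf) :
    classOf f hf = 0 ↔ ∃ b : G → A, ∀ g h, f (g, h) = b h - b (g * h) + b g := by
  rw [classOf, groupCohomology.H2π_eq_zero_iff]
  constructor
  · rintro ⟨b, hb⟩
    exact ⟨b, fun g h => (congrFun hb (g, h)).symm⟩
  · rintro ⟨b, hb⟩
    exact ⟨b, funext fun p => (hb p.1 p.2).symm⟩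

theorem classOf_add (f f' : G × G → A) (hf hf') :
    classOf f hf + classOf f' hf' = classOf (fun p => f p + f' p)
      (fun g h j => by rw [add_add_add_comm, hf, hf', add_add_add_comm]) := by
  rw [classOf, classOf, ← map_add]
  rfl

theorem classOf_sub (f f' : G × G → A) (hf hf') :
    classOf f hf - classOf f' hf' = classOf (fun p => f p - f' p)
      (fun g h j => by rw [sub_add_sub_comm, hf, hf', sub_add_sub_comm]) := by
  rw [classOf, classOf, ← map_sub]
  rfl

theorem classOf_eq_iff (f f' : G × G → A) (hf hf') :
    classOf f hf = classOf f' hf' ↔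
      ∃ b : G → A, ∀ g h, f (g, h) = f' (g, h) + (b h - b (g * h) + b g) := by
  rw [← sub_eq_zero, classOf_sub, classOf_eq_zero_iff]
  simp only [sub_eq_iff_eq_add']

theorem H2map_classOf (p : G →* H) (f : H × H → A) (hf) :
    H2map A p (classOf f hf) = classOf (fun x => f (p x.1, p x.2))
      (fun g h j => by simp only [map_mul, hf]) := by
  have := groupCohomology.H2π_comp_map (A := trivRep H A) (B := trivRep G A) p (𝟙 (trivRep G A))
  have h2 := congrArg (fun F => F.hom ⟨f, (mem_cocycles_iff f).2 hf⟩) this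
  exact h2

theorem H2map_comp_of_eq_id (p : G →* H) (q : H →* G) (h : ∀ g, q (p g) = g) (c : H2 G A) :
    H2map A p (H2map A q c) = c := by
  obtain ⟨f, hf, rfl⟩ := exists_classOf c
  rw [H2map_classOf, H2map_classOf]
  simp only [h]

end Cohomology


/-! ### Central extensions -/

section CentralExtension

variable {N E G A : Type u} [Group N] [Group E] [Group G] [AddCommGroup A]
  {S : GroupExtension N E G}

theorem inl_factorSet (s : S.Section) (g h : G) :
    S.inl (factorSet s (g, h)) = s g * s h * (s (g * h))⁻¹ := by
  have := (MonoidHom.ofInjective S.inl_injective).apply_symm_apply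
    ⟨s g * s h * (s (g * h))⁻¹, by
      rw [S.range_inl_eq_ker_rightHom, MonoidHom.mem_ker]
      simp⟩
  exact congrArg Subtype.val this

theorem mul_section (s : S.Section) (g h : G) :
    s g * s h = S.inl (factorSet s (g, h)) * s (g * h) := by
  rw [inl_factorSet, inv_mul_cancel_right]

theorem inl_comm (hS : S.inl.range ≤ Subgroup.center E) (n : N) (e : E) :
    e * S.inl n = S.inl n * e :=
  Subgroup.mem_center_iff.1 (hS ⟨n, rfl⟩) e

theorem factorSet_mul (hS : S.inl.range ≤ Subgroup.center E) (s : S.Section) (g h j : G) :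
    factorSet s (g * h, j) * factorSet s (g, h) = factorSet s (h, j) * factorSet s (g, h * j) := by
  apply S.inl_injective
  have e : s g * s h * s j = s g * (s h * s j) := mul_assoc _ _ _
  rw [mul_section, mul_section s h, mul_assoc, mul_section, ← mul_assoc, ← mul_assoc,
    inl_comm hS _ (s g), mul_assoc (S.inl (factorSet s (h, j))), mul_section, ← mul_assoc, mul_assoc g] at e
  rw [map_mul, map_mul, inl_comm hS, mul_right_cancel e]

/-- The class of the push-forward of a central extension along `φ`. -/
def pushClass (hS : S.inl.range ≤ Subgroup.center E) (s : S.Section) (φ : Additive N →+ A) :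
    H2 G A :=
  classOf (fun p => φ (Additive.ofMul (factorSet s p))) fun g h j => by
    rw [← map_add φ, ← map_add φ, ← ofMul_mul, ← ofMul_mul, factorSet_mul hS]

/-- The element `n` of the kernel with `e = n · s(π(e))`. -/
def kernelPart (s : S.Section) (e : E) : N :=
  (MonoidHom.ofInjective S.inl_injective).symm
    ⟨e * (s (S.rightHom e))⁻¹, by
      rw [S.range_inl_eq_ker_rightHom, MonoidHom.mem_ker]
      simp⟩

theorem inl_kernelPart (s : S.Section) (e : E) :
    S.inl (kernelPart s e) = e * (s (S.rightHom e))⁻¹ := by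
  have := (MonoidHom.ofInjective S.inl_injective).apply_symm_apply
    ⟨e * (s (S.rightHom e))⁻¹, by
      rw [S.range_inl_eq_ker_rightHom, MonoidHom.mem_ker]
      simp⟩
  exact congrArg Subtype.val this

theorem inl_kernelPart_mul (s : S.Section) (e : E) :
    S.inl (kernelPart s e) * s (S.rightHom e) = e := by
  rw [inl_kernelPart, inv_mul_cancel_right]

/-- Inflated to `E`, the factor set becomes the coboundary of `kernelPart`, up to sign. Hence a
push-forward class dies on every group that lifts to `E`, and sections can be compared. -/
theorem kernelPart_mul (hS : S.inl.range ≤ Subgroup.center E) (s : S.Section) (e e' : E) :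
    kernelPart s (e * e') =
      kernelPart s e * kernelPart s e' * factorSet s (S.rightHom e, S.rightHom e') := by
  apply S.inl_injective
  apply mul_right_cancel (b := s (S.rightHom (e * e')))
  rw [inl_kernelPart_mul, map_mul S.rightHom, map_mul, mul_assoc, ← mul_section, map_mul, mul_assoc,
    ← mul_assoc (S.inl (kernelPart s e')), ← inl_comm hS _ (s _), mul_assoc, inl_kernelPart_mul,
    ← mul_assoc, inl_kernelPart_mul]

theorem kernelPart_inl (s : S.Section) (n : N) (e : E) :
    kernelPart s (S.inl n * e) = n * kernelPart s e := by
  apply S.inl_injective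
  rw [map_mul, inl_kernelPart, inl_kernelPart, map_mul, S.rightHom_inl, one_mul, mul_assoc]

theorem pushClass_eq (hS : S.inl.range ≤ Subgroup.center E) (s s' : S.Section)
    (φ : Additive N →+ A) : pushClass hS s φ = pushClass hS s' φ := by
  refine (classOf_eq_iff _ _ _ _).2 ⟨fun g => φ (Additive.ofMul (kernelPart s' (s g))), ?_⟩
  intro g h
  have h1 := kernelPart_mul hS s' (s g) (s h)
  rw [mul_section, kernelPart_inl, GroupExtension.Section.rightHom_section,
    GroupExtension.Section.rightHom_section] at h1
  have h2 := congrArg (fun n => φ (Additive.ofMul n)) h1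
  simp only [ofMul_mul, map_add] at h2
  rw [eq_sub_of_add_eq h2]
  abel

theorem isPushforwardClass (hS : S.inl.range ≤ Subgroup.center E) (s : S.Section)
    (φ : Additive N →+ A) : IsPushforwardClass S φ (pushClass hS s φ) := by
  intro s'
  rw [pushClass_eq hS s s']
  exact ⟨_, rfl⟩

theorem pushClass_add (hS : S.inl.range ≤ Subgroup.center E) (s : S.Section)
    (φ ψ : Additive N →+ A) :
    pushClass hS s (φ + ψ) = pushClass hS s φ + pushClass hS s ψ := by
  rw [pushClass, pushClass, pushClass, classOf_add]
  rfl

/-- If the push-forward along `φ` is a split extension, `φ` extends to a homomorphism on the whole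
group. -/
theorem exists_extend_of_pushClass_eq_zero (hS : S.inl.range ≤ Subgroup.center E) (s : S.Section)
    (φ : Additive N →+ A) (h : pushClass hS s φ = 0) :
    ∃ l : E →* Multiplicative A, ∀ n, l (S.inl n) = Multiplicative.ofAdd (φ (Additive.ofMul n)) := by
  obtain ⟨b, hb⟩ := (classOf_eq_zero_iff _ _).1 h
  have hm : ∀ e e' : E, φ (Additive.ofMul (kernelPart s (e * e'))) + b (S.rightHom (e * e')) =
      (φ (Additive.ofMul (kernelPart s e)) + b (S.rightHom e)) +
        (φ (Additive.ofMul (kernelPart s e')) + b (S.rightHom e')) := by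
    intro e e'
    rw [kernelPart_mul hS, ofMul_mul, ofMul_mul, map_add, map_add, hb, map_mul]
    abel
  let l : E →* Multiplicative A := MonoidHom.mk'
    (fun e => Multiplicative.ofAdd (φ (Additive.ofMul (kernelPart s e)) + b (S.rightHom e)))
    (fun e e' => by rw [hm, ofAdd_add])
  refine ⟨l, fun n => ?_⟩
  have h1 : l 1 = 1 := map_one l
  have h2 : φ (Additive.ofMul (kernelPart s 1)) + b (S.rightHom 1) = 0 := h1
  have h3 := kernelPart_inl s n 1
  rw [mul_one] at h3
  change Multiplicative.ofAdd (φ (Additive.ofMul (kernelPart s (S.inl n))) +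
    b (S.rightHom (S.inl n))) = _
  rw [h3, ofMul_mul, map_add φ, S.rightHom_inl, add_assoc, ← map_one S.rightHom, h2, add_zero]

end CentralExtension

/-! ### The extension of `GL_2(K)` -/

variable {K : Type u} [Field K]

theorem K2toTilde_central (c : K2 K) (x : GL2hat K) :
    x * SemidirectProduct.inl (K2toTilde K c) = SemidirectProduct.inl (K2toTilde K c) * x := by
  refine SemidirectProduct.ext ?_ ?_
  · simp only [SemidirectProduct.mul_left, SemidirectProduct.left_inl, SemidirectProduct.right_inl,
      map_one, MulAut.one_apply]
    have h1 : autOfEnd (tildeAct (K := K)) x.right (K2toTilde K c) = K2toTilde K c := by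
      apply Subtype.ext
      refine Prod.ext (stEnd_of_mem_K2 x.right c.2) (map_one (slAct x.right))
    rw [h1]
    apply Subtype.ext
    refine Prod.ext (Subgroup.mem_center_iff.1 (K2_le_center c.2) x.left.1.1) ?_
    change x.left.1.2 * 1 = 1 * x.left.1.2
    rw [mul_one, one_mul]
  · simp

theorem steinbergExt_central : (steinbergExt K).inl.range ≤ Subgroup.center (GL2hat K) := by
  rintro _ ⟨c, rfl⟩
  exact Subgroup.mem_center_iff.2 fun x => K2toTilde_central c x

theorem rightHom_comp_inr :
    (steinbergExt K).rightHom.comp SemidirectProduct.inr = diag2 K := by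
  ext1 u
  change toGL2 K (SemidirectProduct.inr u) = _
  rw [toGL2_apply, SemidirectProduct.left_inr, SemidirectProduct.right_inr]
  change SpecialLinearGroup.toGL 1 * diag2 K u = diag2 K u
  rw [map_one, one_mul]

end

/-! ### The rank one pair in the extension of `GL_2(K)`, injectivity, and the reduction to
surjectivity. -/

section

variable {K : Type u} [Field K]

theorem blockGL_injective (n : ℕ) : Function.Injective (blockGL K n) := by
  intro g h e
  apply Units.ext
  have e1 : blockEnd K n g = blockEnd K n h := congrArg Units.val e
  have e2 : ∀ A : Matrix (Fin n) (Fin n) K, (proj K n).comp ((blockEnd K n A).comp (incl K n)) =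
      Matrix.toLin' A := by
    intro A
    have h : ∀ w, proj K n (incl K n w) = w := fun w =>
      LinearMap.congr_fun (proj_comp_incl (K := K) n) w
    apply LinearMap.ext
    intro v
    change proj K n (incl K n v + incl K n (Matrix.toLin' A (proj K n (incl K n v)) -
      proj K n (incl K n v))) = _
    rw [map_add, h, h, add_sub_cancel]
  apply Matrix.toLin'.injective
  rw [← e2, ← e2, e1]

/-- An elementary matrix as an element of `SL_2`. -/
def elemSL (i j : Fin 2) (h : i ≠ j) (a : K) : SpecialLinearGroup (Fin 2) K :=
  ⟨Matrix.transvection i j a, Matrix.det_transvection_of_ne i j h a⟩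

theorem toGL_elemSL (i j : Fin 2) (h : i ≠ j) (a : K) :
    SpecialLinearGroup.toGL (elemSL i j h a) = elemGL i j h a := Units.ext rfl

/-- The elementary generator `x_{ij}(a)` of the pullback of `St(K)` to `SL_2(K)`. -/
def xTilde (i j : Fin 2) (h : i ≠ j) (a : K) : SL2tilde K :=
  ⟨(xS i j (fun e => h (Fin.ext e)) a, elemSL i j h a), by
    refine mem_SL2tilde.2 ?_
    rw [toGLinf_xS]
    exact (blockGL_transvection i j h a _ rfl).symm⟩

/-- Since `SL_2(K)` embeds into `SL(K)`, the pullback is a subgroup of `St(K)`, and identities in it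
can be checked there. -/
theorem SL2tilde_ext {x y : SL2tilde K} (h : x.1.1 = y.1.1) : x = y := by
  apply Subtype.ext
  refine Prod.ext h ?_
  apply SpecialLinearGroup.toGL_injective
  apply blockGL_injective 2
  rw [← mem_SL2tilde.1 x.2, ← mem_SL2tilde.1 y.2, h]

/-- The rank one pair in the pullback of `St(K)` to `SL_2(K)`. -/
def rankOneTilde : RankOne K (SL2tilde K) where
  x := xTilde 0 1 zero_ne_one
  y := xTilde 1 0 one_ne_zero
  x_add a b := SL2tilde_ext (xS_add _ _ _ a b)
  y_add a b := SL2tilde_ext (xS_add _ _ _ a b)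
  weyl u hu a := SL2tilde_ext ((rankOneS 0 1 zero_ne_one).weyl u hu a)

theorem rankOneTilde_sym (u v : K) :
    (rankOneTilde.sym u v).1.1 = (rankOneS 0 1 zero_ne_one).sym u v :=
  ((rankOneTilde (K := K)).map_sym
    ((MonoidHom.fst _ _).comp (SL2tilde K).subtype) u v).symm

theorem rankOneTilde_sym_eq (u v : Kˣ) :
    (rankOneTilde (K := K)).sym u v = K2toTilde K ⟨_, symS_mem_K2 0 1 zero_ne_one u v⟩ :=
  SL2tilde_ext (rankOneTilde_sym (u : K) v)

variable (K) in
/-- The rank one pair with its torus in the extension of `GL_2(K)`. -/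
def rankOneHat : SplitRankOne K (GL2hat K) where
  toRankOne := rankOneTilde.map SemidirectProduct.inl
  t := SemidirectProduct.inr
  t_x u a := by
    change SemidirectProduct.inr u * SemidirectProduct.inl _ * (SemidirectProduct.inr u)⁻¹ = _
    rw [← map_inv, ← SemidirectProduct.inl_aut]
    change _ = SemidirectProduct.inl (xTilde 0 1 zero_ne_one (u * a))
    congr 1
    apply SL2tilde_ext
    refine (stEnd_xS u 0 1 _ a).trans ?_
    change xS 0 1 _ _ = xS 0 1 _ _
    congr 1
    simp [dg]
  t_y u a := by
    change SemidirectProduct.inr u * SemidirectProduct.inl _ * (SemidirectProduct.inr u)⁻¹ = _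
    rw [← map_inv, ← SemidirectProduct.inl_aut]
    change _ = SemidirectProduct.inl (xTilde 1 0 one_ne_zero (a / u))
    congr 1
    apply SL2tilde_ext
    refine (stEnd_xS u 1 0 _ a).trans ?_
    change xS 1 0 _ _ = xS 1 0 _ _
    congr 1
    simp [dg, div_eq_mul_inv]
  sym_central u v := by
    rw [RankOne.map_sym, rankOneTilde_sym_eq]
    exact steinbergExt_central ⟨_, rfl⟩

theorem rankOneHat_sym (u v : Kˣ) :
    (rankOneHat K).sym u v =
      (steinbergExt K).inl ⟨_, symS_mem_K2 0 1 zero_ne_one u v⟩ := by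
  change ((rankOneTilde (K := K)).map _).sym _ _ = _
  rw [RankOne.map_sym, rankOneTilde_sym_eq]
  rfl

theorem toGL2_rankOneHat_x (a : K) : toGL2 K ((rankOneHat K).x a) = elemGL 0 1 zero_ne_one a := by
  rw [toGL2_apply]
  change SpecialLinearGroup.toGL (elemSL 0 1 zero_ne_one a) * diag2 K 1 = _
  rw [map_one, mul_one, toGL_elemSL]

theorem toGL2_rankOneHat_y (a : K) : toGL2 K ((rankOneHat K).y a) = elemGL 1 0 one_ne_zero a := by
  rw [toGL2_apply]
  change SpecialLinearGroup.toGL (elemSL 1 0 one_ne_zero a) * diag2 K 1 = _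
  rw [map_one, mul_one, toGL_elemSL]

theorem toGL2_rankOneHat_t (u : Kˣ) : toGL2 K ((rankOneHat K).t u) = diag2 K u :=
  DFunLike.congr_fun rightHom_comp_inr u

/-- Homomorphisms out of `K_2(K)` are determined by their values on Steinberg symbols. -/
theorem K2_hom_ext {M : Type*} [Group M] {f g : K2 K →* M}
    (h : ∀ u v : Kˣ, f ⟨_, symS_mem_K2 0 1 zero_ne_one u v⟩ =
      g ⟨_, symS_mem_K2 0 1 zero_ne_one u v⟩) : f = g := by
  ext1 ⟨z, hz⟩
  have hz' := hz
  rw [K2_eq_symGroupS] at hz'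
  refine Subgroup.closure_induction (p := fun z hz => ∀ hz' : z ∈ K2 K, f ⟨z, hz'⟩ = g ⟨z, hz'⟩)
    ?_ ?_ ?_ ?_ hz' hz
  · rintro _ ⟨u, v, rfl⟩ _
    exact h u v
  · intro h1
    rw [show (⟨1, h1⟩ : K2 K) = 1 from rfl, map_one, map_one]
  · intro a b ha hb hfa hfb _
    have ha' : a ∈ K2 K := symGroupS_le_K2 ha
    have hb' : b ∈ K2 K := symGroupS_le_K2 hb
    rw [show (⟨a * b, _⟩ : K2 K) = ⟨a, ha'⟩ * ⟨b, hb'⟩ from rfl, map_mul, map_mul, hfa, hfb]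
  · intro a ha hfa _
    have ha' : a ∈ K2 K := symGroupS_le_K2 ha
    rw [show (⟨a⁻¹, _⟩ : K2 K) = ⟨a, ha'⟩⁻¹ from rfl, map_inv, map_inv, hfa]

theorem exists_unit_ne_one (K : Type u) [Field K] [Infinite K] : ∃ u : Kˣ, (u : K) - 1 ≠ 0 := by
  classical
  obtain ⟨a, ha⟩ := Infinite.exists_notMem_finset ({0, 1} : Finset K)
  simp only [Finset.mem_insert, Finset.mem_singleton, not_or] at ha
  exact ⟨Units.mk0 a ha.1, sub_ne_zero.2 ha.2⟩

/-- A homomorphism from the extension of `GL_2(K)` to an abelian group is trivial on `K_2(K)`. -/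
theorem hom_inl_eq_one [Infinite K] {M : Type*} [CommGroup M] (l : GL2hat K →* M) (c : K2 K) :
    l ((steinbergExt K).inl c) = 1 := by
  obtain ⟨u, hu⟩ := exists_unit_ne_one K
  -- In an abelian group, conjugation by the torus element of `u` is invisible, so `x(ub)` and
  -- `x(b)` have the same image. With `b = a/(u - 1)` this kills `x(a)`; similarly for `y(a)` below.
  have hx : ∀ a, l ((rankOneHat K).x a) = 1 := by
    intro a
    have h1 := congrArg l ((rankOneHat K).t_x u (a / (u - 1)))
    rw [map_mul, map_mul, map_inv, mul_comm (l _) (l _), mul_inv_cancel_right,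
      show (u : K) * (a / (u - 1)) = a / (u - 1) + a by field_simp; ring, RankOne.x_add, map_mul] at h1
    exact (mul_eq_left.1 h1.symm)
  have hy : ∀ a, l ((rankOneHat K).y a) = 1 := by
    intro a
    have h1 := congrArg l ((rankOneHat K).t_y u (-a * (u / (u - 1))))
    rw [map_mul, map_mul, map_inv, mul_comm (l _) (l _), mul_inv_cancel_right,
      show (-a * (u / (u - 1))) / (u : K) = -a * (u / (u - 1)) + a by field_simp; ring,
      RankOne.y_add, map_mul] at h1
    exact (mul_eq_left.1 h1.symm)
  have e : l.comp (steinbergExt K).inl = 1 := by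
    apply K2_hom_ext
    intro u v
    rw [MonoidHom.comp_apply, ← rankOneHat_sym, RankOne.sym, RankOne.h, RankOne.h, RankOne.h,
      RankOne.w, RankOne.w, RankOne.w, RankOne.w]
    simp only [map_mul, map_inv, hx, hy, mul_one, inv_one, MonoidHom.one_apply]
  exact DFunLike.congr_fun e c

/-- A section of the projection to `GL_2(K)`. -/
def hatSection (K : Type u) [Field K] : (steinbergExt K).Section := (steinbergExt K).surjInvRightHom

/-- The map `Hom(K_2(K), A) → H²(GL_2(K), A)` given by push-forward. -/
def pushHom (K A : Type u) [Field K] [AddCommGroup A] :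
    (Additive (K2 K) →+ A) →+ H2 (GL (Fin 2) K) A :=
  AddMonoidHom.mk' (pushClass steinbergExt_central (hatSection K))
    (pushClass_add steinbergExt_central (hatSection K))

variable {A : Type u} [AddCommGroup A]

/-- A splitting of the push-forward extends `φ` to the whole extension, and homomorphisms from there
to abelian groups vanish on `K_2(K)`. -/
theorem pushHom_injective [Infinite K] : Function.Injective (pushHom K A) := by
  rw [injective_iff_map_eq_zero]
  intro φ h
  obtain ⟨l, hl⟩ := exists_extend_of_pushClass_eq_zero steinbergExt_central _ φ h
  ext c
  have h1 := hl (Additive.toMul c)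
  rw [hom_inl_eq_one] at h1
  exact h1.symm

/-- The torus lifts through the second factor of the semidirect product, so the extension splits
over it; the kernel part of this lift provides the cobounding function. -/
theorem H2map_diag2_pushHom (φ : Additive (K2 K) →+ A) :
    H2map A (diag2 K) (pushHom K A φ) = 0 := by
  change H2map A (diag2 K) (pushClass steinbergExt_central (hatSection K) φ) = 0
  rw [pushClass, H2map_classOf, classOf_eq_zero_iff]
  refine ⟨fun u => -φ (Additive.ofMul (kernelPart (hatSection K) (SemidirectProduct.inr u))), ?_⟩
  intro u v
  have h1 := kernelPart_mul steinbergExt_central (hatSection K) (SemidirectProduct.inr u)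
    (SemidirectProduct.inr v)
  have h2 : ∀ u, (steinbergExt K).rightHom (SemidirectProduct.inr u) = diag2 K u :=
    DFunLike.congr_fun rightHom_comp_inr
  rw [h2, h2, ← map_mul] at h1
  have h3 := congrArg (fun n => φ (Additive.ofMul n)) h1
  simp only [ofMul_mul, map_add] at h3
  beta_reduce
  rw [h3]
  abel

theorem H2map_diag2_det (c : H2 Kˣ A) :
    H2map A (diag2 K) (H2map A (GeneralLinearGroup.det (n := Fin 2) (R := K)) c) = c :=
  H2map_comp_of_eq_id _ _ det_diag2 c

/-- The isomorphism of the theorem, given that every class trivial on the torus is a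
push-forward. -/
theorem exists_equiv_of_surjective [Infinite K]
    (hsurj : ∀ c : H2 (GL (Fin 2) K) A, H2map A (diag2 K) c = 0 → ∃ φ, pushHom K A φ = c) :
    ∃ e : (H2 Kˣ A × (Additive (K2 K) →+ A)) ≃+ H2 (GL (Fin 2) K) A,
      (∀ c : H2 Kˣ A, e (c, 0) = H2map A (GeneralLinearGroup.det (n := Fin 2) (R := K)) c) ∧
      (∀ φ, IsPushforwardClass (steinbergExt K) φ (e (0, φ))) := by
  let F : (H2 Kˣ A × (Additive (K2 K) →+ A)) →+ H2 (GL (Fin 2) K) A :=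
    AddMonoidHom.coprod (H2map A (GeneralLinearGroup.det (n := Fin 2) (R := K))) (pushHom K A)
  have hF : ∀ c φ, F (c, φ) =
      H2map A (GeneralLinearGroup.det (n := Fin 2) (R := K)) c + pushHom K A φ := fun _ _ => rfl
  -- Restriction to the torus recovers the first component and annihilates push-forwards. It
  -- therefore separates the two summands, and it reduces surjectivity to classes that are trivial
  -- on the torus.
  have hbij : Function.Bijective F := by
    constructor
    · rw [injective_iff_map_eq_zero]
      rintro ⟨c, φ⟩ h
      rw [hF] at h
      have h1 := congrArg (H2map A (diag2 K)) h
      rw [map_add, H2map_diag2_det, H2map_diag2_pushHom, add_zero, map_zero] at h1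
      subst h1
      rw [map_zero, zero_add] at h
      rw [(injective_iff_map_eq_zero _).1 pushHom_injective φ h]
      rfl
    · intro c
      obtain ⟨φ, hφ⟩ := hsurj (c - H2map A (GeneralLinearGroup.det (n := Fin 2) (R := K))
        (H2map A (diag2 K) c)) (by rw [map_sub, H2map_diag2_det, sub_self])
      exact ⟨(H2map A (diag2 K) c, φ), by rw [hF, hφ, add_sub_cancel]⟩
  refine ⟨AddEquiv.ofBijective F hbij, fun c => ?_, fun φ => ?_⟩
  · change F (c, 0) = _
    rw [hF, map_zero, add_zero]
  · change IsPushforwardClass _ _ (F (0, φ))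
    rw [hF, map_zero, zero_add]
    exact isPushforwardClass steinbergExt_central _ φ

end

section

/-! ### Elementary and diagonal matrices -/

section Matrices

variable {K : Type u} [Field K] {n : ℕ}

/-- Transports the relations of the Steinberg group to elementary matrices in `GL_n(K)`, because
`blockGL` is injective. -/
theorem blockGL_elemGL (i j : Fin n) (h : i ≠ j) (a : K) :
    blockGL K n (elemGL i j h a) = toGLinf K (xS i j (fun e => h (Fin.ext e)) a) := by
  rw [toGLinf_xS]
  exact blockGL_transvection i j h a _ rfl

theorem elemGL_add (i j : Fin n) (h : i ≠ j) (a b : K) :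
    elemGL i j h (a + b) = elemGL i j h a * elemGL i j h b := by
  apply blockGL_injective
  rw [map_mul, blockGL_elemGL, blockGL_elemGL, blockGL_elemGL, xS_add, map_mul]

theorem elemGL_zero (i j : Fin n) (h : i ≠ j) : elemGL i j h (0 : K) = 1 := by
  apply blockGL_injective
  rw [blockGL_elemGL, xS_zero, map_one, map_one]

theorem elemGL_neg (i j : Fin n) (h : i ≠ j) (a : K) :
    elemGL i j h (-a) = (elemGL i j h a)⁻¹ := by
  rw [eq_inv_iff_mul_eq_one, ← elemGL_add, neg_add_cancel, elemGL_zero]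

theorem elemGL_injective (i j : Fin n) (h : i ≠ j) {a b : K}
    (e : elemGL i j h a = elemGL i j h b) : a = b := by
  have := congrArg (fun g : GL (Fin n) K => (g : Matrix (Fin n) (Fin n) K) i j) e
  simpa [elemGL_val, Matrix.transvection, h] using this

theorem elemGL_commutator (i j k : Fin n) (hij : i ≠ j) (hjk : j ≠ k) (hik : i ≠ k) (a b : K) :
    ⁅elemGL i j hij a, elemGL j k hjk b⁆ = elemGL i k hik (a * b) := by
  apply blockGL_injective
  rw [map_commutatorElement, blockGL_elemGL, blockGL_elemGL, blockGL_elemGL,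
    ← map_commutatorElement, xS_commutator]

theorem elemGL_commute (i j k l : Fin n) (hij : i ≠ j) (hkl : k ≠ l) (hjk : j ≠ k) (hil : i ≠ l)
    (a b : K) : elemGL i j hij a * elemGL k l hkl b = elemGL k l hkl b * elemGL i j hij a := by
  apply blockGL_injective
  rw [map_mul, map_mul, blockGL_elemGL, blockGL_elemGL, ← map_mul, ← map_mul,
    xS_commute _ _ _ _ _ _ (fun e => hjk (Fin.ext e)) (fun e => hil (Fin.ext e))]

theorem elemGL_weyl (i j : Fin n) (h : i ≠ j) {u : K} (hu : u ≠ 0) (a : K) :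
    elemGL i j h u * elemGL j i h.symm (-u⁻¹) * elemGL i j h u * elemGL i j h a =
      elemGL j i h.symm (-(a / u ^ 2)) *
        (elemGL i j h u * elemGL j i h.symm (-u⁻¹) * elemGL i j h u) := by
  apply blockGL_injective
  simp only [map_mul, blockGL_elemGL]
  simp only [← map_mul]
  congr 1
  exact (rankOneS (i : ℕ) j (fun e => h (Fin.ext e))).weyl u hu a

/-- The diagonal matrix with entries `d`. -/
def diagGL : (Fin n → Kˣ) →* GL (Fin n) K where
  toFun d := ⟨Matrix.diagonal fun i => (d i : K), Matrix.diagonal fun i => ((d i)⁻¹ : Kˣ),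
    by simp [Matrix.diagonal_mul_diagonal], by simp [Matrix.diagonal_mul_diagonal]⟩
  map_one' := by
    apply Units.ext
    simp
  map_mul' d e := by
    apply Units.ext
    simp [Matrix.diagonal_mul_diagonal]

theorem diagGL_val (d : Fin n → Kˣ) :
    (diagGL d : Matrix (Fin n) (Fin n) K) = Matrix.diagonal fun i => (d i : K) := rfl

theorem diagGL_mul_elemGL (d : Fin n → Kˣ) (i j : Fin n) (h : i ≠ j) (a : K) :
    diagGL d * elemGL i j h a = elemGL i j h (d i * a * ((d j)⁻¹ : Kˣ)) * diagGL d := by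
  apply Units.ext
  rw [Units.val_mul, Units.val_mul, elemGL_val, elemGL_val, diagGL_val, Matrix.transvection,
    Matrix.transvection, mul_add, add_mul, mul_one, one_mul]
  congr 1
  ext k l
  rw [Matrix.diagonal_mul, Matrix.mul_diagonal, Matrix.single_apply, Matrix.single_apply]
  split_ifs with hk
  · obtain ⟨rfl, rfl⟩ := hk
    rw [mul_assoc, Units.inv_mul, mul_one]
  · simp

theorem diagGL_conj_elemGL (d : Fin n → Kˣ) (i j : Fin n) (h : i ≠ j) (a : K) :
    diagGL d * elemGL i j h a * (diagGL d)⁻¹ = elemGL i j h (d i * a * ((d j)⁻¹ : Kˣ)) := by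
  rw [diagGL_mul_elemGL, mul_inv_cancel_right]

theorem incl_apply (v : Fin n → K) (m : ℕ) :
    incl K n v m = if h : m < n then v ⟨m, h⟩ else 0 := by
  simp only [incl, LinearMap.sum_apply, LinearMap.comp_apply, LinearMap.proj_apply,
    Finsupp.lsingle_apply, Finsupp.finsetSum_apply, Finsupp.single_apply]
  split_ifs with h
  · rw [Finset.sum_eq_single ⟨m, h⟩]
    · simp
    · intro b _ hb
      rw [if_neg]
      exact fun e => hb (Fin.ext e)
    · simp
  · refine Finset.sum_eq_zero fun b _ => if_neg ?_
    have := b.2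
    omega

/-- A diagonal matrix of size `n`, extended by ones. -/
def extendDiag (d : Fin n → Kˣ) (k : ℕ) : Kˣ := if h : k < n then d ⟨k, h⟩ else 1

theorem blockGL_diagGL_single (d : Fin n → Kˣ) (k : ℕ) (b : K) :
    (blockGL K n (diagGL d) : Module.End K (ℕ →₀ K)) (Finsupp.single k b) =
      Finsupp.single k ((extendDiag d k : K) * b) := by
  change Finsupp.single k b + incl K n (Matrix.toLin' (Matrix.diagonal fun i => (d i : K))
    (proj K n (Finsupp.single k b)) - proj K n (Finsupp.single k b)) = _
  ext m
  rw [Finsupp.add_apply, incl_apply, Finsupp.single_apply, Finsupp.single_apply]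
  split_ifs with h1 h2 h2
  · subst h1
    rw [extendDiag, dif_pos h2]
    simp [proj, Matrix.mulVec_diagonal]
  · subst h1
    rw [extendDiag, dif_neg h2]
    simp
  · simp [proj, Matrix.mulVec_diagonal, h1]
  · simp

theorem weyl_mul_diagGL (d : Fin n → Kˣ) (i j : Fin n) (h : i ≠ j) (u : Kˣ) :
    elemGL i j h (u : K) * elemGL j i h.symm (-(u : K)⁻¹) * elemGL i j h (u : K) * diagGL d =
      diagGL (d ∘ Equiv.swap i j) *
        (elemGL i j h (u : K) * elemGL j i h.symm (-(u : K)⁻¹) * elemGL i j h (u : K)) := by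
  have h' : (i : ℕ) ≠ j := fun e => h (Fin.ext e)
  apply blockGL_injective
  have e : blockGL K n (elemGL i j h (u : K) * elemGL j i h.symm (-(u : K)⁻¹) *
      elemGL i j h (u : K)) = toGLinf K (weylS i j h' u) := by
    simp only [map_mul, blockGL_elemGL, weylS]
  rw [map_mul, map_mul _ (diagGL _), e]
  apply Units.ext
  apply Finsupp.lhom_ext
  intro k b
  rw [Units.val_mul, Units.val_mul, Module.End.mul_apply, Module.End.mul_apply,
    blockGL_diagGL_single, (isMono_weylS _ _ h' u).apply_single,
    (isMono_weylS _ _ h' u).apply_single, blockGL_diagGL_single]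
  have e2 : extendDiag (d ∘ Equiv.swap i j) (Equiv.swap (i : ℕ) j k) = extendDiag d k := by
    by_cases hi : k = i
    · subst hi
      rw [Equiv.swap_apply_left, extendDiag, extendDiag, dif_pos i.2, dif_pos j.2]
      simp
    · by_cases hj : k = j
      · subst hj
        rw [Equiv.swap_apply_right, extendDiag, extendDiag, dif_pos i.2, dif_pos j.2]
        simp
      · rw [Equiv.swap_apply_of_ne_of_ne hi hj, extendDiag, extendDiag]
        split_ifs with hk
        · rw [Function.comp_apply, Equiv.swap_apply_of_ne_of_ne (fun e => hi (congrArg Fin.val e))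
            (fun e => hj (congrArg Fin.val e))]
        · rfl
  rw [e2]
  congr 1
  ring

end Matrices

/-! ### Canonical lifts of elementary matrices to central extensions -/

section Commutators

variable {E : Type*} [Group E]

theorem commutator_mul_left {a b c : E} (h : ⁅b, c⁆ ∈ Subgroup.center E) :
    ⁅a * b, c⁆ = ⁅a, c⁆ * ⁅b, c⁆ := by
  have e : ⁅a * b, c⁆ = a * ⁅b, c⁆ * a⁻¹ * ⁅a, c⁆ := by
    simp only [commutatorElement_def]; group
  rw [e, Subgroup.mem_center_iff.1 h a, mul_inv_cancel_right, Subgroup.mem_center_iff.1 h]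

theorem commutator_mul_right {a b c : E} (h : ⁅a, c⁆ ∈ Subgroup.center E) :
    ⁅a, b * c⁆ = ⁅a, b⁆ * ⁅a, c⁆ := by
  have e : ⁅a, b * c⁆ = ⁅a, b⁆ * (b * ⁅a, c⁆ * b⁻¹) := by
    simp only [commutatorElement_def]; group
  rw [e, Subgroup.mem_center_iff.1 h b, mul_inv_cancel_right]

theorem conj_commutator (s a b : E) : s * ⁅a, b⁆ * s⁻¹ = ⁅s * a * s⁻¹, s * b * s⁻¹⁆ := by
  simp only [commutatorElement_def]; group

/-- The device behind all relations between canonical lifts: a defect that is additive in the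
parameter and invariant under a nontrivial scaling vanishes, since `f((u - 1)a) = 1`. -/
theorem eq_one_of_scale {K : Type*} [Field K] {f : K → E} (hadd : ∀ a b, f (a + b) = f a * f b)
    {u : K} (hu : u - 1 ≠ 0) (hs : ∀ a, f (u * a) = f a) (a : K) : f a = 1 := by
  have h1 := hs (a / (u - 1))
  rw [show u * (a / (u - 1)) = a / (u - 1) + a by field_simp; ring, hadd] at h1
  exact mul_eq_left.1 h1

/-- Over an infinite field the nonzero polynomial `X(1 - X)(X(1 - X) - 1)` has a nonroot `a`; take
`u = a` and `v = 1 - a`. -/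
theorem exists_unit_generic (K : Type u) [Field K] [Infinite K] :
    ∃ u v : Kˣ, (u : K) + v = 1 ∧ (u⁻¹ * v⁻¹ : K) - 1 ≠ 0 := by
  obtain ⟨a, ha⟩ : ∃ a : K, a * (1 - a) * (a * (1 - a) - 1) ≠ 0 := by
    by_contra! hcon
    have h0 : (Polynomial.X * (1 - Polynomial.X) * (Polynomial.X * (1 - Polynomial.X) - 1) :
        Polynomial K) = 0 := by
      apply Polynomial.funext
      intro r
      simpa using hcon r
    rcases mul_eq_zero.1 h0 with h | h
    · rcases mul_eq_zero.1 h with h | h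
      · exact Polynomial.X_ne_zero h
      · have := congrArg (Polynomial.eval 0) h
        simp at this
    · have := congrArg (Polynomial.eval 0) h
      simp at this
  have h1 : a ≠ 0 := by rintro rfl; simp at ha
  have h2 : 1 - a ≠ 0 := by intro h; simp [h] at ha
  have h3 : a * (1 - a) - 1 ≠ 0 := by intro h; simp [h] at ha
  refine ⟨Units.mk0 a h1, Units.mk0 (1 - a) h2, by simp, fun h => h3 ?_⟩
  have h' : a⁻¹ * (1 - a)⁻¹ - 1 = 0 := h
  field_simp at h'
  linear_combination -h'

end Commutators

/-- A surjective homomorphism onto `GL_n(K)` with central kernel. -/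
structure IsCentralCover {K : Type u} [Field K] {n : ℕ} {E : Type*} [Group E]
    (p : E →* GL (Fin n) K) : Prop where
  surjective : Function.Surjective p
  mem_center : ∀ z, p z = 1 → z ∈ Subgroup.center E

namespace IsCentralCover

variable {K : Type u} [Field K] {n : ℕ} {E : Type*} [Group E] {p : E →* GL (Fin n) K}
  (hp : IsCentralCover p)

/-- A chosen preimage. -/
def lift (hp : IsCentralCover p) (g : GL (Fin n) K) : E := (hp.surjective g).choose

theorem map_lift (g : GL (Fin n) K) : p (hp.lift g) = g := (hp.surjective g).choose_spec

theorem exists_eq_mul (hp : IsCentralCover p) {g g' : E} (h : p g = p g') : ∃ z ∈ Subgroup.center E, g' = g * z :=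
  ⟨g⁻¹ * g', hp.mem_center _ (by rw [map_mul, map_inv, h, inv_mul_cancel]), by group⟩

/-- Lifts of the same matrix differ by central elements, which cancel in commutators. So commutators
are well defined on `GL_n(K)`. -/
theorem commutator_eq (hp : IsCentralCover p) {g g' h h' : E} (hg : p g = p g') (hh : p h = p h') : ⁅g, h⁆ = ⁅g', h'⁆ := by
  obtain ⟨z, hz, rfl⟩ := hp.exists_eq_mul hg
  obtain ⟨y, hy, rfl⟩ := hp.exists_eq_mul hh
  have hz' := Subgroup.mem_center_iff.1 hz
  have hy' := Subgroup.mem_center_iff.1 hy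
  rw [commutatorElement_def, commutatorElement_def]
  have e1 : g * z * (h * y) = z * y * (g * h) := by
    rw [hz' g, mul_assoc z g, ← mul_assoc g h, hy', ← mul_assoc, ← mul_assoc]
  have e2 : h * y * (g * z) = z * y * (h * g) := by
    rw [hy' h, mul_assoc y h, ← mul_assoc h g, hz', ← mul_assoc, ← mul_assoc, ← hy' z]
    simp only [mul_assoc]
  rw [show g * z * (h * y) * (g * z)⁻¹ * (h * y)⁻¹ = g * z * (h * y) * (h * y * (g * z))⁻¹ by group,
    e1, e2]
  have hzy : z * y ∈ Subgroup.center E := mul_mem hz hy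
  have h3 := Subgroup.mem_center_iff.1 hzy (g * h * (h * g)⁻¹)
  rw [_root_.mul_inv_rev (z * y), ← mul_assoc, mul_assoc (z * y), ← h3, mul_inv_cancel_right]
  group

theorem commutator_mem_center (hp : IsCentralCover p) {g h : E} (e : p g * p h = p h * p g) :
    ⁅g, h⁆ ∈ Subgroup.center E := by
  apply hp.mem_center
  rw [map_commutatorElement, commutatorElement_eq_one_iff_mul_comm, e]

/-- The commutator of lifts of two elements of a root group. -/
def rootPairing (i j : Fin n) (h : i ≠ j) (a b : K) : E :=
  ⁅hp.lift (elemGL i j h a), hp.lift (elemGL i j h b)⁆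

theorem rootPairing_mem_center (i j : Fin n) (h : i ≠ j) (a b : K) :
    hp.rootPairing i j h a b ∈ Subgroup.center E := by
  apply hp.commutator_mem_center
  rw [hp.map_lift, hp.map_lift, ← elemGL_add, ← elemGL_add, add_comm]

theorem rootPairing_add_left (i j : Fin n) (h : i ≠ j) (a a' b : K) :
    hp.rootPairing i j h (a + a') b = hp.rootPairing i j h a b * hp.rootPairing i j h a' b := by
  rw [rootPairing, hp.commutator_eq (g' := hp.lift (elemGL i j h a) * hp.lift (elemGL i j h a'))
    (by rw [map_mul, map_lift, map_lift, map_lift, elemGL_add]) rfl]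
  exact commutator_mul_left (hp.rootPairing_mem_center i j h a' b)

theorem rootPairing_add_right (i j : Fin n) (h : i ≠ j) (a b b' : K) :
    hp.rootPairing i j h a (b + b') = hp.rootPairing i j h a b * hp.rootPairing i j h a b' := by
  rw [rootPairing, hp.commutator_eq (h' := hp.lift (elemGL i j h b) * hp.lift (elemGL i j h b'))
    rfl (by rw [map_mul, map_lift, map_lift, map_lift, elemGL_add])]
  exact commutator_mul_right (hp.rootPairing_mem_center i j h a b')

/-- The diagonal matrix with the entry `u` in place `k`. -/
def torus (k : Fin n) (u : Kˣ) : GL (Fin n) K := diagGL fun i => if i = k then u else 1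

theorem torus_conj_elemGL (k i j : Fin n) (h : i ≠ j) (u : Kˣ) (a : K) :
    torus k u * elemGL i j h a * (torus k u)⁻¹ =
      elemGL i j h (((if i = k then u else 1 : Kˣ) : K) * a * ((if j = k then u else 1 : Kˣ)⁻¹ : Kˣ)) :=
  diagGL_conj_elemGL _ i j h a

theorem rootPairing_scale (i j : Fin n) (h : i ≠ j) (u : Kˣ) (a b : K) :
    hp.rootPairing i j h (u * a) (u * b) = hp.rootPairing i j h a b := by
  have h1 := Subgroup.mem_center_iff.1 (hp.rootPairing_mem_center i j h a b) (hp.lift (torus i u))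
  rw [← mul_inv_eq_iff_eq_mul] at h1
  rw [← h1, rootPairing, rootPairing, conj_commutator]
  have e : ∀ a : K, elemGL i j h (u * a) =
      p (hp.lift (torus i u) * hp.lift (elemGL i j h a) * (hp.lift (torus i u))⁻¹) := by
    intro a
    rw [map_mul, map_mul, map_inv, map_lift, map_lift, torus_conj_elemGL, if_pos rfl,
      if_neg h.symm, inv_one, Units.val_one, mul_one]
  exact hp.commutator_eq (by rw [← e, map_lift]) (by rw [← e, map_lift])

/-- The commutator pairing on a root group is biadditive, central and invariant under `(a, b) ↦ (ua,
ub)`. For `u + v = 1` this makes the pairing of `a` with `b` equal to that of `a` with `(u⁻¹ + v⁻¹)b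
= u⁻¹v⁻¹b`. Choosing `u⁻¹v⁻¹ ≠ 1`, the pairing is trivial by `eq_one_of_scale`. -/
theorem root_commute (hp : IsCentralCover p) [Infinite K] {i j : Fin n} {h : i ≠ j} {a b : K} {g g' : E}
    (hg : p g = elemGL i j h a) (hg' : p g' = elemGL i j h b) : g * g' = g' * g := by
  obtain ⟨u, v, huv, hne⟩ := exists_unit_generic K
  rw [← commutatorElement_eq_one_iff_mul_comm,
    hp.commutator_eq (g' := hp.lift (elemGL i j h a)) (h' := hp.lift (elemGL i j h b))
      (by rw [hg, map_lift]) (by rw [hg', map_lift])]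
  refine eq_one_of_scale (f := hp.rootPairing i j h a) (hp.rootPairing_add_right i j h a) hne
    (fun b => ?_) b
  have h1 : ∀ (u : Kˣ) b, hp.rootPairing i j h (u * a) b = hp.rootPairing i j h a (u⁻¹ * b) := by
    intro u b
    rw [← hp.rootPairing_scale i j h u a, Units.mul_inv_cancel_left]
  have h2 := hp.rootPairing_add_left i j h (u * a) (v * a) b
  rw [← add_mul, huv, one_mul, h1, h1, ← rootPairing_add_right] at h2
  rw [h2]
  congr 1
  have := u.ne_zero
  have := v.ne_zero
  rw [Units.val_inv_eq_inv_val, Units.val_inv_eq_inv_val]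
  field_simp
  linear_combination (-b) * huv

variable (K) in
/-- A unit different from one. -/
def scaleUnit [Infinite K] : Kˣ := (exists_unit_ne_one K).choose

theorem scaleUnit_sub_one [Infinite K] : (scaleUnit K : K) - 1 ≠ 0 :=
  (exists_unit_ne_one K).choose_spec

variable [Infinite K]

/-- The canonical lift of an elementary matrix. -/
def rootLift (hp : IsCentralCover p) (i j : Fin n) (h : i ≠ j) (a : K) : E :=
  ⁅hp.lift (torus i (scaleUnit K)), hp.lift (elemGL i j h (a / (scaleUnit K - 1)))⁆

/-- The canonical lift does not depend on the chosen preimages, so it may be computed with preimages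
adapted to the situation. -/
theorem rootLift_eq {i j : Fin n} {h : i ≠ j} {a : K} {t g : E}
    (ht : p t = torus i (scaleUnit K)) (hg : p g = elemGL i j h (a / (scaleUnit K - 1))) :
    hp.rootLift i j h a = ⁅t, g⁆ :=
  hp.commutator_eq (by rw [map_lift, ht]) (by rw [map_lift, hg])

theorem map_rootLift (i j : Fin n) (h : i ≠ j) (a : K) :
    p (hp.rootLift i j h a) = elemGL i j h a := by
  rw [rootLift, map_commutatorElement, map_lift, map_lift, commutatorElement_def,
    torus_conj_elemGL, if_pos rfl, if_neg h.symm, inv_one, Units.val_one, mul_one, ← elemGL_neg,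
    ← elemGL_add]
  congr 1
  have := scaleUnit_sub_one (K := K)
  field_simp
  ring

theorem rootLift_add (i j : Fin n) (h : i ≠ j) (a b : K) :
    hp.rootLift i j h (a + b) = hp.rootLift i j h a * hp.rootLift i j h b := by
  set t := hp.lift (torus i (scaleUnit K))
  set g := hp.lift (elemGL i j h (a / (scaleUnit K - 1)))
  set g' := hp.lift (elemGL i j h (b / (scaleUnit K - 1)))
  rw [hp.rootLift_eq (t := t) (g := g * g') (hp.map_lift _)
    (by rw [map_mul, map_lift, map_lift, add_div, elemGL_add])]
  have e : ⁅t, g * g'⁆ = ⁅t, g⁆ * (g * ⁅t, g'⁆ * g⁻¹) := by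
    simp only [commutatorElement_def]; group
  have h1 : g * ⁅t, g'⁆ = ⁅t, g'⁆ * g :=
    hp.root_commute (hp.map_lift _) (hp.map_rootLift i j h b)
  rw [e, h1, mul_inv_cancel_right]
  rfl

theorem rootLift_conj_diag (i j : Fin n) (h : i ≠ j) {t : E} {d : Fin n → Kˣ} (ht : p t = diagGL d)
    (a : K) : t * hp.rootLift i j h a * t⁻¹ =
      hp.rootLift i j h (d i * a * ((d j)⁻¹ : Kˣ)) := by
  rw [rootLift, conj_commutator]
  refine (hp.rootLift_eq ?_ ?_).symm
  · rw [map_mul, map_mul, map_inv, ht, map_lift, torus, ← map_mul, ← map_inv, ← map_mul]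
    congr 1
    rw [mul_comm d, mul_inv_cancel_right]
  · rw [map_mul, map_mul, map_inv, ht, map_lift, diagGL_conj_elemGL]
    congr 1
    ring

/-- The quotient of the two sides is central and additive in `a`. If `t` lifts the torus element
scaling the first root by `scaleUnit K`, then `s t s⁻¹` scales the second root by the same factor;
conjugating by it shows that the quotient is invariant under this scaling, so `eq_one_of_scale`
applies. -/
theorem rootLift_conj {s : E} {i j k l : Fin n} {h : i ≠ j} {h' : k ≠ l} {c : Kˣ}
    (hs : ∀ a : K, p s * elemGL i j h a = elemGL k l h' (c * a) * p s)
    (hd : ∀ d, ∃ d', p s * diagGL d = diagGL d' * p s) (a : K) :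
    s * hp.rootLift i j h a * s⁻¹ = hp.rootLift k l h' (c * a) := by
  have hc : ∀ a, s * hp.rootLift i j h a * s⁻¹ * (hp.rootLift k l h' (c * a))⁻¹ ∈
      Subgroup.center E := by
    intro a
    apply hp.mem_center
    rw [map_mul, map_mul, map_mul, map_inv, map_inv, map_rootLift, map_rootLift, hs,
      mul_inv_cancel_right, mul_inv_cancel]
  rw [← mul_inv_eq_one]
  refine eq_one_of_scale (f := fun a => s * hp.rootLift i j h a * s⁻¹ *
    (hp.rootLift k l h' (c * a))⁻¹) ?_ (scaleUnit_sub_one (K := K)) ?_ a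
  · intro a b
    have h1 := Subgroup.mem_center_iff.1 (hc a) (s * hp.rootLift i j h b * s⁻¹)
    have h2 := hp.root_commute (hp.map_rootLift k l h' (c * a)) (hp.map_rootLift k l h' (c * b))
    have h3 := congrArg (fun x => x⁻¹) h2
    simp only [_root_.mul_inv_rev] at h3
    have h4 : s * (hp.rootLift i j h a * hp.rootLift i j h b) * s⁻¹ *
        ((hp.rootLift k l h' (c * b))⁻¹ * (hp.rootLift k l h' (c * a))⁻¹) =
        s * hp.rootLift i j h a * s⁻¹ * (hp.rootLift k l h' (c * a))⁻¹ *
        (s * hp.rootLift i j h b * s⁻¹ * (hp.rootLift k l h' (c * b))⁻¹) := by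
      rw [← mul_assoc (s * hp.rootLift i j h a * s⁻¹ * (hp.rootLift k l h' (c * a))⁻¹), ← h1, h3,
        hp.root_commute (hp.map_rootLift i j h a) (hp.map_rootLift i j h b)]
      group
    simp only [mul_add, rootLift_add, _root_.mul_inv_rev]
    rw [h3, ← h3, h4]
  · intro a
    obtain ⟨d', hd'⟩ := hd (fun m => if m = i then scaleUnit K else 1)
    obtain ⟨t, ht⟩ := hp.surjective (torus i (scaleUnit K))
    have h1 := hp.rootLift_conj_diag i j h ht a
    rw [if_pos rfl, if_neg h.symm, inv_one, Units.val_one, mul_one] at h1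
    have ht' : p (s * t * s⁻¹) = diagGL d' := by
      rw [map_mul, map_mul, map_inv, ht]
      exact mul_inv_eq_iff_eq_mul.2 hd'
    -- The factor by which `diagGL d'` scales the root `(k, l)` is found by comparing both sides on
    -- one elementary matrix with nonzero entry.
    have h2 : (d' k : K) * ((d' l)⁻¹ : Kˣ) = scaleUnit K := by
      have e1 := hs (scaleUnit K * (c : K)⁻¹)
      have e2 := torus_conj_elemGL i i j h (scaleUnit K) ((c : K)⁻¹)
      rw [if_pos rfl, if_neg h.symm, inv_one, Units.val_one, mul_one] at e2
      have e3 := diagGL_conj_elemGL d' k l h' (c * (c : K)⁻¹)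
      rw [← e2, ← mul_assoc, ← mul_assoc, show p s * torus i (scaleUnit K) = diagGL d' * p s from hd',
        mul_assoc (diagGL d'), hs, ← mul_assoc, mul_assoc _ (p s),
        show p s * (torus i (scaleUnit K))⁻¹ = (diagGL d')⁻¹ * p s by
          rw [eq_inv_mul_iff_mul_eq, ← mul_assoc, ← hd']; exact mul_inv_cancel_right _ _,
        ← mul_assoc, e3, mul_left_inj] at e1
      have e4 := elemGL_injective k l h' e1
      have := c.ne_zero
      field_simp at e4
      rw [← e4]
    have h3 := hp.rootLift_conj_diag k l h' ht' (c * a)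
    have h4 := Subgroup.mem_center_iff.1 (hc a) (s * t * s⁻¹)
    rw [← mul_inv_eq_iff_eq_mul] at h4
    rw [← h4, ← h1]
    have h5 : (d' k : K) * (c * a) * ((d' l)⁻¹ : Kˣ) = c * (scaleUnit K * a) := by
      rw [← h2]; ring
    rw [h5] at h3
    rw [← h3]
    group

end IsCentralCover

end

/-! ### Steinberg relations for the canonical lifts. -/

section

namespace IsCentralCover

variable {K : Type u} [Field K] {n : ℕ} {E : Type*} [Group E] {p : E →* GL (Fin n) K}
  (hp : IsCentralCover p) [Infinite K]

/-- The commutator is central and additive in `a`. A diagonal matrix that scales the root `(i, j)`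
by `scaleUnit K` and fixes the root `(k, l)` shows that it is invariant under a nontrivial scaling.
-/
theorem rootLift_commute_of_scale (i j k l : Fin n) (hij : i ≠ j) (hkl : k ≠ l)
    (hjk : j ≠ k) (hil : i ≠ l) (d : Fin n → Kˣ) (hd : (d i : K) * ((d j)⁻¹ : Kˣ) = scaleUnit K)
    (hd' : d k = d l) (a b : K) :
    ⁅hp.rootLift i j hij a, hp.rootLift k l hkl b⁆ = 1 := by
  have hc : ∀ a, ⁅hp.rootLift i j hij a, hp.rootLift k l hkl b⁆ ∈ Subgroup.center E := by
    intro a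
    apply hp.commutator_mem_center
    rw [map_rootLift, map_rootLift, elemGL_commute _ _ _ _ _ _ hjk hil]
  refine eq_one_of_scale (f := fun a => ⁅hp.rootLift i j hij a, hp.rootLift k l hkl b⁆) ?_
    (scaleUnit_sub_one (K := K)) ?_ a
  · intro a a'
    rw [rootLift_add]
    exact commutator_mul_left (hc a')
  · intro a
    obtain ⟨t, ht⟩ := hp.surjective (diagGL d)
    have h1 := hp.rootLift_conj_diag i j hij ht a
    have h2 := hp.rootLift_conj_diag k l hkl ht b
    rw [mul_right_comm, hd] at h1
    rw [hd', mul_right_comm, Units.mul_inv, one_mul] at h2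
    have h3 := Subgroup.mem_center_iff.1 (hc a) t
    rw [← mul_inv_eq_iff_eq_mul, conj_commutator, h1, h2] at h3
    exact h3

theorem rootLift_commutator_eq_one (i j k l : Fin n) (hij : i ≠ j) (hkl : k ≠ l)
    (hjk : j ≠ k) (hil : i ≠ l) (a b : K) :
    ⁅hp.rootLift i j hij a, hp.rootLift k l hkl b⁆ = 1 := by
  by_cases hik : i = k
  · subst hik
    by_cases hjl : j = l
    · subst hjl
      rw [commutatorElement_eq_one_iff_mul_comm]
      exact hp.root_commute (hp.map_rootLift _ _ _ _) (hp.map_rootLift _ _ _ _)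
    -- For `i = k` the diagonal matrix has to act through `j`, because place `i` would also scale
    -- the second root.
    · refine hp.rootLift_commute_of_scale i j i l hij hkl hjk hil
        (fun m => if m = j then (scaleUnit K)⁻¹ else 1) ?_ ?_ a b
      · rw [if_neg hij, if_pos rfl, inv_inv, Units.val_one, one_mul]
      · rw [if_neg hij, if_neg (Ne.symm hjl)]
  · refine hp.rootLift_commute_of_scale i j k l hij hkl hjk hil
      (fun m => if m = i then scaleUnit K else 1) ?_ ?_ a b
    · rw [if_pos rfl, if_neg hij.symm, inv_one, Units.val_one, mul_one]
    · rw [if_neg (Ne.symm hik), if_neg hil.symm]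

/-- The torus element in place `i` scales the roots `(i, j)` and `(i, k)` alike and fixes `(j, k)`.
So the central defect of the relation is additive in `a` and invariant under a nontrivial scaling.
-/
theorem rootLift_commutator (i j k : Fin n) (hij : i ≠ j) (hjk : j ≠ k) (hik : i ≠ k) (a b : K) :
    ⁅hp.rootLift i j hij a, hp.rootLift j k hjk b⁆ = hp.rootLift i k hik (a * b) := by
  have hm : ∀ a, p ⁅hp.rootLift i j hij a, hp.rootLift j k hjk b⁆ = elemGL i k hik (a * b) := by
    intro a
    rw [map_commutatorElement, map_rootLift, map_rootLift, elemGL_commutator]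
  have hc : ∀ a, ⁅hp.rootLift i j hij a, hp.rootLift j k hjk b⁆ * (hp.rootLift i k hik (a * b))⁻¹ ∈
      Subgroup.center E := by
    intro a
    apply hp.mem_center
    rw [map_mul, hm, map_inv, map_rootLift, mul_inv_cancel]
  rw [← mul_inv_eq_one]
  refine eq_one_of_scale (f := fun a => ⁅hp.rootLift i j hij a, hp.rootLift j k hjk b⁆ *
    (hp.rootLift i k hik (a * b))⁻¹) ?_ (scaleUnit_sub_one (K := K)) ?_ a
  · intro a a'
    have e1 : ∀ g g' h : E, ⁅g * g', h⁆ = g * ⁅g', h⁆ * g⁻¹ * ⁅g, h⁆ := by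
      intro g g' h
      simp only [commutatorElement_def]; group
    have h2 : hp.rootLift i j hij a * ⁅hp.rootLift i j hij a', hp.rootLift j k hjk b⁆ =
        ⁅hp.rootLift i j hij a', hp.rootLift j k hjk b⁆ * hp.rootLift i j hij a := by
      obtain ⟨z, hz, hz'⟩ := hp.exists_eq_mul (g := hp.rootLift i k hik (a' * b))
        (g' := ⁅hp.rootLift i j hij a', hp.rootLift j k hjk b⁆) (by rw [hm, map_rootLift])
      have h3 := hp.rootLift_commutator_eq_one i j i k hij hik hij.symm hik a (a' * b)
      rw [commutatorElement_eq_one_iff_mul_comm] at h3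
      rw [hz', ← mul_assoc, h3, mul_assoc, Subgroup.mem_center_iff.1 hz, mul_assoc]
    have h4 := Subgroup.mem_center_iff.1 (hc a)
      ⁅hp.rootLift i j hij a', hp.rootLift j k hjk b⁆
    rw [rootLift_add, e1, h2, mul_inv_cancel_right, add_mul, add_comm (a * b), rootLift_add,
      _root_.mul_inv_rev, ← mul_assoc, mul_assoc ⁅hp.rootLift i j hij a', hp.rootLift j k hjk b⁆, h4,
      mul_assoc]
  · intro a
    obtain ⟨t, ht⟩ := hp.surjective (torus i (scaleUnit K))
    have h1 := hp.rootLift_conj_diag i j hij ht a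
    have h2 := hp.rootLift_conj_diag j k hjk ht b
    have h3 := hp.rootLift_conj_diag i k hik ht (a * b)
    rw [if_pos rfl, if_neg hij.symm, inv_one, Units.val_one, mul_one] at h1
    rw [if_neg hij.symm, if_neg hik.symm, inv_one, Units.val_one, mul_one, one_mul] at h2
    rw [if_pos rfl, if_neg hik.symm, inv_one, Units.val_one, mul_one, ← mul_assoc] at h3
    have h4 := Subgroup.mem_center_iff.1 (hc a) t
    rw [← mul_inv_eq_iff_eq_mul] at h4
    rw [← h4, ← h1, ← h3]
    nth_rewrite 1 [← h2]
    rw [← conj_commutator]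
    group

/-- The rank one pair of canonical lifts. -/
def rankOne (i j : Fin n) (h : i ≠ j) : RankOne K E where
  x := hp.rootLift i j h
  y := hp.rootLift j i h.symm
  x_add := hp.rootLift_add i j h
  y_add := hp.rootLift_add j i h.symm
  weyl u hu a := by
    have e : p (hp.rootLift i j h u * hp.rootLift j i h.symm (-u⁻¹) * hp.rootLift i j h u) =
        elemGL i j h u * elemGL j i h.symm (-u⁻¹) * elemGL i j h u := by
      simp only [map_mul, map_rootLift]
    have h1 := hp.rootLift_conj (i := i) (j := j) (h := h) (h' := h.symm)
      (c := -((Units.mk0 u hu)⁻¹ ^ 2))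
      (s := hp.rootLift i j h u * hp.rootLift j i h.symm (-u⁻¹) * hp.rootLift i j h u)
      (fun a => by
        rw [e, elemGL_weyl i j h hu]
        congr 2
        simp [div_eq_mul_inv, mul_comm])
      (fun d => ⟨_, by
        rw [e]
        exact weyl_mul_diagGL d i j h (Units.mk0 u hu)⟩) a
    rw [mul_inv_eq_iff_eq_mul] at h1
    rw [h1]
    congr 2
    simp [div_eq_mul_inv, mul_comm]

theorem rankOne_torus_x (i j : Fin n) (h : i ≠ j) {t : E} {d : Fin n → Kˣ} (ht : p t = diagGL d)
    (a : K) : t * (hp.rankOne i j h).x a * t⁻¹ = (hp.rankOne i j h).x ((d i / d j : Kˣ) * a) := by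
  refine (hp.rootLift_conj_diag i j h ht a).trans ?_
  change hp.rootLift i j h _ = hp.rootLift i j h _
  congr 1
  rw [div_eq_mul_inv, Units.val_mul]
  ring

theorem rankOne_torus_y (i j : Fin n) (h : i ≠ j) {t : E} {d : Fin n → Kˣ} (ht : p t = diagGL d)
    (a : K) : t * (hp.rankOne i j h).y a * t⁻¹ = (hp.rankOne i j h).y (a / (d i / d j : Kˣ)) := by
  refine (hp.rootLift_conj_diag j i h.symm ht a).trans ?_
  change hp.rootLift j i h.symm _ = hp.rootLift j i h.symm _
  congr 1
  rw [div_eq_mul_inv a, ← Units.val_inv_eq_inv_val, inv_div, div_eq_mul_inv, Units.val_mul]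
  ring

end IsCentralCover

end

section

/-! ### Steinberg symbols -/

/-- A Steinberg symbol on `K` with values in `A`. -/
structure Symbol (K A : Type*) [Field K] [AddCommGroup A] where
  toFun : Kˣ → Kˣ → A
  mul_left : ∀ u v w, toFun (u * v) w = toFun u w + toFun v w
  mul_right : ∀ u v w, toFun u (v * w) = toFun u v + toFun u w
  steinberg : ∀ u v : Kˣ, (u : K) + v = 1 → toFun u v = 0

namespace Symbol

variable {K A : Type*} [Field K] [AddCommGroup A]

instance : CoeFun (Symbol K A) (fun _ => Kˣ → Kˣ → A) := ⟨Symbol.toFun⟩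

variable (c : Symbol K A)

theorem one_left (u : Kˣ) : c 1 u = 0 := by
  have := c.mul_left 1 1 u
  rwa [mul_one, left_eq_add] at this

theorem one_right (u : Kˣ) : c u 1 = 0 := by
  have := c.mul_right u 1 1
  rwa [mul_one, left_eq_add] at this

theorem inv_left (u v : Kˣ) : c u⁻¹ v = -c u v := by
  rw [eq_neg_iff_add_eq_zero, ← c.mul_left, inv_mul_cancel, one_left]

theorem inv_right (u v : Kˣ) : c u v⁻¹ = -c u v := by
  rw [eq_neg_iff_add_eq_zero, ← c.mul_right, inv_mul_cancel, one_right]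

/-- For `u ≠ 1` write `-u = (1 - u)/(1 - u⁻¹)` and apply the Steinberg relation to `u` and to `u⁻¹`.
-/
theorem neg_self (u : Kˣ) : c u (-u) = 0 := by
  by_cases hu : u = 1
  · rw [hu, one_left]
  have hu1 : (u : K) ≠ 1 := fun h => hu (Units.ext h)
  have h1 : (1 : K) - u ≠ 0 := sub_ne_zero.2 hu1.symm
  have h2 : (1 : K) - (u⁻¹ : Kˣ) ≠ 0 := by
    rw [sub_ne_zero, Units.val_inv_eq_inv_val]
    intro h
    exact hu1 (inv_eq_one.1 h.symm)
  have e : -u = Units.mk0 _ h1 * (Units.mk0 _ h2)⁻¹ := by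
    rw [eq_mul_inv_iff_mul_eq]
    apply Units.ext
    simp only [Units.val_mul, Units.val_neg, Units.val_mk0, Units.val_inv_eq_inv_val]
    have := u.ne_zero
    field_simp
    ring
  have e2 := c.steinberg u⁻¹ (Units.mk0 _ h2) (by simp)
  rw [e, c.mul_right, c.inv_right, ← c.inv_left, e2, c.steinberg u (Units.mk0 _ h1) (by simp),
    add_zero]

/-- Expand `c (uv) (-uv) = 0` bimultiplicatively; the terms `c u (-u)` and `c v (-v)` drop out. -/
theorem add_swap (u v : Kˣ) : c u v + c v u = 0 := by
  have h := c.neg_self (u * v)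
  rw [c.mul_left] at h
  nth_rewrite 1 [← neg_mul, c.mul_right] at h
  rw [c.neg_self, zero_add, mul_comm u v, ← neg_mul, mul_comm (-v), c.mul_right v, c.neg_self,
    add_zero] at h
  exact h

theorem swap (u v : Kˣ) : c u v = -c v u := eq_neg_of_add_eq_zero_left (c.add_swap u v)

theorem self (u : Kˣ) : c u u = c u (-1) := by
  have h := c.neg_self u
  rw [← neg_one_mul, c.mul_right] at h
  have h2 : c u (-1) + c u (-1) = 0 := by
    rw [← c.mul_right, neg_one_mul, neg_neg, one_right]
  rw [eq_neg_of_add_eq_zero_right h]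
  exact (eq_neg_of_add_eq_zero_left h2).symm

theorem neg_one_add_self (u : Kˣ) : c u (-1) + c u (-1) = 0 := by
  rw [← c.mul_right, neg_one_mul, neg_neg, one_right]

/-- The alternating function on triangles defined by a symbol. -/
def tri (p q r : Kˣ) : A := c p q + c q r + c r p + c q (-1)

/-- Divided by its right side, the hypothesis exhibits two units with sum `1`. Their Steinberg
relation, expanded, is the alternating sum over four faces of the octahedron with vertices `p_{ab}`.
-/
theorem tri_octahedron {p01 p02 p03 p12 p13 p23 : Kˣ}
    (h : (p01 * p23 + p03 * p12 : K) = p02 * p13) :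
    c.tri p12 p13 p23 - c.tri p02 p03 p23 + c.tri p01 p03 p13 - c.tri p01 p02 p12 = 0 := by
  have h1 := c.steinberg (p01 * p23 * (p02 * p13)⁻¹) (p03 * p12 * (p02 * p13)⁻¹) (by
    have := p02.ne_zero
    have := p13.ne_zero
    simp only [Units.val_mul, Units.val_inv_eq_inv_val, _root_.mul_inv_rev]
    field_simp
    rw [h, mul_comm])
  rw [c.mul_left, c.mul_right _ (p03 * p12), c.mul_right _ (p03 * p12), c.inv_left, c.inv_right,
    c.inv_left, c.inv_right, neg_neg, c.self (p02 * p13)] at h1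
  simp only [c.mul_left, c.mul_right] at h1
  simp only [tri]
  have h2 := c.neg_one_add_self p02
  have e1 := c.add_swap p12 p13
  have e2 := c.add_swap p13 p23
  have e3 := c.add_swap p03 p23
  have e4 := c.add_swap p03 p13
  have e5 := c.add_swap p01 p13
  have e6 := c.add_swap p01 p12
  rw [← h1]
  linear_combination (norm := module) e1 + e2 - e3 + e4 + e5 - e6 - h2

/-- Each edge of the tetrahedron lies on two faces, and antisymmetry cancels its contributions; the
Steinberg relation is not needed. -/
theorem tri_tetrahedron (q0 q1 q2 q3 : Kˣ) :
    c.tri q3 q2 q1 - c.tri q3 q2 q0 + c.tri q3 q1 q0 - c.tri q2 q1 q0 = 0 := by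
  simp only [tri]
  have e2 := c.add_swap q1 q3
  have e3 := c.add_swap q0 q2
  linear_combination (norm := module) e2 - e3

theorem tri_mul (d p q r : Kˣ) : c.tri (d * p) (d * q) (d * r) = c.tri p q r := by
  simp only [tri, c.mul_left, c.mul_right, c.self]
  have e1 := c.add_swap d p
  have e2 := c.add_swap d q
  have e3 := c.add_swap d r
  have e4 := c.neg_one_add_self d
  linear_combination (norm := module) e1 + e2 + e3 + 2 • e4

/-- In the application `d` and `e` are the factors of minors that use `i + 1` and `i` vectors of a
rescaled sequence, so `d/e` is a single scaling factor and the correction telescopes. -/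
theorem tri_mul_mul (d e p q r : Kˣ) :
    c.tri (d * p) (d * q) (e * r) = c.tri p q r + c (d * e⁻¹) (q * p⁻¹) := by
  simp only [tri, c.mul_left, c.mul_right, c.inv_left, c.inv_right, c.self]
  have e1 := c.add_swap d p
  have e2 := c.add_swap d r
  have e3 := c.add_swap d e
  have e4 := c.neg_one_add_self d
  have e5 := c.add_swap q e
  linear_combination (norm := module) e1 + e2 + e3 + e4 + e5

end Symbol

end

section

/-! ### Sums over simplices of lattice points -/

section SimplexSums

variable {A : Type*} [AddCommGroup A]

/-- The sum over all `(i, j)` with `i + j = N`. -/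
def sum2 (N : ℕ) (f : ℕ → ℕ → A) : A := ∑ x ∈ Finset.HasAntidiagonal.antidiagonal N, f x.1 x.2

/-- The sum over all `(i, j, k)` with `i + j + k = N`. -/
def sum3 (N : ℕ) (f : ℕ → ℕ → ℕ → A) : A := ∑ x ∈ Finset.HasAntidiagonal.antidiagonal N, sum2 x.2 (f x.1)

/-- The sum over all `(i, j, k, l)` with `i + j + k + l = N`. -/
def sum4 (N : ℕ) (f : ℕ → ℕ → ℕ → ℕ → A) : A := ∑ x ∈ Finset.HasAntidiagonal.antidiagonal N, sum3 x.2 (f x.1)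

theorem sum2_congr {N : ℕ} {f g : ℕ → ℕ → A} (h : ∀ i j, i + j = N → f i j = g i j) :
    sum2 N f = sum2 N g :=
  Finset.sum_congr rfl fun _ hx => h _ _ (Finset.HasAntidiagonal.mem_antidiagonal.1 hx)

theorem sum3_congr {N : ℕ} {f g : ℕ → ℕ → ℕ → A}
    (h : ∀ i j k, i + j + k = N → f i j k = g i j k) : sum3 N f = sum3 N g :=
  Finset.sum_congr rfl fun x hx => sum2_congr fun j k e => h _ _ _ (by
    have := Finset.HasAntidiagonal.mem_antidiagonal.1 hx
    omega)

theorem sum4_congr {N : ℕ} {f g : ℕ → ℕ → ℕ → ℕ → A}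
    (h : ∀ i j k l, i + j + k + l = N → f i j k l = g i j k l) : sum4 N f = sum4 N g :=
  Finset.sum_congr rfl fun x hx => sum3_congr fun j k l e => h _ _ _ _ (by
    have := Finset.HasAntidiagonal.mem_antidiagonal.1 hx
    omega)

theorem sum2_zero (f : ℕ → ℕ → A) : sum2 0 f = f 0 0 := by simp [sum2]

theorem sum3_zero (f : ℕ → ℕ → ℕ → A) : sum3 0 f = f 0 0 0 := by simp [sum3, sum2]

theorem sum4_zero (f : ℕ → ℕ → ℕ → ℕ → A) : sum4 0 f = f 0 0 0 0 := by simp [sum4, sum3, sum2]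

theorem sum4_sub (N : ℕ) (f g : ℕ → ℕ → ℕ → ℕ → A) :
    sum4 N (fun i j k l => f i j k l - g i j k l) = sum4 N f - sum4 N g := by
  simp only [sum4, sum3, sum2, Finset.sum_sub_distrib]

theorem sum4_add (N : ℕ) (f g : ℕ → ℕ → ℕ → ℕ → A) :
    sum4 N (fun i j k l => f i j k l + g i j k l) = sum4 N f + sum4 N g := by
  simp only [sum4, sum3, sum2, Finset.sum_add_distrib]

theorem sum2_succ_fst (N : ℕ) (f : ℕ → ℕ → A) :
    sum2 (N + 1) f = f 0 (N + 1) + sum2 N (fun i j => f (i + 1) j) :=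
  Finset.Nat.sum_antidiagonal_succ

theorem sum2_succ_snd (N : ℕ) (f : ℕ → ℕ → A) :
    sum2 (N + 1) f = f (N + 1) 0 + sum2 N (fun i j => f i (j + 1)) :=
  Finset.Nat.sum_antidiagonal_succ'

theorem sum3_succ_fst (N : ℕ) (f : ℕ → ℕ → ℕ → A) :
    sum3 (N + 1) f = sum2 (N + 1) (f 0) + sum3 N (fun i j k => f (i + 1) j k) :=
  Finset.Nat.sum_antidiagonal_succ

theorem sum3_succ_snd (N : ℕ) (f : ℕ → ℕ → ℕ → A) :
    sum3 (N + 1) f = sum2 (N + 1) (fun i k => f i 0 k) + sum3 N (fun i j k => f i (j + 1) k) := by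
  rw [sum2_succ_snd, sum3, Finset.Nat.sum_antidiagonal_succ']
  simp only [sum2_succ_fst, Finset.sum_add_distrib, sum2_zero]
  rw [add_assoc]
  rfl

theorem sum3_succ_thd (N : ℕ) (f : ℕ → ℕ → ℕ → A) :
    sum3 (N + 1) f = sum2 (N + 1) (fun i j => f i j 0) + sum3 N (fun i j k => f i j (k + 1)) := by
  rw [sum2_succ_snd, sum3, Finset.Nat.sum_antidiagonal_succ']
  simp only [sum2_succ_snd, Finset.sum_add_distrib, sum2_zero]
  rw [add_assoc]
  rfl

/-- This and the next three lemmas split the lattice tetrahedron into the face where one coordinate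
vanishes and a smaller tetrahedron; they separate the boundary terms in `flagCocycle_eq`. -/
theorem sum4_succ_fst (N : ℕ) (f : ℕ → ℕ → ℕ → ℕ → A) :
    sum4 (N + 1) f = sum3 (N + 1) (f 0) + sum4 N (fun i j k l => f (i + 1) j k l) :=
  Finset.Nat.sum_antidiagonal_succ

theorem sum4_succ_snd (N : ℕ) (f : ℕ → ℕ → ℕ → ℕ → A) :
    sum4 (N + 1) f = sum3 (N + 1) (fun i k l => f i 0 k l) +
      sum4 N (fun i j k l => f i (j + 1) k l) := by
  rw [sum4, sum3, Finset.Nat.sum_antidiagonal_succ', Finset.Nat.sum_antidiagonal_succ']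
  simp only [sum3_succ_fst, Finset.sum_add_distrib, sum2_zero, sum3_zero]
  rw [add_assoc]
  rfl

theorem sum4_succ_thd (N : ℕ) (f : ℕ → ℕ → ℕ → ℕ → A) :
    sum4 (N + 1) f = sum3 (N + 1) (fun i j l => f i j 0 l) +
      sum4 N (fun i j k l => f i j (k + 1) l) := by
  rw [sum4, sum3, Finset.Nat.sum_antidiagonal_succ', Finset.Nat.sum_antidiagonal_succ']
  simp only [sum3_succ_snd, Finset.sum_add_distrib, sum2_zero, sum3_zero]
  rw [add_assoc]
  rfl

theorem sum4_succ_fth (N : ℕ) (f : ℕ → ℕ → ℕ → ℕ → A) :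
    sum4 (N + 1) f = sum3 (N + 1) (fun i j k => f i j k 0) +
      sum4 N (fun i j k l => f i j k (l + 1)) := by
  rw [sum4, sum3, Finset.Nat.sum_antidiagonal_succ', Finset.Nat.sum_antidiagonal_succ']
  simp only [sum3_succ_thd, Finset.sum_add_distrib, sum2_zero, sum3_zero]
  rw [add_assoc]
  rfl

end SimplexSums

/-! ### Concatenation of sequences of vectors -/

section Sequences

variable {V : Type*}

/-- The first `i` terms of `u`, followed by `v`. -/
def cat (i : ℕ) (u v : ℕ → V) : ℕ → V := fun r => if r < i then u r else v (r - i)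

/-- The sequence `v` preceded by `x`. -/
def seqCons (x : V) (v : ℕ → V) : ℕ → V := fun r => if r = 0 then x else v (r - 1)

theorem cat_zero (u v : ℕ → V) : cat 0 u v = v := by
  funext r
  simp [cat]

theorem cat_cat (i j : ℕ) (u v w : ℕ → V) : cat i u (cat j v w) = cat (i + j) (cat i u v) w := by
  funext r
  simp only [cat]
  split_ifs <;> first | rfl | omega | (congr 1; omega)

theorem cat_succ (i : ℕ) (u w : ℕ → V) : cat (i + 1) u w = cat i u (seqCons (u i) w) := by
  funext r
  simp only [cat, seqCons]
  split_ifs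
  all_goals first | rfl | omega | (congr 1; omega)

theorem seqCons_cat (i : ℕ) (x : V) (u w : ℕ → V) :
    seqCons x (cat i u w) = cat (i + 1) (seqCons x u) w := by
  funext r
  simp only [cat, seqCons]
  split_ifs
  all_goals first | rfl | omega | (congr 1; omega)

theorem cat_shift (i : ℕ) (u : ℕ → V) : cat i u (fun r => u (r + i)) = u := by
  funext r
  simp only [cat]
  split_ifs
  · rfl
  · congr 1; omega

theorem cat_agree {i m : ℕ} {u v w : ℕ → V} (h : ∀ r < m - i, v r = w r) :
    ∀ r < m, cat i u v r = cat i u w r := by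
  intro r hr
  simp only [cat]
  split_ifs
  · rfl
  · exact h _ (by omega)

theorem seqCons_agree {m : ℕ} {x : V} {v w : ℕ → V} (h : ∀ r < m - 1, v r = w r) :
    ∀ r < m, seqCons x v r = seqCons x w r := by
  intro r hr
  simp only [seqCons]
  split_ifs
  · rfl
  · exact h _ (by omega)

end Sequences

/-! ### Determinants of sequences of vectors -/

section Determinants

variable {K : Type*} [Field K] {n : ℕ}

/-- The determinant of the first `n` vectors of a sequence. -/
def vdet (f : ℕ → Fin n → K) : K := (Matrix.of fun r : Fin n => f r).det

theorem vdet_congr {f g : ℕ → Fin n → K} (h : ∀ r < n, f r = g r) : vdet f = vdet g := by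
  have e : (fun r : Fin n => f r) = fun r : Fin n => g r := funext fun r => h r r.2
  rw [vdet, vdet, e]

theorem vdet_eq_zero {f : ℕ → Fin n → K} {r t : ℕ} (hrt : r ≠ t) (hr : r < n) (ht : t < n)
    (h : f r = f t) : vdet f = 0 :=
  Matrix.det_zero_of_row_eq (i := ⟨r, hr⟩) (j := ⟨t, ht⟩) (fun e => hrt (congrArg Fin.val e)) h

theorem vdet_swap (i : ℕ) (hi : i + 1 < n) (u w : ℕ → Fin n → K) (x y : Fin n → K) :
    vdet (cat i u (seqCons x (seqCons y w))) = -vdet (cat i u (seqCons y (seqCons x w))) := by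
  have h := Matrix.det_permute (Equiv.swap (⟨i, by omega⟩ : Fin n) ⟨i + 1, hi⟩)
    (Matrix.of fun r : Fin n => cat i u (seqCons y (seqCons x w)) r)
  rw [Equiv.Perm.sign_swap (by simp)] at h
  simp only [Units.val_neg, Units.val_one, Int.cast_neg, Int.cast_one, neg_mul, one_mul] at h
  refine Eq.trans ?_ h
  rw [vdet]
  congr 1
  ext r c
  simp only [Matrix.of_apply, Matrix.submatrix_apply, id_eq]
  by_cases h1 : r = ⟨i, by omega⟩
  · subst h1
    rw [Equiv.swap_apply_left]
    simp [cat, seqCons]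
  · by_cases h2 : r = ⟨i + 1, hi⟩
    · subst h2
      rw [Equiv.swap_apply_right]
      simp [cat, seqCons]
    · rw [Equiv.swap_apply_of_ne_of_ne h1 h2]
      have h1' : (r : ℕ) ≠ i := fun e => h1 (Fin.ext e)
      have h2' : (r : ℕ) ≠ i + 1 := fun e => h2 (Fin.ext e)
      simp only [cat, seqCons]
      split_ifs <;> first | rfl | omega

theorem vdet_cat_seqCons (i : ℕ) (hi : i < n) (u w : ℕ → Fin n → K) (x : Fin n → K) :
    vdet (cat i u (seqCons x w)) = (-1) ^ i * vdet (seqCons x (cat i u w)) := by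
  induction i generalizing w with
  | zero => rw [cat_zero, cat_zero, pow_zero, one_mul]
  | succ i ih =>
    rw [cat_succ, vdet_swap i hi, ih (by omega), cat_succ, pow_succ]
    ring

theorem vdet_seqCons_swap (hn : 1 < n) (w : ℕ → Fin n → K) (x y : Fin n → K) :
    vdet (seqCons x (seqCons y w)) = -vdet (seqCons y (seqCons x w)) := by
  have := vdet_swap 0 (by omega) w w x y
  rwa [cat_zero, cat_zero] at this

theorem vdet_cat_seqCons_seqCons (i j : ℕ) (hij : i + j + 1 < n) (u v w : ℕ → Fin n → K)
    (x y : Fin n → K) :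
    vdet (cat i u (seqCons x (cat j v (seqCons y w)))) =
      (-1) ^ i * (-1) ^ (i + j) * vdet (seqCons x (seqCons y (cat i u (cat j v w)))) := by
  rw [vdet_cat_seqCons i (by omega), cat_cat, seqCons_cat, vdet_cat_seqCons _ hij, ← seqCons_cat,
    vdet_seqCons_swap (by omega), cat_cat, pow_succ]
  ring

/-- The determinant of a sequence as a linear function of its first term. -/
def vdetLinear (w : ℕ → Fin (n + 1) → K) : (Fin (n + 1) → K) →ₗ[K] K :=
  (Matrix.detRowAlternating (n := Fin (n + 1)) (R := K)).toMultilinearMap.toLinearMap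
    (fun r => seqCons 0 w r) 0

theorem vdetLinear_apply (w : ℕ → Fin (n + 1) → K) (x : Fin (n + 1) → K) :
    vdetLinear w x = vdet (seqCons x w) := by
  change Matrix.det (Function.update (fun r : Fin (n + 1) => seqCons 0 w r) 0 x) = _
  rw [vdet]
  congr 1
  ext r c
  rw [Matrix.of_apply]
  by_cases hr : r = 0
  · subst hr
    simp [seqCons]
  · have : (r : ℕ) ≠ 0 := fun e => hr (Fin.ext e)
    rw [Function.update_of_ne hr]
    simp [seqCons, this]

/-- The vectors `x`, `y` and the first `n` terms of `w` form a basis. The components of `z` along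
`w` contribute determinants with a repeated row. -/
theorem exists_coeffs {x y : Fin (n + 2) → K} {w : ℕ → Fin (n + 2) → K}
    (h : vdet (seqCons x (seqCons y w)) ≠ 0) (z : Fin (n + 2) → K) :
    ∃ a b : K, ∀ t, vdet (seqCons z (seqCons t w)) =
      a * vdet (seqCons x (seqCons t w)) + b * vdet (seqCons y (seqCons t w)) := by
  set M : Matrix (Fin (n + 2)) (Fin (n + 2)) K :=
    Matrix.of fun r : Fin (n + 2) => seqCons x (seqCons y w) r with hM
  have hdet : IsUnit M.det := isUnit_iff_ne_zero.2 h
  set c := z ᵥ* M⁻¹ with hc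
  have hz : z = c ᵥ* M := by
    rw [hc, Matrix.vecMul_vecMul, Matrix.nonsing_inv_mul _ hdet, Matrix.vecMul_one]
  refine ⟨c 0, c 1, fun t => ?_⟩
  rw [← vdetLinear_apply, ← vdetLinear_apply, ← vdetLinear_apply]
  conv_lhs => rw [hz, Matrix.vecMul_eq_sum]
  rw [map_sum, Fin.sum_univ_succ, Fin.sum_univ_succ, Finset.sum_eq_zero, add_zero]
  · simp only [map_smul, smul_eq_mul]
    rfl
  · intro r _
    rw [map_smul, vdetLinear_apply, vdet_eq_zero (r := 0) (t := (r : ℕ) + 2) (by omega) (by omega)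
      (by omega), smul_zero]
    rfl

/-- The three-term Plücker relation. -/
theorem vdet_pluecker {w : ℕ → Fin (n + 2) → K} {x0 x1 x2 x3 : Fin (n + 2) → K}
    (h : vdet (seqCons x0 (seqCons x1 w)) ≠ 0) :
    vdet (seqCons x0 (seqCons x1 w)) * vdet (seqCons x2 (seqCons x3 w)) +
      vdet (seqCons x0 (seqCons x3 w)) * vdet (seqCons x1 (seqCons x2 w)) =
    vdet (seqCons x0 (seqCons x2 w)) * vdet (seqCons x1 (seqCons x3 w)) := by
  obtain ⟨a, b, hab⟩ := exists_coeffs h x2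
  have hs := vdet_seqCons_swap (n := n + 2) (by omega) w
  have h0 : ∀ x, vdet (seqCons x (seqCons x w)) = 0 := fun x =>
    vdet_eq_zero (r := 0) (t := 1) (by omega) (by omega) (by omega) rfl
  have e0 := hab x0
  have e1 := hab x1
  have e3 := hab x3
  rw [h0, hs x1 x0, hs x2 x0] at e0
  rw [h0, hs x2 x1] at e1
  rw [e3]
  linear_combination (vdet (seqCons x0 (seqCons x3 w))) * (-e1) + vdet (seqCons x1 (seqCons x3 w)) * e0

end Determinants

end

section

/-! ### The cocycle on flags -/

section Flags

variable {K : Type*} [Field K]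

/-- The unit defined by a nonzero element. -/
def toUnit (a : K) : Kˣ := by
  classical exact if h : a ≠ 0 then Units.mk0 a h else 1

theorem toUnit_val {a : K} (h : a ≠ 0) : (toUnit a : K) = a := by
  rw [toUnit, dif_pos h, Units.val_mk0]

theorem toUnit_mul {a b : K} (ha : a ≠ 0) (hb : b ≠ 0) :
    toUnit (a * b) = toUnit a * toUnit b := by
  apply Units.ext
  rw [Units.val_mul, toUnit_val ha, toUnit_val hb, toUnit_val (mul_ne_zero ha hb)]

theorem toUnit_unit (u : Kˣ) : toUnit (u : K) = u := Units.ext (toUnit_val u.ne_zero)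

variable {n : ℕ}

/-- The determinant of `i` vectors of `A`, `j` vectors of `B` and the remaining ones from `C`. -/
def det3 (A B C : ℕ → Fin n → K) (i j : ℕ) : K := vdet (cat i A (cat j B C))

/-- The determinant of `i` vectors of `A`, `j` vectors of `B`, `k` vectors of `C` and the remaining
ones from `D`. -/
def det4 (A B C D : ℕ → Fin n → K) (i j k : ℕ) : K := vdet (cat i A (cat j B (cat k C D)))

theorem det4_zero_fst (A B C D : ℕ → Fin n → K) (j k : ℕ) :
    det4 A B C D 0 j k = det3 B C D j k := by rw [det4, cat_zero, det3]

theorem det4_zero_snd (A B C D : ℕ → Fin n → K) (i k : ℕ) :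
    det4 A B C D i 0 k = det3 A C D i k := by rw [det4, cat_zero, det3]

theorem det4_zero_thd (A B C D : ℕ → Fin n → K) (i j : ℕ) :
    det4 A B C D i j 0 = det3 A B D i j := by rw [det4, cat_zero, det3]

theorem det4_of_add_eq (A B C D : ℕ → Fin n → K) {i j k : ℕ} (h : i + j + k = n) :
    det4 A B C D i j k = det3 A B C i j := by
  rw [det4, det3]
  refine vdet_congr (cat_agree (cat_agree fun r hr => ?_))
  rw [cat, if_pos (by omega)]

/-- All six minors contain the same `N` vectors: `i` from `A`, `j` from `B`, `k` from `C` and `l`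
from `D`, with `i + j + k + l = N`. They differ in which two of `A_i`, `B_j`, `C_k`, `D_l` are
added. Moving these two to the front costs signs whose product is the same in all three terms of the
Plücker relation. -/
theorem det4_pluecker {N : ℕ} (A B C D : ℕ → Fin (N + 2) → K) {i j k : ℕ} (h : i + j + k ≤ N)
    (h0 : det4 A B C D (i + 1) (j + 1) k ≠ 0) :
    det4 A B C D (i + 1) (j + 1) k * det4 A B C D i j (k + 1) +
      det4 A B C D (i + 1) j k * det4 A B C D i (j + 1) (k + 1) =
    det4 A B C D (i + 1) j (k + 1) * det4 A B C D i (j + 1) k := by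
  obtain ⟨l, hl⟩ := Nat.exists_eq_add_of_le h
  -- Dropping the term `D_l` leaves a sequence into which this vector can be reinserted, so that it
  -- is treated like the other three.
  set D' : ℕ → Fin (N + 2) → K := fun r => D (r + (l + 1))
  set Q := cat i A (cat j B (cat k C (cat l D D')))
  have hD : D = cat l D (seqCons (D l) D') := by
    rw [← cat_succ, cat_shift]
  have hQ : ∀ x y : Fin (N + 2) → K, vdet (seqCons x (seqCons y (cat i A (cat j B (cat k C D))))) =
      vdet (seqCons x (seqCons y Q)) := by
    intro x y
    refine vdet_congr (seqCons_agree (seqCons_agree (cat_agree (cat_agree (cat_agree ?_)))))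
    intro r hr
    rw [cat, if_pos (by omega)]
  have e01 : det4 A B C D (i + 1) (j + 1) k =
      (-1) ^ i * (-1) ^ (i + j) * vdet (seqCons (A i) (seqCons (B j) Q)) := by
    rw [det4, cat_succ, cat_succ, vdet_cat_seqCons_seqCons _ _ (by omega), hQ]
  have e02 : det4 A B C D (i + 1) j (k + 1) =
      (-1) ^ i * (-1) ^ (i + j + k) * vdet (seqCons (A i) (seqCons (C k) Q)) := by
    rw [det4, cat_succ, cat_succ, cat_cat, vdet_cat_seqCons_seqCons _ _ (by omega), ← cat_cat j, hQ,
      add_assoc i]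
  have e12 : det4 A B C D i (j + 1) (k + 1) =
      (-1) ^ (i + j) * (-1) ^ (i + j + k) * vdet (seqCons (B j) (seqCons (C k) Q)) := by
    rw [det4, cat_succ, cat_succ, cat_cat, vdet_cat_seqCons_seqCons _ _ (by omega), ← cat_cat i, hQ]
  have e03 : det4 A B C D (i + 1) j k =
      (-1) ^ i * (-1) ^ (i + j + k + l) * vdet (seqCons (A i) (seqCons (D l) Q)) := by
    rw [det4, cat_succ, hD, cat_cat k, cat_cat j, vdet_cat_seqCons_seqCons _ _ (by omega),
      ← cat_cat j, ← cat_cat k, ← hD, show i + (j + (k + l)) = i + j + k + l by omega]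
  have e13 : det4 A B C D i (j + 1) k =
      (-1) ^ (i + j) * (-1) ^ (i + j + k + l) * vdet (seqCons (B j) (seqCons (D l) Q)) := by
    rw [det4, cat_succ, hD, cat_cat k, cat_cat i, vdet_cat_seqCons_seqCons _ _ (by omega),
      ← cat_cat i, ← cat_cat k, ← hD, show i + j + (k + l) = i + j + k + l by omega]
  have e23 : det4 A B C D i j (k + 1) =
      (-1) ^ (i + j + k) * (-1) ^ (i + j + k + l) * vdet (seqCons (C k) (seqCons (D l) Q)) := by
    rw [det4, cat_succ, hD, cat_cat j, cat_cat i, vdet_cat_seqCons_seqCons _ _ (by omega),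
      ← cat_cat i, ← cat_cat j, ← hD, show i + (j + k) = i + j + k by omega]
  have h01 : vdet (seqCons (A i) (seqCons (B j) Q)) ≠ 0 := by
    intro e
    rw [e01, e, mul_zero] at h0
    exact h0 rfl
  have hP := vdet_pluecker (x2 := C k) (x3 := D l) h01
  rw [e01, e02, e03, e12, e13, e23]
  linear_combination ((-1) ^ i * (-1) ^ (i + j) * (-1) ^ (i + j + k) * (-1) ^ (i + j + k + l)) * hP

variable {M : Type*} [AddCommGroup M] (c : Symbol K M)

/-- The summand of the flag cocycle. -/
def flagTerm (A B C : ℕ → Fin n → K) (i j : ℕ) : M :=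
  c.tri (toUnit (det3 A B C (i + 1) (j + 1))) (toUnit (det3 A B C (i + 1) j))
    (toUnit (det3 A B C i (j + 1)))

/-- The flag cocycle attached to a symbol. -/
def flagCocycle (N : ℕ) (A B C : ℕ → Fin (N + 2) → K) : M :=
  sum3 N fun i j _ => flagTerm c A B C i j

/-- Four sequences in general position. -/
def Generic4 (A B C D : ℕ → Fin n → K) : Prop :=
  ∀ i ≤ n, ∀ j ≤ n, ∀ k ≤ n, det4 A B C D i j k ≠ 0

/-- Three sequences in general position. -/
def Generic3 (A B C : ℕ → Fin n → K) : Prop := ∀ i ≤ n, ∀ j ≤ n, det3 A B C i j ≠ 0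

/-- The minors label the lattice points of a tetrahedron of side `N + 2`, and each lattice point of
side `N` determines an octahedron, whose Plücker relation gives `tri_octahedron`. Summing over all
octahedra, the triangles with a vanishing coordinate give the four cocycle values. The remaining
triangles are the faces of small tetrahedra and cancel by `tri_tetrahedron`. -/
theorem flagCocycle_eq {N : ℕ} {A B C D : ℕ → Fin (N + 2) → K} (h : Generic4 A B C D) :
    flagCocycle c N B C D - flagCocycle c N A C D + flagCocycle c N A B D -
      flagCocycle c N A B C = 0 := by
  set q : ℕ → ℕ → ℕ → Kˣ := fun i j k => toUnit (det4 A B C D i j k) with hq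
  set g0 : ℕ → ℕ → ℕ → ℕ → M := fun i j k _ =>
    c.tri (q i (j + 1) (k + 1)) (q i (j + 1) k) (q i j (k + 1)) with hg0
  set g1 : ℕ → ℕ → ℕ → ℕ → M := fun i j k _ =>
    c.tri (q (i + 1) j (k + 1)) (q (i + 1) j k) (q i j (k + 1)) with hg1
  set g2 : ℕ → ℕ → ℕ → ℕ → M := fun i j k _ =>
    c.tri (q (i + 1) (j + 1) k) (q (i + 1) j k) (q i (j + 1) k) with hg2
  set g3 : ℕ → ℕ → ℕ → ℕ → M := fun i j k _ =>
    c.tri (q (i + 1) (j + 1) k) (q (i + 1) j (k + 1)) (q i (j + 1) (k + 1)) with hg3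
  have hocta : sum4 N g0 - sum4 N g1 + sum4 N g2 - sum4 N g3 = 0 := by
    rw [← sum4_sub, ← sum4_add, ← sum4_sub]
    have : sum4 N (fun _ _ _ _ => (0 : M)) = 0 := by simp [sum4, sum3, sum2]
    rw [← this]
    refine sum4_congr fun i j k l hl => c.tri_octahedron ?_
    simp only [hq]
    rw [toUnit_val (h _ (by omega) _ (by omega) _ (by omega)),
      toUnit_val (h _ (by omega) _ (by omega) _ (by omega)),
      toUnit_val (h _ (by omega) _ (by omega) _ (by omega)),
      toUnit_val (h _ (by omega) _ (by omega) _ (by omega)),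
      toUnit_val (h _ (by omega) _ (by omega) _ (by omega)),
      toUnit_val (h _ (by omega) _ (by omega) _ (by omega))]
    exact det4_pluecker A B C D (by omega) (h _ (by omega) _ (by omega) _ (by omega))
  have f0 : flagCocycle c N B C D = sum3 N (g0 0) := by
    simp only [hg0, hq, det4_zero_fst]
    rfl
  have f1 : flagCocycle c N A C D = sum3 N (fun i k l => g1 i 0 k l) := by
    simp only [hg1, hq, det4_zero_snd]
    rfl
  have f2 : flagCocycle c N A B D = sum3 N (fun i j l => g2 i j 0 l) := by
    simp only [hg2, hq, det4_zero_thd]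
    rfl
  have f3 : flagCocycle c N A B C = sum3 N (fun i j k => g3 i j k 0) := by
    -- On this face the vectors of `A`, `B`, `C` already number `N + 2`, so `D` does not occur in
    -- the minors.
    refine sum3_congr fun i j k hijk => ?_
    simp only [hg3, hq]
    rw [det4_of_add_eq _ _ _ _ (by omega), det4_of_add_eq _ _ _ _ (by omega),
      det4_of_add_eq _ _ _ _ (by omega)]
    rfl
  rw [f0, f1, f2, f3]
  rcases N with _ | N
  · simpa only [sum3_zero, sum4_zero] using hocta
  · rw [sum4_succ_fst, sum4_succ_snd _ g1, sum4_succ_thd _ g2, sum4_succ_fth _ g3] at hocta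
    have ht : sum4 N (fun i j k l => g0 (i + 1) j k l) - sum4 N (fun i j k l => g1 i (j + 1) k l) +
        sum4 N (fun i j k l => g2 i j (k + 1) l) - sum4 N (fun i j k l => g3 i j k (l + 1)) = 0 := by
      rw [← sum4_sub, ← sum4_add, ← sum4_sub]
      have : sum4 N (fun _ _ _ _ => (0 : M)) = 0 := by simp [sum4, sum3, sum2]
      rw [← this]
      exact sum4_congr fun i j k l _ => c.tri_tetrahedron _ _ _ _
    linear_combination (norm := abel) hocta - ht

/-- The action of a matrix on a sequence of vectors. -/
def actSeq (g : GL (Fin n) K) (A : ℕ → Fin n → K) : ℕ → Fin n → K := fun r =>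
  (g : Matrix (Fin n) (Fin n) K) *ᵥ A r

theorem actSeq_one (A : ℕ → Fin n → K) : actSeq 1 A = A := by
  funext r
  rw [actSeq, Units.val_one, Matrix.one_mulVec]

theorem actSeq_mul (g h : GL (Fin n) K) (A : ℕ → Fin n → K) :
    actSeq (g * h) A = actSeq g (actSeq h A) := by
  funext r
  rw [actSeq, actSeq, actSeq, Units.val_mul, Matrix.mulVec_mulVec]

theorem actSeq_cat (g : GL (Fin n) K) (i : ℕ) (A B : ℕ → Fin n → K) :
    actSeq g (cat i A B) = cat i (actSeq g A) (actSeq g B) := by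
  funext r
  simp only [actSeq, cat]
  split_ifs <;> rfl

theorem vdet_actSeq (g : GL (Fin n) K) (A : ℕ → Fin n → K) :
    vdet (actSeq g A) = (GeneralLinearGroup.det g : Kˣ) * vdet A := by
  change _ = (g : Matrix (Fin n) (Fin n) K).det * _
  rw [vdet, vdet, mul_comm, ← Matrix.det_transpose (g : Matrix (Fin n) (Fin n) K), ← Matrix.det_mul]
  congr 1
  ext r k
  simp [actSeq, Matrix.mul_apply, Matrix.mulVec, dotProduct, mul_comm]

theorem det3_actSeq (g : GL (Fin n) K) (A B C : ℕ → Fin n → K) (i j : ℕ) :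
    det3 (actSeq g A) (actSeq g B) (actSeq g C) i j =
      (GeneralLinearGroup.det g : Kˣ) * det3 A B C i j := by
  rw [det3, ← actSeq_cat, ← actSeq_cat, vdet_actSeq, det3]

theorem flagCocycle_actSeq {N : ℕ} (g : GL (Fin (N + 2)) K) {A B C : ℕ → Fin (N + 2) → K}
    (h : Generic3 A B C) :
    flagCocycle c N (actSeq g A) (actSeq g B) (actSeq g C) = flagCocycle c N A B C := by
  refine sum3_congr fun i j k hijk => ?_
  rw [flagTerm, flagTerm]
  simp only [det3_actSeq]
  have hd := (GeneralLinearGroup.det g).ne_zero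
  rw [toUnit_mul hd (h _ (by omega) _ (by omega)), toUnit_mul hd (h _ (by omega) _ (by omega)),
    toUnit_mul hd (h _ (by omega) _ (by omega)), c.tri_mul]

/-- The sequence `A` with the `r`-th term multiplied by `d r`. -/
def scaleSeq (d : ℕ → Kˣ) (A : ℕ → Fin n → K) : ℕ → Fin n → K := fun r => (d r : K) • A r

theorem vdet_scaleSeq (d : ℕ → Kˣ) (A : ℕ → Fin n → K) :
    vdet (scaleSeq d A) = (∏ r ∈ Finset.range n, d r : Kˣ) * vdet A := by
  have h := Matrix.det_mul_column (fun r : Fin n => (d r : K)) (Matrix.of fun r : Fin n => A r)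
  rw [Units.coe_prod, Finset.prod_range]
  exact h

theorem cat_scaleSeq (d : ℕ → Kˣ) {i : ℕ} (A B : ℕ → Fin n → K) :
    cat i (scaleSeq d A) B = scaleSeq (fun r => if r < i then d r else 1) (cat i A B) := by
  funext r
  simp only [cat, scaleSeq]
  split_ifs <;> simp

theorem vdet_cat_scaleSeq (d : ℕ → Kˣ) {i : ℕ} (hi : i ≤ n) (A B : ℕ → Fin n → K) :
    vdet (cat i (scaleSeq d A) B) = (∏ r ∈ Finset.range i, d r : Kˣ) * vdet (cat i A B) := by
  rw [cat_scaleSeq, vdet_scaleSeq, ← Finset.prod_filter]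
  congr 3
  ext r
  simp only [Finset.mem_filter, Finset.mem_range]
  omega

/-- The minor of `i` vectors of `A` and the remaining ones from `B`. -/
def det2 (A B : ℕ → Fin n → K) (i : ℕ) : K := vdet (cat i A B)

/-- The minors with `i + 1` and with `i` vectors of `A` are scaled by factors with quotient `d_i`,
so the term changes by the symbol of `d_i` with a quotient of consecutive minors in `j`. -/
theorem flagTerm_scaleSeq (d : ℕ → Kˣ) {A B C : ℕ → Fin n → K} (h : Generic3 A B C) {i j : ℕ}
    (hi : i + 1 ≤ n) (hj : j + 1 ≤ n) :
    flagTerm c (scaleSeq d A) B C i j = flagTerm c A B C i j +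
      (c (d i) (toUnit (det3 A B C (i + 1) j)) - c (d i) (toUnit (det3 A B C (i + 1) (j + 1)))) := by
  have e : ∀ i' ≤ n, ∀ j' ≤ n, toUnit (det3 (scaleSeq d A) B C i' j') =
      (∏ r ∈ Finset.range i', d r) * toUnit (det3 A B C i' j') := by
    intro i' hi' j' hj'
    rw [det3, vdet_cat_scaleSeq d hi', ← det3, toUnit_mul (Units.ne_zero _) (h _ hi' _ hj'),
      toUnit_unit]
  rw [flagTerm, e _ hi _ hj, e _ hi _ (by omega), e _ (by omega) _ hj, c.tri_mul_mul, flagTerm,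
    Finset.prod_range_succ, mul_comm (∏ r ∈ Finset.range i, d r), mul_inv_cancel_right, c.mul_right,
    c.inv_right, sub_eq_add_neg]

theorem sum3_eq_range (N : ℕ) (f : ℕ → ℕ → M) :
    sum3 N (fun i j _ => f i j) =
      ∑ i ∈ Finset.range (N + 1), ∑ j ∈ Finset.range (N - i + 1), f i j := by
  rw [sum3, Finset.Nat.sum_antidiagonal_eq_sum_range_succ_mk]
  refine Finset.sum_congr rfl fun i _ => ?_
  rw [sum2, Finset.Nat.sum_antidiagonal_eq_sum_range_succ_mk]

/-- The corrections telescope in `j`. Only the end terms survive, and they are minors of `A` with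
`C` alone and of `A` with `B` alone. This makes the potential of a diagonal matrix explicit. -/
theorem flagCocycle_scaleSeq {N : ℕ} (d : ℕ → Kˣ) {A B C : ℕ → Fin (N + 2) → K}
    (h : Generic3 A B C) :
    flagCocycle c N (scaleSeq d A) B C - flagCocycle c N A B C =
      (∑ i ∈ Finset.range (N + 1), c (d i) (toUnit (det2 A C (i + 1)))) -
        ∑ i ∈ Finset.range (N + 1), c (d i) (toUnit (det2 A B (i + 1))) := by
  rw [flagCocycle, flagCocycle, sum3_eq_range, sum3_eq_range, ← Finset.sum_sub_distrib,
    ← Finset.sum_sub_distrib]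
  refine Finset.sum_congr rfl fun i hi => ?_
  have hi' := Finset.mem_range.1 hi
  have e : ∀ j ∈ Finset.range (N - i + 1), flagTerm c (scaleSeq d A) B C i j =
      flagTerm c A B C i j + (c (d i) (toUnit (det3 A B C (i + 1) j)) -
        c (d i) (toUnit (det3 A B C (i + 1) (j + 1)))) := by
    intro j hj
    have := Finset.mem_range.1 hj
    exact flagTerm_scaleSeq c d h (by omega) (by omega)
  rw [Finset.sum_congr rfl e, Finset.sum_add_distrib, add_sub_cancel_left, Finset.sum_range_sub']
  have e1 : det3 A B C (i + 1) 0 = det2 A C (i + 1) := by rw [det3, cat_zero, det2]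
  have e2 : det3 A B C (i + 1) (N - i + 1) = det2 A B (i + 1) := by
    rw [det3, det2]
    refine vdet_congr (cat_agree fun r hr => ?_)
    rw [cat, if_pos (by omega)]
  rw [e1, e2]

end Flags

end

section

/-! ### The Zariski filter -/

section Zariski

variable {K : Type u} [Field K] {n : ℕ}

variable (K n) in
/-- The filter of sets of sequences of vectors that contain the non-vanishing locus of a nonzero
polynomial in the coordinates. -/
def zariski : Filter (ℕ → Fin n → K) where
  sets := {U | ∃ P : MvPolynomial (ℕ × Fin n) K, P ≠ 0 ∧
    ∀ z : ℕ → Fin n → K, MvPolynomial.eval (fun p => z p.1 p.2) P ≠ 0 → z ∈ U}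
  univ_sets := ⟨1, one_ne_zero, fun _ _ => trivial⟩
  sets_of_superset := by
    rintro U V ⟨P, hP, hU⟩ hUV
    exact ⟨P, hP, fun z hz => hUV (hU z hz)⟩
  inter_sets := by
    rintro U V ⟨P, hP, hU⟩ ⟨Q, hQ, hV⟩
    refine ⟨P * Q, mul_ne_zero hP hQ, fun z hz => ?_⟩
    rw [map_mul] at hz
    exact ⟨hU z (left_ne_zero_of_mul hz), hV z (right_ne_zero_of_mul hz)⟩

theorem eventually_zariski {p : (ℕ → Fin n → K) → Prop} (P : MvPolynomial (ℕ × Fin n) K)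
    {z₀ : ℕ → Fin n → K} (h0 : MvPolynomial.eval (fun p => z₀ p.1 p.2) P ≠ 0)
    (h : ∀ z : ℕ → Fin n → K, MvPolynomial.eval (fun p => z p.1 p.2) P ≠ 0 → p z) :
    ∀ᶠ z in zariski K n, p z :=
  ⟨P, by rintro rfl; exact h0 (map_zero _), h⟩

theorem exists_eval_ne_zero [Infinite K] {P : MvPolynomial (ℕ × Fin n) K} (hP : P ≠ 0) :
    ∃ z : ℕ → Fin n → K, MvPolynomial.eval (fun p => z p.1 p.2) P ≠ 0 := by
  by_contra! h
  refine hP (MvPolynomial.funext fun x => ?_)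
  rw [map_zero]
  exact h fun i j => x (i, j)

instance [Infinite K] : (zariski K n).NeBot := by
  rw [Filter.neBot_iff]
  intro h
  obtain ⟨P, hP, hU⟩ : (∅ : Set (ℕ → Fin n → K)) ∈ zariski K n := by
    rw [h]
    exact Filter.mem_bot
  obtain ⟨z, hz⟩ := exists_eval_ne_zero hP
  exact hU z hz

/-- The determinant is polynomial in `z`, and it is not the zero polynomial because it takes the
value `vdet u` at the tail of `u`. -/
theorem eventually_vdet_cat (m : ℕ) {u : ℕ → Fin n → K} (h : vdet u ≠ 0) :
    ∀ᶠ z in zariski K n, vdet (cat m u z) ≠ 0 := by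
  have he : ∀ z : ℕ → Fin n → K, MvPolynomial.eval (fun p => z p.1 p.2)
      (Matrix.det (Matrix.of fun r k : Fin n => if (r : ℕ) < m then MvPolynomial.C (u r k) else
        MvPolynomial.X ((r : ℕ) - m, k))) = vdet (cat m u z) := by
    intro z
    rw [RingHom.map_det, vdet]
    congr 1
    ext r k
    simp only [RingHom.mapMatrix_apply, Matrix.map_apply, Matrix.of_apply, cat]
    split_ifs <;> simp
  refine eventually_zariski _ (z₀ := fun r => u (r + m)) ?_ (fun z hz => (he z).symm.trans_ne hz)
  have e := he fun r => u (r + m)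
  rw [cat_shift] at e
  rw [e]
  exact h

theorem tendsto_actSeq [Infinite K] (g : GL (Fin n) K) :
    Filter.Tendsto (actSeq g) (zariski K n) (zariski K n) := by
  rintro U ⟨P, hP, hU⟩
  have he : ∀ z : ℕ → Fin n → K, MvPolynomial.eval (fun p => z p.1 p.2)
      (MvPolynomial.bind₁ (fun p : ℕ × Fin n => ∑ k, MvPolynomial.C ((g : Matrix _ _ K) p.2 k) *
        MvPolynomial.X (p.1, k)) P) = MvPolynomial.eval (fun p => actSeq g z p.1 p.2) P := by
    intro z
    rw [MvPolynomial.eval, MvPolynomial.eval₂Hom_bind₁]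
    congr 2
    funext p
    simp [actSeq, Matrix.mulVec, dotProduct]
  obtain ⟨z₀, hz₀⟩ := exists_eval_ne_zero hP
  refine eventually_zariski _ (z₀ := actSeq g⁻¹ z₀) ?_ (fun z hz => hU _ ((he z).symm.trans_ne hz))
  rw [he, ← actSeq_mul, mul_inv_cancel, actSeq_one]
  exact hz₀

theorem eventually_det2 {A : ℕ → Fin n → K} (hA : vdet A ≠ 0) :
    ∀ᶠ B in zariski K n, ∀ i ≤ n, det2 A B i ≠ 0 := by
  have := (Filter.eventually_all_finset (Finset.range (n + 1)) (l := zariski K n)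
    (p := fun i B => det2 A B i ≠ 0)).2 fun i _ => eventually_vdet_cat i hA
  exact this.mono fun B hB i hi => hB i (Finset.mem_range_succ_iff.2 hi)

theorem eventually_generic3 {A B : ℕ → Fin n → K} (h : ∀ i ≤ n, det2 A B i ≠ 0) :
    ∀ᶠ C in zariski K n, Generic3 A B C := by
  have := (Filter.eventually_all_finset (Finset.range (n + 1) ×ˢ Finset.range (n + 1))
    (l := zariski K n) (p := fun i C => det3 A B C i.1 i.2 ≠ 0)).2 fun i hi => by
      simp only [det3, cat_cat]
      exact eventually_vdet_cat _ (h i.1 (Finset.mem_range_succ_iff.1 (Finset.mem_product.1 hi).1))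
  exact this.mono fun C hC i hi j hj => hC (i, j) (Finset.mem_product.2
    ⟨Finset.mem_range_succ_iff.2 hi, Finset.mem_range_succ_iff.2 hj⟩)

theorem eventually_generic4 {A B C : ℕ → Fin n → K} (h : Generic3 A B C) :
    ∀ᶠ D in zariski K n, Generic4 A B C D := by
  have := (Filter.eventually_all_finset
    (Finset.range (n + 1) ×ˢ Finset.range (n + 1) ×ˢ Finset.range (n + 1))
    (l := zariski K n) (p := fun i D => det4 A B C D i.1 i.2.1 i.2.2 ≠ 0)).2 fun i hi => by
      simp only [Finset.mem_product, Finset.mem_range_succ_iff] at hi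
      simp only [det4, cat_cat]
      refine eventually_vdet_cat _ ?_
      have := h i.1 hi.1 i.2.1 hi.2.1
      rwa [det3, cat_cat] at this
  exact this.mono fun D hD i hi j hj k hk => hD (i, j, k) (by
    simp only [Finset.mem_product, Finset.mem_range_succ_iff]
    exact ⟨hi, hj, hk⟩)

theorem eventually_eventually_generic3 {A : ℕ → Fin n → K} (hA : vdet A ≠ 0) :
    ∀ᶠ B in zariski K n, ∀ᶠ C in zariski K n, Generic3 A B C :=
  (eventually_det2 hA).mono fun _ hB => eventually_generic3 hB

theorem eventually_eventually_eventually_generic4 {A : ℕ → Fin n → K} (hA : vdet A ≠ 0) :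
    ∀ᶠ B in zariski K n, ∀ᶠ C in zariski K n, ∀ᶠ D in zariski K n, Generic4 A B C D :=
  (eventually_eventually_generic3 hA).mono fun _ hB => hB.mono fun _ hC => eventually_generic4 hC

end Zariski

/-! ### The central extension of `GL_n(K)` attached to a symbol -/

section Potentials

variable {K A : Type u} [Field K] [AddCommGroup A] {N : ℕ}

/-- The sequence that starts with the standard basis. -/
def stdSeq (K : Type u) [Field K] (n : ℕ) : ℕ → Fin n → K := fun r k => if (k : ℕ) = r then 1 else 0

theorem vdet_stdSeq (n : ℕ) : vdet (stdSeq K n) = 1 := by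
  rw [vdet, ← Matrix.det_one (n := Fin n)]
  congr 1
  ext r k
  simp [stdSeq, Matrix.one_apply, Fin.ext_iff, eq_comm]

theorem vdet_actSeq_stdSeq {n : ℕ} (g : GL (Fin n) K) : vdet (actSeq g (stdSeq K n)) ≠ 0 := by
  rw [vdet_actSeq, vdet_stdSeq, mul_one]
  exact Units.ne_zero _

/-- The variation of the flag cocycle under a change of base point. -/
def variation (c : Symbol K A) (g : GL (Fin (N + 2)) K) (z z' : ℕ → Fin (N + 2) → K) : A :=
  flagCocycle c N (actSeq g (stdSeq K (N + 2))) z z' - flagCocycle c N (stdSeq K (N + 2)) z z'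

/-- A function whose differences are given by the variation of the flag cocycle. -/
def IsPotential (c : Symbol K A) (g : GL (Fin (N + 2)) K)
    (F : (ℕ → Fin (N + 2) → K) → Multiplicative A) : Prop :=
  ∀ᶠ z in zariski K (N + 2), ∀ᶠ z' in zariski K (N + 2),
    (F z).toAdd - (F z').toAdd = variation c g z z'

variable (c : Symbol K A)

/-- The flag cocycle is invariant under the simultaneous action of `h`. This identity makes the
pairs of a matrix and a potential closed under multiplication and inversion. -/
theorem variation_act (g h : GL (Fin (N + 2)) K) :
    ∀ᶠ z in zariski K (N + 2), ∀ᶠ z' in zariski K (N + 2),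
      variation c g (actSeq h z) (actSeq h z') = variation c (h⁻¹ * g) z z' - variation c h⁻¹ z z' := by
  have h1 := eventually_eventually_generic3 (vdet_actSeq_stdSeq (h⁻¹ * g))
  have h2 := eventually_eventually_generic3 (vdet_actSeq_stdSeq h⁻¹)
  refine (h1.and h2).mono fun z hz => (hz.1.and hz.2).mono fun z' hz' => ?_
  have e1 := flagCocycle_actSeq c h hz'.1
  have e2 := flagCocycle_actSeq c h hz'.2
  rw [← actSeq_mul, mul_inv_cancel_left] at e1
  rw [← actSeq_mul, mul_inv_cancel, actSeq_one] at e2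
  simp only [variation]
  rw [e1, e2]
  abel

/-- The germ of a function. -/
def toGerm {K A : Type u} [Field K] {n : ℕ} (F : (ℕ → Fin n → K) → Multiplicative A) :
    Filter.Germ (zariski K n) (Multiplicative A) := Filter.Germ.ofFun F

theorem toGerm_eq {K A : Type u} [Field K] {n : ℕ} {F H : (ℕ → Fin n → K) → Multiplicative A} :
    toGerm F = toGerm H ↔ ∀ᶠ z in zariski K n, F z = H z := Filter.Germ.coe_eq

theorem isPotential_const (a : Multiplicative A) :
    IsPotential c (1 : GL (Fin (N + 2)) K) fun _ => a :=
  Filter.Eventually.of_forall fun z => Filter.Eventually.of_forall fun z' => by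
    rw [variation, actSeq_one, sub_self, sub_self]

theorem actSeq_diagGL (d : ℕ → Kˣ) (n : ℕ) :
    actSeq (diagGL fun i : Fin n => d i) (stdSeq K n) = scaleSeq d (stdSeq K n) := by
  funext r k
  rw [actSeq, diagGL_val, Matrix.mulVec_diagonal, scaleSeq, Pi.smul_apply, smul_eq_mul, stdSeq]
  split_ifs with h
  · rw [h]
  · rw [mul_zero, mul_zero]

/-- The potential of a diagonal matrix. -/
def diagPotential (N : ℕ) (d : ℕ → Kˣ) (z : ℕ → Fin (N + 2) → K) : Multiplicative A :=
  Multiplicative.ofAdd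
    (-∑ i ∈ Finset.range (N + 1), c (d i) (toUnit (det2 (stdSeq K (N + 2)) z (i + 1))))

theorem isPotential_diag (N : ℕ) (d : ℕ → Kˣ) :
    IsPotential c (diagGL fun i : Fin (N + 2) => d i) (diagPotential c N d) := by
  refine (eventually_eventually_generic3 (A := stdSeq K (N + 2))
    (by rw [vdet_stdSeq]; exact one_ne_zero)).mono fun z hz => hz.mono fun z' hz' => ?_
  rw [variation, actSeq_diagGL, flagCocycle_scaleSeq c d hz', diagPotential, diagPotential,
    toAdd_ofAdd, toAdd_ofAdd]
  abel

theorem det2_actSeq_diagGL (d : ℕ → Kˣ) {n i : ℕ} (hi : i ≤ n) (z : ℕ → Fin n → K) :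
    det2 (stdSeq K n) (actSeq (diagGL fun i : Fin n => d i)⁻¹ z) i =
      ((∏ r ∈ Finset.range n, d r)⁻¹ * ∏ r ∈ Finset.range i, d r : Kˣ) *
        det2 (stdSeq K n) z i := by
  set g := diagGL fun i : Fin n => d i with hg
  have h1 := vdet_actSeq g (cat i (stdSeq K n) (actSeq g⁻¹ z))
  rw [actSeq_cat, ← actSeq_mul, mul_inv_cancel, actSeq_one, hg, actSeq_diagGL,
    vdet_cat_scaleSeq d hi, ← hg] at h1
  have h2 : GeneralLinearGroup.det g = ∏ r ∈ Finset.range n, d r := by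
    apply Units.ext
    change Matrix.det (g : Matrix (Fin n) (Fin n) K) = _
    rw [hg, diagGL_val, Matrix.det_diagonal, Units.coe_prod, Finset.prod_range]
  rw [h2] at h1
  rw [Units.val_mul, mul_assoc, det2, det2, h1, Units.inv_mul_cancel_left]

/-- Translation by a diagonal matrix multiplies the relevant minors by constants, so it changes the
potential by a constant of `A`. Comparing these constants for two diagonal matrices gives the
commutator of their lifts. -/
theorem diagPotential_act (N : ℕ) (d d' : ℕ → Kˣ) :
    ∀ᶠ z in zariski K (N + 2),
      diagPotential c N d' (actSeq (diagGL fun i : Fin (N + 2) => d i)⁻¹ z) =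
        Multiplicative.ofAdd (-∑ i ∈ Finset.range (N + 1), c (d' i)
          ((∏ r ∈ Finset.range (N + 2), d r)⁻¹ * ∏ r ∈ Finset.range (i + 1), d r)) *
        diagPotential c N d' z := by
  refine (eventually_det2 (A := stdSeq K (N + 2))
    (by rw [vdet_stdSeq]; exact one_ne_zero)).mono fun z hz => ?_
  rw [diagPotential, diagPotential, ← ofAdd_add, ← neg_add, ← Finset.sum_add_distrib]
  congr 2
  refine Finset.sum_congr rfl fun i hi => ?_
  have hi' := Finset.mem_range.1 hi
  rw [det2_actSeq_diagGL d (by omega), toUnit_mul (Units.ne_zero _) (hz _ (by omega)), toUnit_unit,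
    c.mul_right]

variable [Infinite K]

/-- Fix a generic `w` and take the negative of the variation from `w` to `z`. The difference of the
cocycle identities for the moved and for the original base point says that this is a potential. -/
theorem exists_isPotential (g : GL (Fin (N + 2)) K) : ∃ F, IsPotential c g F := by
  have h1 := eventually_eventually_eventually_generic4 (vdet_actSeq_stdSeq g)
  have h2 := eventually_eventually_eventually_generic4 (A := stdSeq K (N + 2))
    (by rw [vdet_stdSeq]; exact one_ne_zero)
  obtain ⟨w, hw, hw'⟩ := (h1.and h2).exists
  refine ⟨fun z => Multiplicative.ofAdd (-variation c g w z), ?_⟩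
  refine (hw.and hw').mono fun z hz => (hz.1.and hz.2).mono fun z' hz' => ?_
  have e1 := flagCocycle_eq c hz'.1
  have e2 := flagCocycle_eq c hz'.2
  simp only [toAdd_ofAdd, variation]
  linear_combination (norm := abel) e1 - e2

/-- The action of `GL_n(K)` on germs of functions. -/
def germAct (A : Type u) [AddCommGroup A] (n : ℕ) :
    GL (Fin n) K →* Monoid.End (Filter.Germ (zariski K n) (Multiplicative A)) where
  toFun g := MonoidHom.mk' (fun f => f.compTendsto (actSeq g⁻¹) (tendsto_actSeq g⁻¹))
    (fun f f' => f.inductionOn₂ f' fun _ _ => rfl)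
  map_one' := by
    ext f
    refine f.inductionOn fun F => ?_
    change toGerm (F ∘ actSeq 1⁻¹) = toGerm F
    rw [inv_one]
    congr 1
    funext z
    rw [Function.comp_apply, actSeq_one]
  map_mul' g h := by
    ext f
    refine f.inductionOn fun F => ?_
    change toGerm (F ∘ actSeq (g * h)⁻¹) = toGerm ((F ∘ actSeq h⁻¹) ∘ actSeq g⁻¹)
    congr 1
    funext z
    rw [Function.comp_apply, _root_.mul_inv_rev, actSeq_mul]
    rfl

/-- The group of germs of functions on flags, extended by `GL_n(K)`. -/
abbrev GermGroup (K A : Type u) [Field K] [Infinite K] [AddCommGroup A] (n : ℕ) : Type u :=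
  Filter.Germ (zariski K n) (Multiplicative A) ⋊[autOfEnd (germAct (K := K) A n)] GL (Fin n) K

/-- The central extension of `GL_n(K)` attached to a symbol. -/
def symbolCover (N : ℕ) : Subgroup (GermGroup K A (N + 2)) where
  carrier := {e | ∃ F, e.left = toGerm F ∧ IsPotential c e.right F}
  one_mem' := by
    refine ⟨fun _ => 1, rfl, Filter.Eventually.of_forall fun z => Filter.Eventually.of_forall
      fun z' => ?_⟩
    rw [SemidirectProduct.one_right, variation, actSeq_one, sub_self, sub_self]
  mul_mem' := by
    rintro ⟨_, g⟩ ⟨_, h⟩ ⟨F, rfl, hF⟩ ⟨H, rfl, hH⟩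
    -- By `variation_act` the translate of `H` contributes the variation of `gh` minus that of `g`,
    -- and `F` contributes the latter.
    refine ⟨fun z => F z * H (actSeq g⁻¹ z), rfl, ?_⟩
    have h1 := (tendsto_actSeq g⁻¹).eventually hH
    refine (hF.and (h1.and (variation_act c h g⁻¹))).mono fun z hz => ?_
    refine (hz.1.and (((tendsto_actSeq g⁻¹).eventually hz.2.1).and hz.2.2)).mono fun z' hz' => ?_
    obtain ⟨e1, e2, e3⟩ := hz'
    rw [e3, inv_inv] at e2
    rw [toAdd_mul, toAdd_mul, add_sub_add_comm, e1, e2, add_sub_cancel]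
    rfl
  inv_mem' := by
    rintro ⟨_, g⟩ ⟨F, rfl, hF⟩
    refine ⟨fun z => (F (actSeq g z))⁻¹, ?_, ?_⟩
    · change toGerm (fun z => (F (actSeq g⁻¹⁻¹ z))⁻¹) = _
      rw [inv_inv]
    have h1 := (tendsto_actSeq g).eventually hF
    refine (h1.and (variation_act c g g)).mono fun z hz => ?_
    refine (((tendsto_actSeq g).eventually hz.1).and hz.2).mono fun z' hz' => ?_
    obtain ⟨e1, e2⟩ := hz'
    have e3 : variation c (1 : GL (Fin (N + 2)) K) z z' = 0 := by
      rw [variation, actSeq_one, sub_self]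
    rw [e2, inv_mul_cancel, e3, zero_sub] at e1
    rw [toAdd_inv, toAdd_inv, neg_sub_neg, ← neg_sub, e1, neg_neg]
    rfl

/-- The projection to `GL_n(K)`. -/
def symbolCoverProj (N : ℕ) : symbolCover c N →* GL (Fin (N + 2)) K :=
  SemidirectProduct.rightHom.comp (symbolCover c N).subtype

theorem symbolCover_ext {x y : symbolCover c N} (h1 : x.1.left = y.1.left)
    (h2 : symbolCoverProj c N x = symbolCoverProj c N y) : x = y :=
  Subtype.ext (SemidirectProduct.ext h1 h2)

/-- An element of the central extension given by a potential. -/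
def ofPotential {g : GL (Fin (N + 2)) K} {F : (ℕ → Fin (N + 2) → K) → Multiplicative A}
    (h : IsPotential c g F) : symbolCover c N :=
  ⟨⟨toGerm F, g⟩, F, rfl, h⟩

theorem ofPotential_mul {g g' : GL (Fin (N + 2)) K}
    {F F' : (ℕ → Fin (N + 2) → K) → Multiplicative A}
    (h : IsPotential c g F) (h' : IsPotential c g' F') :
    (ofPotential c h * ofPotential c h').1.left = toGerm fun z => F z * F' (actSeq g⁻¹ z) := rfl

theorem exists_eq_ofPotential (x : symbolCover c N) :
    ∃ (g : GL (Fin (N + 2)) K) (F : (ℕ → Fin (N + 2) → K) → Multiplicative A)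
      (h : IsPotential c g F), x = ofPotential c h := by
  obtain ⟨⟨l, g⟩, F, h1, hF⟩ := x
  change l = toGerm F at h1
  subst h1
  exact ⟨g, F, hF, rfl⟩

/-- The inclusion of constants. -/
def symbolCoverConst (N : ℕ) : Multiplicative A →* symbolCover c N where
  toFun a := ofPotential c (isPotential_const c a)
  map_one' := rfl
  map_mul' a b := symbolCover_ext c rfl (by
    rw [map_mul]
    exact (mul_one 1).symm)

theorem symbolCoverConst_injective (N : ℕ) : Function.Injective (symbolCoverConst c N) := by
  intro a b h
  have h1 : toGerm (fun _ : ℕ → Fin (N + 2) → K => a) = toGerm fun _ => b :=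
    congrArg (fun x : symbolCover c N => x.1.left) h
  obtain ⟨z, hz⟩ := (toGerm_eq.1 h1).exists
  exact hz

theorem symbolCoverConst_mem_center (N : ℕ) (a : Multiplicative A) :
    symbolCoverConst c N a ∈ Subgroup.center (symbolCover c N) := by
  rw [Subgroup.mem_center_iff]
  intro x
  obtain ⟨g, F, hF, rfl⟩ := exists_eq_ofPotential c x
  refine symbolCover_ext c ?_ ?_
  · change (ofPotential c hF * ofPotential c (isPotential_const c a)).1.left =
      (ofPotential c (isPotential_const c a) * ofPotential c hF).1.left
    rw [ofPotential_mul, ofPotential_mul]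
    congr 1
    funext z
    rw [inv_one, actSeq_one, mul_comm]
  · change g * 1 = 1 * g
    rw [mul_one, one_mul]

/-- The variation of the identity matrix is zero, so its potentials are generically constant; the
value at one generic point is the constant. -/
theorem exists_const_of_proj_eq_one {x : symbolCover c N} (h : symbolCoverProj c N x = 1) :
    ∃ a, x = symbolCoverConst c N a := by
  obtain ⟨g, F, hF, rfl⟩ := exists_eq_ofPotential c x
  obtain rfl : g = 1 := h
  obtain ⟨z, hz⟩ := hF.exists
  refine ⟨F z, symbolCover_ext c (toGerm_eq.2 (hz.mono fun z' hz' => ?_)) rfl⟩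
  rw [variation, actSeq_one, sub_self, sub_eq_zero] at hz'
  exact (Multiplicative.toAdd.injective hz').symm

theorem isCentralCover_symbolCover (N : ℕ) : IsCentralCover (symbolCoverProj c N) where
  surjective g := by
    obtain ⟨F, hF⟩ := exists_isPotential c g
    exact ⟨ofPotential c hF, rfl⟩
  mem_center z hz := by
    obtain ⟨a, rfl⟩ := exists_const_of_proj_eq_one c hz
    exact symbolCoverConst_mem_center c N a

/-- The commutator of lifts of `diag(t, 1, 1, …)` and `diag(u, u⁻¹, 1, …)`. -/
theorem commutator_diag (N : ℕ) (t u : Kˣ) {x y : symbolCover c N}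
    (hx : symbolCoverProj c N x = diagGL fun i => if (i : ℕ) = 0 then t else 1)
    (hy : symbolCoverProj c N y =
      diagGL fun i => if (i : ℕ) = 0 then u else if (i : ℕ) = 1 then u⁻¹ else 1) :
    ⁅x, y⁆ = symbolCoverConst c N (Multiplicative.ofAdd (c t u)) := by
  set d : ℕ → Kˣ := fun i => if i = 0 then t else 1 with hd
  set d' : ℕ → Kˣ := fun i => if i = 0 then u else if i = 1 then u⁻¹ else 1 with hd'
  rw [(isCentralCover_symbolCover c N).commutator_eq
    (g' := ofPotential c (isPotential_diag c N d)) (h' := ofPotential c (isPotential_diag c N d'))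
    hx hy, commutatorElement_def, mul_inv_eq_iff_eq_mul, mul_inv_eq_iff_eq_mul]
  have p1 : ∀ m, ∏ r ∈ Finset.range (m + 1), d r = t := by
    intro m
    rw [Finset.prod_range_succ', Finset.prod_eq_one (fun i _ => by simp [hd])]
    simp [hd]
  have p2 : ∀ m, ∏ r ∈ Finset.range (m + 2), d' r = 1 := by
    intro m
    rw [Finset.prod_range_succ', Finset.prod_range_succ',
      Finset.prod_eq_one (fun i _ => by simp [hd'])]
    simp [hd']
  -- All nonempty initial products of `d` equal `t`, so nothing remains here. For `d'` only the
  -- product of length one, equal to `u`, differs from `1`, so the other translation contributes `c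
  -- t u`.
  have s1 : ∑ i ∈ Finset.range (N + 1), c (d' i)
      ((∏ r ∈ Finset.range (N + 2), d r)⁻¹ * ∏ r ∈ Finset.range (i + 1), d r) = 0 := by
    refine Finset.sum_eq_zero fun i _ => ?_
    rw [p1, p1, inv_mul_cancel, c.one_right]
  have s2 : ∑ i ∈ Finset.range (N + 1), c (d i)
      ((∏ r ∈ Finset.range (N + 2), d' r)⁻¹ * ∏ r ∈ Finset.range (i + 1), d' r) = c t u := by
    rw [Finset.sum_range_succ', Finset.sum_eq_zero (fun i _ => by simp [hd, c.one_left]), p2]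
    simp [hd, hd']
  have a1 := diagPotential_act c N d d'
  have a2 := diagPotential_act c N d' d
  rw [s1] at a1
  rw [s2] at a2
  refine symbolCover_ext c ?_ ?_
  · change toGerm (fun z => diagPotential c N d z *
        diagPotential c N d' (actSeq (diagGL fun i : Fin (N + 2) => d i)⁻¹ z)) =
      toGerm (fun z => (Multiplicative.ofAdd (c t u) *
        diagPotential c N d' (actSeq 1⁻¹ z)) *
          diagPotential c N d (actSeq (1 * diagGL fun i : Fin (N + 2) => d' i)⁻¹ z))
    refine toGerm_eq.2 ((a1.and a2).mono fun z hz => ?_)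
    rw [one_mul, hz.1, hz.2, inv_one, actSeq_one, neg_zero, ofAdd_zero, one_mul, ofAdd_neg]
    rw [mul_mul_mul_comm, mul_inv_cancel, one_mul, mul_comm]
  · change (diagGL fun i : Fin (N + 2) => d i) * (diagGL fun i : Fin (N + 2) => d' i) =
      1 * (diagGL fun i : Fin (N + 2) => d' i) * (diagGL fun i : Fin (N + 2) => d i)
    rw [one_mul, ← map_mul, ← map_mul, mul_comm]

end Potentials

end

section

/-! ### From symbols to homomorphisms of `K_2` -/

namespace IsCentralCover

variable {K : Type u} [Field K] {n : ℕ} {E : Type*} [Group E] {p : E →* GL (Fin n) K}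

theorem map_rankOne_h (hp : IsCentralCover p) [Infinite K] (i j : Fin n) (h : i ≠ j) (u : Kˣ) :
    p ((hp.rankOne i j h).h u) =
      diagGL fun k => if k = i then u else if k = j then u⁻¹ else 1 := by
  have hij : (i : ℕ) ≠ j := fun e => h (Fin.ext e)
  have e1 : blockGL K n (p ((hp.rankOne i j h).h u)) =
      toGLinf K ((rankOneS (i : ℕ) j hij).h (u : K)) := by
    simp only [RankOne.h, RankOne.w, rankOne, rankOneS, map_mul, map_rootLift, blockGL_elemGL]
  apply blockGL_injective
  rw [e1]
  apply Units.ext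
  apply Finsupp.lhom_ext
  intro k b
  rw [(isMono_h (i : ℕ) j hij u).apply_single, blockGL_diagGL_single, mul_comm]
  congr 2
  simp only [extendDiag]
  split_ifs with h1 h2 h3 h4 h5 h6 h7 h8 <;> first | rfl | (exfalso; simp_all [Fin.ext_iff])

end IsCentralCover

variable {K A : Type u} [Field K] [AddCommGroup A] [Infinite K] (c : Symbol K A)

/-- The symbol of the central extension attached to `c` is `c`. -/
theorem rankOne_symbolCover_sym (N : ℕ) (u v : Kˣ) :
    ((isCentralCover_symbolCover c N).rankOne 0 1 zero_ne_one).sym u v =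
      symbolCoverConst c N (Multiplicative.ofAdd (c u v)) := by
  set hp := isCentralCover_symbolCover c N
  -- The commutator of a lift `τ` of `diag(v, 1, …)` with `h(u)` is the inverse of the symbol by
  -- `torus_commutator_h`, and the constant `c v u` by `commutator_diag`; antisymmetry of `c` gives
  -- the claim.
  obtain ⟨τ, hτ⟩ := hp.surjective (diagGL fun i => if (i : ℕ) = 0 then v else 1)
  have e : ((if ((0 : Fin (N + 2)) : ℕ) = 0 then v else 1) /
      (if ((1 : Fin (N + 2)) : ℕ) = 0 then v else 1) : Kˣ) = v := by
    simp
  have hx := hp.rankOne_torus_x 0 1 zero_ne_one hτ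
  have hy := hp.rankOne_torus_y 0 1 zero_ne_one hτ
  rw [e] at hx hy
  have h1 := (hp.rankOne 0 1 zero_ne_one).torus_commutator_h hx hy u
  rw [commutator_diag c N v u hτ ?_] at h1
  · rw [← _root_.inv_inj, ← h1, ← map_inv, ← ofAdd_neg, c.swap v u]
  · rw [hp.map_rankOne_h]
    congr 1
    funext k
    simp only [Fin.ext_iff, Fin.val_zero, Fin.val_one]

/-- The images of the generators of the Steinberg group in the finite central extensions. -/
def genLift (N : ℕ) (g : Gen K) : symbolCover c N :=
  if h : g.i < N + 2 ∧ g.j < N + 2 then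
    (isCentralCover_symbolCover c N).rootLift ⟨g.i, h.1⟩ ⟨g.j, h.2⟩
      (fun e => g.ne (congrArg Fin.val e)) g.a
  else 1

/-- The homomorphism from the free group given by `genLift`. -/
def freeLift (N : ℕ) : FreeGroup (Gen K) →* symbolCover c N := FreeGroup.lift (genLift c N)

theorem freeLift_x {N i j : ℕ} (h : i ≠ j) (hi : i < N + 2) (hj : j < N + 2) (a : K) :
    freeLift c N (x i j h a) =
      (isCentralCover_symbolCover c N).rootLift ⟨i, hi⟩ ⟨j, hj⟩
        (fun e => h (congrArg Fin.val e)) a := by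
  rw [freeLift, x, FreeGroup.lift_apply_of, genLift, dif_pos ⟨hi, hj⟩]

/-- A relator involves finitely many indices, so for large `N` it is one of the Steinberg relations
between canonical lifts. -/
theorem eventually_freeLift_rel {r : FreeGroup (Gen K)} (hr : r ∈ Rels K) :
    ∀ᶠ N in Filter.atTop, freeLift c N r = 1 := by
  obtain ⟨i, j, h, a, b⟩ | ⟨i, j, k, hij, hjk, hik, a, b⟩ |
    ⟨i, j, k, l, hij, hkl, hjk, hil, a, b⟩ := hr
  · filter_upwards [Filter.eventually_ge_atTop (i + j)] with N hN
    rw [map_mul, map_mul, map_inv, freeLift_x c h (by omega) (by omega),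
      freeLift_x c h (by omega) (by omega), freeLift_x c h (by omega) (by omega),
      IsCentralCover.rootLift_add, mul_inv_cancel]
  · filter_upwards [Filter.eventually_ge_atTop (i + j + k)] with N hN
    rw [map_mul, map_commutatorElement, map_inv, freeLift_x c hij (by omega) (by omega),
      freeLift_x c hjk (by omega) (by omega), freeLift_x c hik (by omega) (by omega),
      IsCentralCover.rootLift_commutator _ _ _ _ _ _ (fun e => hik (congrArg Fin.val e)),
      mul_inv_cancel]
  · filter_upwards [Filter.eventually_ge_atTop (i + j + k + l)] with N hN
    rw [map_commutatorElement, freeLift_x c hij (by omega) (by omega),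
      freeLift_x c hkl (by omega) (by omega)]
    exact IsCentralCover.rootLift_commutator_eq_one _ _ _ _ _ _ _
      (fun e => hjk (congrArg Fin.val e)) (fun e => hil (congrArg Fin.val e)) _ _

/-- The words that become trivial for all large `N` form a normal subgroup containing the relators.
In this way the covers for different `N` need no maps between them. -/
theorem eventually_freeLift_eq_one {w : FreeGroup (Gen K)}
    (hw : PresentedGroup.mk (Rels K) w = 1) : ∀ᶠ N in Filter.atTop, freeLift c N w = 1 := by
  have h1 : w ∈ Subgroup.normalClosure (Rels K) := (QuotientGroup.eq_one_iff w).1 hw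
  let S : Subgroup (FreeGroup (Gen K)) :=
    { carrier := {w | ∀ᶠ N in Filter.atTop, freeLift c N w = 1}
      one_mem' := Filter.Eventually.of_forall fun N => map_one _
      mul_mem' := fun ha hb => (Filter.Eventually.and ha hb).mono fun N h => by
        rw [map_mul, h.1, h.2, mul_one]
      inv_mem' := fun ha => Filter.Eventually.mono ha fun N h => by rw [map_inv, h, inv_one] }
  have hS : S.Normal := ⟨fun a ha g => Filter.Eventually.mono ha fun N h => by
    rw [map_mul, map_mul, h, mul_one, ← map_mul, mul_inv_cancel, map_one]⟩
  exact Subgroup.normalClosure_le_normal (N := S) (fun r hr => eventually_freeLift_rel c hr) h1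

/-- `z ∈ St(K)` lifts to a word which maps to the constant `a` in almost all finite central
extensions. -/
def IsSymbolValue (z : St K) (a : A) : Prop :=
  ∃ w, PresentedGroup.mk (Rels K) w = z ∧
    ∀ᶠ N in Filter.atTop, freeLift c N w = symbolCoverConst c N (Multiplicative.ofAdd a)

variable {c}

/-- Two words for `z` have the same image for large `N`, and constants embed into each cover. -/
theorem IsSymbolValue.unique {z : St K} {a b : A} (ha : IsSymbolValue c z a)
    (hb : IsSymbolValue c z b) : a = b := by
  obtain ⟨w, hw, ha⟩ := ha
  obtain ⟨w', hw', hb⟩ := hb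
  have h1 := eventually_freeLift_eq_one c (w := w * w'⁻¹)
    (by rw [map_mul, map_inv, hw, hw', mul_inv_cancel])
  obtain ⟨N, ⟨h1, h2⟩, h3⟩ := ((h1.and ha).and hb).exists
  rw [map_mul, map_inv, mul_inv_eq_one, h2, h3] at h1
  exact symbolCoverConst_injective c N h1

theorem IsSymbolValue.mul {z z' : St K} {a a' : A} (ha : IsSymbolValue c z a)
    (ha' : IsSymbolValue c z' a') : IsSymbolValue c (z * z') (a + a') := by
  obtain ⟨w, hw, ha⟩ := ha
  obtain ⟨w', hw', ha'⟩ := ha'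
  refine ⟨w * w', by rw [map_mul, hw, hw'], (ha.and ha').mono fun N h => ?_⟩
  rw [map_mul, h.1, h.2, ofAdd_add, map_mul]

theorem IsSymbolValue.inv {z : St K} {a : A} (ha : IsSymbolValue c z a) :
    IsSymbolValue c z⁻¹ (-a) := by
  obtain ⟨w, hw, ha⟩ := ha
  refine ⟨w⁻¹, by rw [map_inv, hw], ha.mono fun N h => ?_⟩
  rw [map_inv, h, ofAdd_neg, map_inv]

variable (c)

theorem isSymbolValue_symS (u v : Kˣ) :
    IsSymbolValue c (symS 0 1 zero_ne_one u v) (c u v) := by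
  let W : K → FreeGroup (Gen K) := fun a =>
    x 0 1 zero_ne_one a * x 1 0 one_ne_zero (-a⁻¹) * x 0 1 zero_ne_one a
  let H : K → FreeGroup (Gen K) := fun a => W a * W (-1)
  refine ⟨H u * H v * (H (u * v))⁻¹, rfl, Filter.Eventually.of_forall fun N => ?_⟩
  have hW : ∀ a, freeLift c N (W a) =
      ((isCentralCover_symbolCover c N).rankOne 0 1 zero_ne_one).w a := by
    intro a
    simp only [W]
    rw [map_mul, map_mul, freeLift_x c zero_ne_one (by omega) (by omega),
      freeLift_x c one_ne_zero (by omega) (by omega)]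
    rfl
  have hH : ∀ a, freeLift c N (H a) =
      ((isCentralCover_symbolCover c N).rankOne 0 1 zero_ne_one).h a := by
    intro a
    simp only [H]
    rw [map_mul, hW, hW, RankOne.h]
  rw [map_mul, map_mul, map_inv, hH, hH, hH]
  exact rankOne_symbolCover_sym c N u v

theorem exists_isSymbolValue (z : K2 K) : ∃ a, IsSymbolValue c (z : St K) a := by
  obtain ⟨z, hz⟩ := z
  rw [K2_eq_symGroupS] at hz
  refine Subgroup.closure_induction (p := fun z _ => ∃ a, IsSymbolValue c z a) ?_ ?_ ?_ ?_ hz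
  · rintro _ ⟨u, v, rfl⟩
    exact ⟨_, isSymbolValue_symS c u v⟩
  · exact ⟨0, 1, map_one _, Filter.Eventually.of_forall fun N => by
      rw [map_one, ofAdd_zero, map_one]⟩
  · rintro a b _ _ ⟨_, ha⟩ ⟨_, hb⟩
    exact ⟨_, ha.mul hb⟩
  · rintro a _ ⟨_, ha⟩
    exact ⟨_, ha.inv⟩

/-- Matsumoto's theorem: every Steinberg symbol is induced by a homomorphism from `K_2(K)`. -/
theorem exists_hom_of_symbol : ∃ φ : Additive (K2 K) →+ A,
    ∀ u v : Kˣ, φ (Additive.ofMul ⟨_, symS_mem_K2 0 1 zero_ne_one u v⟩) = c u v := by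
  choose f hf using exists_isSymbolValue c
  refine ⟨AddMonoidHom.mk' (fun z => f z.toMul) fun z z' => ?_, fun u v => ?_⟩
  · exact (hf (z.toMul * z'.toMul)).unique ((hf z.toMul).mul (hf z'.toMul))
  · exact (hf ⟨_, symS_mem_K2 0 1 zero_ne_one u v⟩).unique (isSymbolValue_symS c u v)

end

section

/-! ### The central extension of a cocycle -/

/-- The underlying set of the central extension attached to a 2-cocycle. -/
@[ext]
structure CocycleExt {G A : Type u} [Group G] [AddCommGroup A] (f : G × G → A)
    (hf : ∀ g h j : G, f (g * h, j) + f (g, h) = f (h, j) + f (g, h * j)) : Type u where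
  coeff : A
  base : G

namespace CocycleExt

variable {G A : Type u} [Group G] [AddCommGroup A] {f : G × G → A}
  {hf : ∀ g h j : G, f (g * h, j) + f (g, h) = f (h, j) + f (g, h * j)}

theorem map_one_left (hf : ∀ g h j : G, f (g * h, j) + f (g, h) = f (h, j) + f (g, h * j)) (g : G) :
    f (1, g) = f (1, 1) := by
  have := hf 1 1 g
  rw [one_mul, one_mul] at this
  exact (add_left_cancel this).symm

theorem map_one_right (hf : ∀ g h j : G, f (g * h, j) + f (g, h) = f (h, j) + f (g, h * j))
    (g : G) : f (g, 1) = f (1, 1) := by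
  have := hf g 1 1
  rw [mul_one, mul_one] at this
  exact add_right_cancel this

/-- The cocycle need not be normalized, so the neutral element has coefficient `-f (1, 1)`, and the
inverse and the inclusion of the kernel carry the same correction. -/
instance : Group (CocycleExt f hf) :=
  letI : Mul (CocycleExt f hf) := ⟨fun x y => ⟨x.coeff + y.coeff + f (x.base, y.base),
    x.base * y.base⟩⟩
  letI : One (CocycleExt f hf) := ⟨⟨-f (1, 1), 1⟩⟩
  letI : Inv (CocycleExt f hf) := ⟨fun x => ⟨-x.coeff - f (x.base⁻¹, x.base) - f (1, 1), x.base⁻¹⟩⟩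
  Group.ofLeftAxioms
    (fun x y z => CocycleExt.ext (by
      change x.coeff + y.coeff + f (x.base, y.base) + z.coeff + f (x.base * y.base, z.base) =
        x.coeff + (y.coeff + z.coeff + f (y.base, z.base)) + f (x.base, y.base * z.base)
      linear_combination (norm := abel) hf x.base y.base z.base) (mul_assoc _ _ _))
    (fun x => CocycleExt.ext (by
      change -f (1, 1) + x.coeff + f (1, x.base) = x.coeff
      rw [map_one_left hf x.base]
      abel) (one_mul _))
    (fun x => CocycleExt.ext (by
      change -x.coeff - f (x.base⁻¹, x.base) - f (1, 1) + x.coeff + f (x.base⁻¹, x.base) = -f (1, 1)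
      abel) (inv_mul_cancel _))

theorem coeff_mul (x y : CocycleExt f hf) :
    (x * y).coeff = x.coeff + y.coeff + f (x.base, y.base) := rfl

variable (f hf) in
/-- The projection of the extension. -/
def proj : CocycleExt f hf →* G where
  toFun := base
  map_one' := rfl
  map_mul' _ _ := rfl

variable (f hf) in
/-- The inclusion of the kernel of the extension. -/
def const : Multiplicative A →* CocycleExt f hf where
  toFun a := ⟨a.toAdd - f (1, 1), 1⟩
  map_one' := CocycleExt.ext (zero_sub _) rfl
  map_mul' a b := CocycleExt.ext (by
    change a.toAdd + b.toAdd - f (1, 1) = a.toAdd - f (1, 1) + (b.toAdd - f (1, 1)) + f (1, 1)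
    abel) (one_mul 1).symm

theorem const_injective : Function.Injective (const f hf) := fun _ _ h =>
  Multiplicative.toAdd.injective (sub_left_injective (congrArg coeff h))

theorem exists_const {x : CocycleExt f hf} (h : proj f hf x = 1) : ∃ a, x = const f hf a :=
  ⟨Multiplicative.ofAdd (x.coeff + f (1, 1)), CocycleExt.ext (add_sub_cancel_right _ _).symm h⟩

theorem coeff_const_mul (a : Multiplicative A) (x : CocycleExt f hf) :
    (const f hf a * x).coeff = a.toAdd + x.coeff := by
  rw [coeff_mul]
  change a.toAdd - f (1, 1) + x.coeff + f (1, x.base) = _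
  rw [map_one_left hf x.base]
  abel

theorem const_mem_center (a : Multiplicative A) :
    const f hf a ∈ Subgroup.center (CocycleExt f hf) := by
  refine Subgroup.mem_center_iff.2 fun x => CocycleExt.ext ?_ ?_
  · rw [coeff_const_mul, coeff_mul]
    change x.coeff + (a.toAdd - f (1, 1)) + f (x.base, 1) = _
    rw [map_one_right hf x.base]
    abel
  · exact (mul_one x.base).trans (one_mul x.base).symm

theorem isCentralCover {K : Type u} [Field K] {n : ℕ} {f : GL (Fin n) K × GL (Fin n) K → A}
    {hf : ∀ g h j, f (g * h, j) + f (g, h) = f (h, j) + f (g, h * j)} :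
    IsCentralCover (proj f hf) where
  surjective g := ⟨⟨0, g⟩, rfl⟩
  mem_center z hz := by
    obtain ⟨a, rfl⟩ := exists_const hz
    exact const_mem_center a

end CocycleExt

/-! ### Surjectivity -/

theorem IsCentralCover.map_rankOne_sym {K : Type u} [Field K] {n : ℕ} {E : Type*} [Group E]
    {p : E →* GL (Fin n) K} (hp : IsCentralCover p) [Infinite K] (i j : Fin n) (h : i ≠ j)
    (u v : Kˣ) : p ((hp.rankOne i j h).sym u v) = 1 := by
  rw [RankOne.sym, map_mul, map_mul, map_inv, ← Units.val_mul, hp.map_rankOne_h,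
    hp.map_rankOne_h, hp.map_rankOne_h, ← map_mul, mul_inv_eq_one]
  congr 1
  funext k
  rw [Pi.mul_apply]
  split_ifs
  · rfl
  · rw [mul_inv]
  · rw [mul_one]

theorem diag2_eq_diagGL {K : Type u} [Field K] (u : Kˣ) : diag2 K u = diagGL ![u, 1] := by
  apply Units.ext
  rw [diag2_val, diagGL_val]
  ext i j
  fin_cases i <;> fin_cases j <;> simp

/-- A central cover of `GL_2(K)` with a lift of the torus `diag(u, 1)`. -/
def IsCentralCover.splitRankOne {K : Type u} [Field K] [Infinite K] {E : Type*} [Group E]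
    {p : E →* GL (Fin 2) K} (hp : IsCentralCover p) (t : Kˣ →* E) (ht : ∀ u, p (t u) = diag2 K u) :
    SplitRankOne K E where
  toRankOne := hp.rankOne 0 1 zero_ne_one
  t := t
  t_x u a := by
    have := hp.rankOne_torus_x 0 1 zero_ne_one ((ht u).trans (diag2_eq_diagGL u)) a
    rwa [Matrix.cons_val_zero, Matrix.cons_val_one, Matrix.cons_val_fin_one, div_one] at this
  t_y u a := by
    have := hp.rankOne_torus_y 0 1 zero_ne_one ((ht u).trans (diag2_eq_diagGL u)) a
    rwa [Matrix.cons_val_zero, Matrix.cons_val_one, Matrix.cons_val_fin_one, div_one] at this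
  sym_central u v := hp.mem_center _ (hp.map_rankOne_sym _ _ _ u v)

/-- The product of two rank one pairs. -/
def SplitRankOne.prod {K E E' : Type*} [Field K] [Group E] [Group E'] (R : SplitRankOne K E)
    (R' : SplitRankOne K E') : SplitRankOne K (E × E') where
  x a := (R.x a, R'.x a)
  y a := (R.y a, R'.y a)
  x_add a b := Prod.ext (R.x_add a b) (R'.x_add a b)
  y_add a b := Prod.ext (R.y_add a b) (R'.y_add a b)
  weyl u hu a := Prod.ext (R.weyl u hu a) (R'.weyl u hu a)
  t := R.t.prod R'.t
  t_x u a := Prod.ext (R.t_x u a) (R'.t_x u a)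
  t_y u a := Prod.ext (R.t_y u a) (R'.t_y u a)
  sym_central u v := Subgroup.mem_center_iff.2 fun g =>
    Prod.ext (R.mul_comm_sym u v g.1) (R'.mul_comm_sym u v g.2)

variable {K A : Type u} [Field K] [Infinite K] [AddCommGroup A]

/-- A class on `GL_2(K)` which is trivial on the torus `diag(u, 1)` is a push-forward. -/
theorem exists_pushHom_eq (c : H2 (GL (Fin 2) K) A) (hc : H2map A (diag2 K) c = 0) :
    ∃ φ, pushHom K A φ = c := by
  obtain ⟨f, hf, rfl⟩ := exists_classOf c
  rw [H2map_classOf, classOf_eq_zero_iff] at hc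
  obtain ⟨b, hb⟩ := hc
  have hp : IsCentralCover (CocycleExt.proj f hf) := CocycleExt.isCentralCover
  -- The cochain `b` that trivializes the class on the torus is, up to sign, the coefficient of a
  -- lift of the torus.
  let t : Kˣ →* CocycleExt f hf := MonoidHom.mk' (fun u => ⟨-b u, diag2 K u⟩) fun u v =>
    CocycleExt.ext (by
      rw [CocycleExt.coeff_mul]
      change -b (u * v) = -b u + -b v + f (diag2 K u, diag2 K v)
      rw [hb]
      abel) (map_mul _ _ _)
  let R : SplitRankOne K (CocycleExt f hf) := hp.splitRankOne t fun u => rfl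
  have hsym : ∀ u v : Kˣ, ∃ a, R.sym u v = CocycleExt.const f hf a := fun u v =>
    CocycleExt.exists_const (hp.map_rankOne_sym 0 1 zero_ne_one u v)
  choose s hs using hsym
  let S : Symbol K A :=
    { toFun := fun u v => (s u v).toAdd
      mul_left := fun u v w => by
        rw [← toAdd_mul]
        congr 1
        apply CocycleExt.const_injective (hf := hf)
        rw [map_mul, ← hs, ← hs, ← hs, R.sym_mul_left]
      mul_right := fun u v w => by
        rw [← toAdd_mul]
        congr 1
        apply CocycleExt.const_injective (hf := hf)
        rw [map_mul, ← hs, ← hs, ← hs, R.sym_mul_right]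
      steinberg := fun u v h => by
        have e : (v : K) = 1 - u := eq_sub_of_add_eq' h
        rw [← toAdd_one]
        congr 1
        apply CocycleExt.const_injective (hf := hf)
        rw [map_one, ← hs, e, R.sym_one_sub u.ne_zero (e ▸ v.ne_zero)] }
  obtain ⟨φ, hφ⟩ := exists_hom_of_symbol S
  -- Pairing the root elements and tori of both extensions generates a subgroup of their product
  -- lying over the diagonal copy of `GL_2(K)`.
  let Q := (rankOneHat K).prod R
  let p : GL2hat K × CocycleExt f hf →* GL (Fin 2) K := (toGL2 K).comp (MonoidHom.fst _ _)
  have hx : ∀ a, p (Q.x a) = elemGL 0 1 zero_ne_one a := toGL2_rankOneHat_x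
  have hy : ∀ a, p (Q.y a) = elemGL 1 0 one_ne_zero a := toGL2_rankOneHat_y
  have ht : ∀ u, p (Q.t u) = diag2 K u := toGL2_rankOneHat_t
  have hgen : Q.generated ≤ p.eqLocus ((CocycleExt.proj f hf).comp (MonoidHom.snd _ _)) := by
    rw [SplitRankOne.generated, Subgroup.closure_le]
    rintro _ ((⟨a, rfl⟩ | ⟨a, rfl⟩) | ⟨u, rfl⟩)
    · exact (hx a).trans (hp.map_rootLift 0 1 zero_ne_one a).symm
    · exact (hy a).trans (hp.map_rootLift 1 0 one_ne_zero a).symm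
    · exact ht u
  -- The symbols of the pair are pairs of symbols, and `φ` sends the first to the second; so the
  -- group they generate lies in the graph of `φ`.
  have hsg : ∀ q ∈ Q.symGroup, ∃ k : K2 K, q = ((steinbergExt K).inl k,
      CocycleExt.const f hf (Multiplicative.ofAdd (φ (Additive.ofMul k)))) := by
    let F : K2 K →* GL2hat K × CocycleExt f hf := (steinbergExt K).inl.prod
      ((CocycleExt.const f hf).comp (AddMonoidHom.toMultiplicativeRight φ))
    have hF : Q.symGroup ≤ F.range := by
      rw [SplitRankOne.symGroup, Subgroup.closure_le]
      rintro _ ⟨u, v, rfl⟩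
      refine ⟨⟨_, symS_mem_K2 0 1 zero_ne_one u v⟩, Prod.ext (rankOneHat_sym u v).symm ?_⟩
      change CocycleExt.const f hf (Multiplicative.ofAdd (φ (Additive.ofMul
        ⟨_, symS_mem_K2 0 1 zero_ne_one u v⟩))) = R.sym u v
      rw [hφ, hs]
      rfl
    intro q hq
    obtain ⟨k, rfl⟩ := hF hq
    exact ⟨k, rfl⟩
  -- A section with values in the generated subgroup yields sections of both extensions at once. Its
  -- factor set lies in the kernel part of that subgroup, hence in the graph of `φ`, so the two
  -- factor sets correspond under `φ`.
  choose e he hpe using Q.exists_generated p hx hy ht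
  let σ : (steinbergExt K).Section := ⟨fun g => (e g).1, hpe⟩
  refine ⟨φ, ?_⟩
  change pushClass steinbergExt_central (hatSection K) φ = _
  rw [pushClass_eq steinbergExt_central (hatSection K) σ, eq_comm]
  refine (classOf_eq_iff _ _ _ _).2 ⟨fun g => -(e g).2.coeff, fun g h => ?_⟩
  obtain ⟨k, hk⟩ := hsg _ (Q.mem_symGroup p hx hy ht
    (mul_mem (mul_mem (he g) (he h)) (inv_mem (he (g * h))))
    (by rw [map_mul, map_mul, map_inv, hpe, hpe, hpe, mul_inv_cancel]))
  have h1 : factorSet σ (g, h) = k := by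
    apply (steinbergExt K).inl_injective
    rw [inl_factorSet]
    exact congrArg Prod.fst hk
  have hbase : ∀ g, (e g).2.base = g := fun g => (hgen (he g)).symm.trans (hpe g)
  have h2 := congrArg Prod.snd hk
  change (e g).2 * (e h).2 * ((e (g * h)).2)⁻¹ = _ at h2
  rw [mul_inv_eq_iff_eq_mul] at h2
  have h3 := congrArg CocycleExt.coeff h2
  rw [CocycleExt.coeff_const_mul, CocycleExt.coeff_mul, hbase, hbase, toAdd_ofAdd] at h3
  dsimp only
  rw [h1]
  linear_combination (norm := abel) h3

end

end

end Steinberg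

theorem proposition1 (K A : Type u) [Field K] [Infinite K] [AddCommGroup A] :
    (Steinberg.steinbergExt K).inl.range ≤ Subgroup.center (Steinberg.GL2hat K) ∧
    (∃ σ : Kˣ →* Steinberg.GL2hat K, (Steinberg.steinbergExt K).rightHom.comp σ = Steinberg.diag2 K) ∧
    ∃ e : (Steinberg.H2 Kˣ A × (Additive (Steinberg.K2 K) →+ A)) ≃+ Steinberg.H2 (GL (Fin 2) K) A,
      (∀ c : Steinberg.H2 Kˣ A,
        e (c, 0) = Steinberg.H2map A (GeneralLinearGroup.det (n := Fin 2) (R := K)) c) ∧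
      (∀ φ : Additive (Steinberg.K2 K) →+ A,
        Steinberg.IsPushforwardClass (Steinberg.steinbergExt K) φ (e (0, φ))) := by
  refine ⟨Steinberg.steinbergExt_central, ⟨_, Steinberg.rightHom_comp_inr⟩,
    Steinberg.exists_equiv_of_surjective Steinberg.exists_pushHom_eq⟩
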